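/- Theorem 1.2. Let $p,q,r\ge 0$ be integers, at most one of which is $0$, and let $\theta(p,q,r)$ be the simple graph on $p+q+r+2$ vertices consisting of two given vertices joined by three internally disjoint paths that have $p$, $q$ and $r$ inner vertices, respectively. For a finite simple graph $G$ with degree matrix $D(G)$, adjacency matrix $A(G)$ and Laplacian matrix $L(G)=D(G)-A(G)$, let $\pi(L(G);x)=\operatorname{per}(xI-L(G))$ be its Laplacian permanental polynomial, where $\operatorname{per}(X)=\sum_{\sigma}\prod_{i} x_{i\sigma(i)}$, the sum running over all permutations $\sigma$ of the vertices. Then $\theta(p,q,r)$ is determined by its Laplacian permanental polynomial: every finite simple graph $H$ with $\pi(L(H);x)=\pi(L(\theta(p,q,r));x)$ is isomorphic to $\theta(p,q,r)$. -/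

import Mathlib

open Polynomial

/-- The Laplacian permanental polynomial `per (x I - L(G))` of a finite simple graph, where
`L(G) = D(G) - A(G)`; the matrix `Matrix.charmatrix M` is `x I - M`. -/
noncomputable def lapPermPoly {V : Type*} [Fintype V] [DecidableEq V] (G : SimpleGraph V)
    [DecidableRel G.Adj] : ℤ[X] :=
  (G.lapMatrix ℤ).charmatrix.permanent

/-- Two finite simple graphs are Laplacian copermanental if they have the same Laplacian
permanental polynomial. -/
def LaplacianCopermanental {V W : Type*} [Fintype V] [DecidableEq V] [Fintype W] [DecidableEq W]
    (G : SimpleGraph V) [DecidableRel G.Adj] (H : SimpleGraph W) [DecidableRel H.Adj] : Prop :=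
  lapPermPoly G = lapPermPoly H

/-- The vertices of the theta graph: two end vertices `inl 0`, `inl 1`, and three pairwise disjoint
sets of inner vertices, with `p`, `q` and `r` elements. -/
abbrev ThetaVertex (p q r : ℕ) : Type :=
  Fin 2 ⊕ (Σ i : Fin 3, Fin (![p, q, r] i))

/-- The vertices of the `i`-th path in order: position `0` is the end vertex `inl 0`, the positions
`1, …, l` (where `l` is `p`, `q` or `r`) are the inner vertices, and position `l + 1` is the end
vertex `inl 1`. Larger positions are not used. -/
def thetaPath (p q r : ℕ) (i : Fin 3) (k : ℕ) : ThetaVertex p q r :=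
  if k = 0 then Sum.inl 0
  else if h : k - 1 < ![p, q, r] i then Sum.inr ⟨i, ⟨k - 1, h⟩⟩
  else Sum.inl 1

/-- The theta graph `θ(p, q, r)`: two vertices joined by three internally disjoint paths with `p`,
`q` and `r` inner vertices. Its edges join consecutive vertices of one of the three paths. -/
def thetaGraph (p q r : ℕ) : SimpleGraph (ThetaVertex p q r) :=
  SimpleGraph.fromRel fun x y =>
    ∃ (i : Fin 3) (k : Fin (![p, q, r] i + 1)),
      x = thetaPath p q r i k ∧ y = thetaPath p q r i ((k : ℕ) + 1)

instance (p q r : ℕ) : DecidableRel (thetaGraph p q r).Adj := fun x y =>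
  decidable_of_iff' _ (SimpleGraph.fromRel_adj _ x y)

/-!
Put `x = y + 2`. Then `x I - L(H)` has diagonal entry `y` at the vertices of degree two, `y - 1`
at those of degree three, and every path through vertices of degree two is governed by the
Fibonacci polynomials `F (n + 2) = y F (n + 1) + F n` (`fibPoly`).

The degree of the polynomial and the two coefficients below the leading one determine the number of
vertices, the sum and the sum of squares of the degrees. In a theta graph two vertices have degree
three and all others degree two, so the nonnegative integers `(d - 2) * (d - 3)` add up to zero, also for
`H`, and `H` has the same degrees (`exists_degrees_of_copermanental`). Following vertices of
degree two shows that `H` is a theta graph or a dumbbell (two cycles joined by a path), together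
with some disjoint cycles (`exists_theta_or_dumbbell`, `exists_cycles`), so that its polynomial is
an explicit product of `thetaVal` or `dumbbellVal` with factors `cycleVal`. It remains to compare
such products with `thetaVal`.

* Modulo `y ^ 2`, in the dual numbers over `ℤ`, the constant coefficients depend on parities only,
  and the linear ones are linear in the parameters. This already excludes dumbbells and extra
  cycles, unless all three paths have an odd number of inner vertices and there are cycles
  (`thetaVal_ne_dumbbellVal`, `cycles_eq_zero_of_thetaVal_eq`).
* In that case no `cycleVal` divides `thetaVal` (`cycles_eq_zero_of_odd`). For an odd cycle,
  `cycleVal` has a negative root, whereas `thetaVal` is negative on the negative half line. For an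
  even cycle, `cycleVal` has double roots `± 2 i cos ψ`, where `F n = i ^ (n - 1) sin (n ψ) / sin
  ψ`. A double root of the even part of `thetaVal` means that `cot (A t) + cot (B t) + cot (C t) -
  cot t` vanishes together with its derivative at `ψ`, for `A`, `B`, `C` the lengths of the paths,
  or that the three sines vanish. The first is impossible by `|sin (n ψ)| ≤ n sin ψ`
  (`sin_eq_zero_of_spider`), the second because of the derivative of the odd part
  (`not_thetaVal_dual_eq_zero`).
* So `H` is a theta graph, and it has the right lengths because the substitution `y = e⁻¹ - e`
  turns `thetaVal` into a sparse polynomial in `e`, whose lowest terms show the smallest length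
  and then the second one (`eq_of_thetaVal_eq`).
-/


/-! ### Permanents of principal submatrices -/

/-- The permanent of the submatrix of `B` with rows and columns in `S`. -/
def permOn {W R : Type*} [Fintype W] [DecidableEq W] [CommRing R] (B : W → W → R)
    (S : Finset W) : R :=
  ∑ σ : Equiv.Perm W with ∀ i ∉ S, σ i = i, ∏ i ∈ S, B i (σ i)

/-- The part of the permanent on `S` in which `x` is sent to `z`, without the factor `B x z`. For
`x ≠ z` these permutations consist of a path from `z` to `x` and a permutation of the rest. -/
def permPath {W R : Type*} [Fintype W] [DecidableEq W] [CommRing R] (B : W → W → R)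
    (S : Finset W) (x z : W) : R :=
  ∑ σ : Equiv.Perm W with (∀ i ∉ S, σ i = i) ∧ σ x = z, ∏ i ∈ S.erase x, B i (σ i)

section Permanents

variable {W R : Type*} [Fintype W] [DecidableEq W] [CommRing R] (B : W → W → R)

theorem permOn_univ : permOn B Finset.univ = Matrix.permanent (Matrix.of B) := by
  rw [← Matrix.permanent_transpose]
  simp [permOn, Matrix.permanent]

theorem permOn_empty : permOn B ∅ = 1 := by
  have : (Finset.univ.filter fun σ : Equiv.Perm W => ∀ i ∉ (∅ : Finset W), σ i = i) = {1} := by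
    ext σ
    simp [Equiv.ext_iff]
  rw [permOn, this]
  simp

theorem permOn_eq_sum_row {S : Finset W} {w : W} (hw : w ∈ S) :
    permOn B S = ∑ j ∈ S, B w j * permPath B S w j := by
  have hmem : ∀ σ ∈ (Finset.univ.filter fun σ : Equiv.Perm W => ∀ i ∉ S, σ i = i), σ w ∈ S := by
    intro σ hσ
    simp only [Finset.mem_filter, Finset.mem_univ, true_and] at hσ
    by_contra h
    have := hσ _ h
    rw [σ.injective this] at h
    exact h hw
  rw [permOn, ← Finset.sum_fiberwise_of_maps_to hmem]
  refine Finset.sum_congr rfl fun j _ => ?_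
  rw [permPath, Finset.mul_sum, Finset.filter_filter]
  refine Finset.sum_congr rfl fun σ hσ => ?_
  simp only [Finset.mem_filter, Finset.mem_univ, true_and] at hσ
  rw [← Finset.mul_prod_erase _ _ hw, hσ.2]

theorem permPath_self {S : Finset W} {w : W} (hw : w ∈ S) :
    permPath B S w w = permOn B (S.erase w) := by
  rw [permPath, permOn]
  refine Finset.sum_congr ?_ fun _ _ => rfl
  ext σ
  simp only [Finset.mem_filter, Finset.mem_univ, true_and, Finset.mem_erase, not_and_or, not_not]
  constructor
  · rintro ⟨h1, h2⟩ i (rfl | hi)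
    · exact h2
    · exact h1 i hi
  · intro h
    exact ⟨fun i hi => h i (Or.inr hi), h w (Or.inl rfl)⟩

theorem permPath_eq_sum_col {S : Finset W} {x z : W} (hx : x ∈ S) (hxz : x ≠ z) :
    permPath B S x z = ∑ i ∈ S.erase x, B i x * permPath B (S.erase x) i z := by
  have hmem : ∀ σ ∈ (Finset.univ.filter fun σ : Equiv.Perm W => (∀ i ∉ S, σ i = i) ∧ σ x = z),
      σ.symm x ∈ S.erase x := by
    intro σ hσ
    simp only [Finset.mem_filter, Finset.mem_univ, true_and] at hσ
    rw [Finset.mem_erase]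
    constructor
    · intro h
      rw [Equiv.symm_apply_eq] at h
      exact hxz (h.trans hσ.2)
    · by_contra h
      have h1 := hσ.1 _ h
      rw [Equiv.apply_symm_apply] at h1
      exact h (h1 ▸ hx)
  rw [permPath, ← Finset.sum_fiberwise_of_maps_to hmem]
  refine Finset.sum_congr rfl fun i hi => ?_
  rw [permPath, Finset.mul_sum, Finset.filter_filter]
  have hix : i ≠ x := (Finset.mem_erase.1 hi).1
  have hiS : i ∈ S := (Finset.mem_erase.1 hi).2
  -- a permutation with `i ↦ x ↦ z` is contracted to one that fixes `x` and sends `i` to `z`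
  refine Finset.sum_bij' (fun σ _ => σ * Equiv.swap x i) (fun σ _ => σ * Equiv.swap x i)
    ?_ ?_ ?_ ?_ ?_
  · intro σ hσ
    simp only [Finset.mem_filter, Finset.mem_univ, true_and] at hσ ⊢
    obtain ⟨⟨h1, h2⟩, h3⟩ := hσ
    rw [Equiv.symm_apply_eq] at h3
    refine ⟨fun k hk => ?_, by simp [h2]⟩
    rw [Finset.mem_erase, not_and_or, not_not] at hk
    by_cases hkx : k = x
    · subst hkx
      simp [← h3]
    · have hkS := hk.resolve_left hkx
      have hki : k ≠ i := fun h => hkS (h ▸ hiS)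
      simp [Equiv.swap_apply_of_ne_of_ne hkx hki, h1 k hkS]
  · intro σ hσ
    simp only [Finset.mem_filter, Finset.mem_univ, true_and] at hσ ⊢
    obtain ⟨h1, h2⟩ := hσ
    have hx1 : σ x = x := h1 x (by simp)
    refine ⟨⟨fun k hk => ?_, by simp [h2]⟩, ?_⟩
    · have hkx : k ≠ x := fun h => hk (h ▸ hx)
      have hki : k ≠ i := fun h => hk (h ▸ hiS)
      simp [Equiv.swap_apply_of_ne_of_ne hkx hki, h1 k (by simp [hk])]
    · rw [Equiv.symm_apply_eq]
      simp [hx1]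
  · intro σ _
    simp [mul_assoc]
  · intro σ _
    simp [mul_assoc]
  · intro σ hσ
    simp only [Finset.mem_filter, Finset.mem_univ, true_and] at hσ
    obtain ⟨⟨h1, h2⟩, h3⟩ := hσ
    rw [Equiv.symm_apply_eq] at h3
    rw [← Finset.mul_prod_erase _ _ hi, ← h3]
    congr 1
    refine Finset.prod_congr rfl fun k hk => ?_
    simp only [Finset.mem_erase] at hk
    rw [Equiv.Perm.mul_apply, Equiv.swap_apply_of_ne_of_ne hk.2.1 hk.1]

theorem permPath_comm (hB : ∀ i j, B i j = B j i) (S : Finset W) (x z : W) :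
    permPath B S x z = permPath B S z x := by
  rw [permPath, permPath]
  refine Finset.sum_bij' (fun σ _ => σ⁻¹) (fun σ _ => σ⁻¹) ?_ ?_ ?_ ?_ ?_
  · intro σ hσ
    simp only [Finset.mem_filter, Finset.mem_univ, true_and] at hσ ⊢
    exact ⟨fun i hi => by rw [Equiv.Perm.inv_eq_iff_eq, hσ.1 i hi],
      by rw [Equiv.Perm.inv_eq_iff_eq, hσ.2]⟩
  · intro σ hσ
    simp only [Finset.mem_filter, Finset.mem_univ, true_and] at hσ ⊢
    exact ⟨fun i hi => by rw [Equiv.Perm.inv_eq_iff_eq, hσ.1 i hi],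
      by rw [Equiv.Perm.inv_eq_iff_eq, hσ.2]⟩
  · simp
  · simp
  · intro σ hσ
    simp only [Finset.mem_filter, Finset.mem_univ, true_and] at hσ
    obtain ⟨h1, h2⟩ := hσ
    refine Finset.prod_bij' (fun i _ => σ i) (fun i _ => σ⁻¹ i) ?_ ?_ ?_ ?_ ?_
    · intro i hi
      simp only [Finset.mem_erase] at hi ⊢
      refine ⟨fun h => hi.1 (σ.injective (h.trans h2.symm)), ?_⟩
      by_contra h
      rw [σ.injective (h1 _ h)] at h
      exact h hi.2
    · intro i hi
      simp only [Finset.mem_erase] at hi ⊢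
      refine ⟨fun h => hi.1 ?_, ?_⟩
      · rw [Equiv.Perm.inv_eq_iff_eq] at h
        rw [h, h2]
      · by_contra h
        have h3 := h1 _ h
        rw [show σ (σ⁻¹ i) = i by simp] at h3
        exact h (h3 ▸ hi.2)
    · simp
    · simp
    · intro i _
      simp [hB i]

/-- Expansion along the row and the column of `w`. -/
theorem permOn_eq_expand {S : Finset W} {w : W} (hw : w ∈ S) :
    permOn B S = B w w * permOn B (S.erase w) +
      ∑ j ∈ S.erase w, B w j * ∑ i ∈ S.erase w, B i w * permPath B (S.erase w) i j := by
  rw [permOn_eq_sum_row B hw, ← Finset.add_sum_erase _ _ hw, permPath_self B hw]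
  congr 1
  refine Finset.sum_congr rfl fun j hj => ?_
  rw [permPath_eq_sum_col B hw (Finset.mem_erase.1 hj).1.symm]

end Permanents

/-! ### Pendant paths and Fibonacci polynomials -/

/-- The Fibonacci polynomials at `y`: `fibPoly y (k + 1)` is the permanent of `y I + A` for the path
with `k` vertices. -/
def fibPoly {R : Type*} [CommRing R] (y : R) : ℕ → R
  | 0 => 0
  | 1 => 1
  | n + 2 => y * fibPoly y (n + 1) + fibPoly y n

/-- The matrix `x I - L(G)` at `x = y + 2`, so that vertices of degree two have diagonal entry `y`
and vertices of degree three have diagonal entry `y - 1`. -/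
def shiftMat {W R : Type*} [Fintype W] [DecidableEq W] [CommRing R] (G : SimpleGraph W)
    [DecidableRel G.Adj] (y : R) (i j : W) : R :=
  if i = j then y + 2 - (G.degree i : R) else if G.Adj i j then 1 else 0

/-- The vertices `w 1, …, w L`. -/
def innerVerts {W : Type*} [DecidableEq W] (w : ℕ → W) (L : ℕ) : Finset W :=
  (Finset.range L).image fun k => w (k + 1)

section InnerVerts

variable {W : Type*} [DecidableEq W]

theorem mem_innerVerts {w : ℕ → W} {L : ℕ} {t : W} :
    t ∈ innerVerts w L ↔ ∃ k < L, w (k + 1) = t := by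
  simp [innerVerts]

theorem last_mem_innerVerts {w : ℕ → W} {L : ℕ} (hL : L ≠ 0) : w L ∈ innerVerts w L :=
  mem_innerVerts.2 ⟨L - 1, by omega, by congr 1; omega⟩

theorem first_mem_innerVerts {w : ℕ → W} {L : ℕ} (hL : L ≠ 0) : w 1 ∈ innerVerts w L :=
  mem_innerVerts.2 ⟨0, by omega, rfl⟩

theorem innerVerts_zero (w : ℕ → W) : innerVerts w 0 = ∅ := by simp [innerVerts]

theorem innerVerts_succ (w : ℕ → W) (L : ℕ) :
    innerVerts w (L + 1) = insert (w (L + 1)) (innerVerts w L) := by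
  simp [innerVerts, Finset.range_add_one, Finset.image_insert]

theorem union_innerVerts_succ_erase {S : Finset W} {w : ℕ → W} {L : ℕ}
    (h : w (L + 1) ∉ S ∪ innerVerts w L) :
    (S ∪ innerVerts w (L + 1)).erase (w (L + 1)) = S ∪ innerVerts w L := by
  rw [innerVerts_succ, Finset.union_insert, Finset.erase_insert h]

theorem union_erase_of_notMem {S I : Finset W} {x : W} (h : x ∉ I) :
    (S ∪ I).erase x = S.erase x ∪ I := by
  rw [Finset.erase_union_distrib, Finset.erase_eq_of_notMem h]

theorem innerVerts_reverse (w : ℕ → W) (L : ℕ) :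
    innerVerts (fun k => w (L + 1 - k)) L = innerVerts w L := by
  ext t
  simp only [mem_innerVerts]
  constructor
  · rintro ⟨k, hk, rfl⟩
    exact ⟨L - 1 - k, by omega, by congr 1; omega⟩
  · rintro ⟨k, hk, rfl⟩
    exact ⟨L - 1 - k, by omega, by congr 1; omega⟩

end InnerVerts

section Expansion

variable {W R : Type*} [Fintype W] [DecidableEq W] [CommRing R] (G : SimpleGraph W)
  [DecidableRel G.Adj] (y : R)

theorem shiftMat_comm (i j : W) : shiftMat G y i j = shiftMat G y j i := by
  unfold shiftMat
  by_cases h : i = j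
  · rw [h]
  · simp [h, Ne.symm h, G.adj_comm]

theorem sum_shiftMat {S N : Finset W} {w : W} (hN : N ⊆ S)
    (h : ∀ t ∈ S, G.Adj w t ↔ t ∈ N) (f : W → R) :
    ∑ i ∈ S.erase w, shiftMat G y w i * f i = ∑ i ∈ N, f i := by
  have hsub : N ⊆ S.erase w := fun t ht => by
    rw [Finset.mem_erase]
    exact ⟨((h t (hN ht)).2 ht).ne', hN ht⟩
  rw [← Finset.sum_subset hsub]
  · refine Finset.sum_congr rfl fun i hi => ?_
    have := (h i (hN hi)).2 hi
    simp [shiftMat, this.ne, this]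
  · intro i hi hiN
    rw [Finset.mem_erase] at hi
    have : ¬ G.Adj w i := fun ha => hiN ((h i hi.2).1 ha)
    simp [shiftMat, hi.1.symm, this]

theorem permOn_expand_nbrs {S N : Finset W} {w : W} (hw : w ∈ S) (hN : N ⊆ S)
    (h : ∀ t ∈ S, G.Adj w t ↔ t ∈ N) :
    permOn (shiftMat G y) S = shiftMat G y w w * permOn (shiftMat G y) (S.erase w) +
      ∑ j ∈ N, ∑ i ∈ N, permPath (shiftMat G y) (S.erase w) i j := by
  rw [permOn_eq_expand _ hw]
  simp_rw [shiftMat_comm G y _ w, sum_shiftMat G y hN h]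

theorem permPath_expand_nbrs {S N : Finset W} {x z : W} (hx : x ∈ S) (hxz : x ≠ z) (hN : N ⊆ S)
    (h : ∀ t ∈ S, G.Adj x t ↔ t ∈ N) :
    permPath (shiftMat G y) S x z = ∑ i ∈ N, permPath (shiftMat G y) (S.erase x) i z := by
  rw [permPath_eq_sum_col _ hx hxz]
  simp_rw [shiftMat_comm G y _ x, sum_shiftMat G y hN h]

theorem permOn_isolated {S : Finset W} {w : W} (hw : w ∈ S) (h : ∀ t ∈ S, ¬ G.Adj w t) :
    permOn (shiftMat G y) S = shiftMat G y w w * permOn (shiftMat G y) (S.erase w) := by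
  rw [permOn_expand_nbrs G y hw (Finset.empty_subset _) (by simpa using h)]
  simp

theorem permOn_leaf {S : Finset W} {w a : W} (hw : w ∈ S) (ha : a ∈ S)
    (h : ∀ t ∈ S, G.Adj w t ↔ t = a) :
    permOn (shiftMat G y) S = shiftMat G y w w * permOn (shiftMat G y) (S.erase w) +
      permOn (shiftMat G y) ((S.erase w).erase a) := by
  rw [permOn_expand_nbrs G y hw (Finset.singleton_subset_iff.2 ha) (by simpa using h)]
  have : a ∈ S.erase w := by
    rw [Finset.mem_erase]
    exact ⟨((h a ha).2 rfl).ne', ha⟩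
  simp [permPath_self _ this]

theorem permOn_two {S : Finset W} {w a b : W} (hw : w ∈ S) (ha : a ∈ S) (hb : b ∈ S) (hab : a ≠ b)
    (h : ∀ t ∈ S, G.Adj w t ↔ t = a ∨ t = b) :
    permOn (shiftMat G y) S = shiftMat G y w w * permOn (shiftMat G y) (S.erase w) +
      permOn (shiftMat G y) ((S.erase w).erase a) + permOn (shiftMat G y) ((S.erase w).erase b) +
      2 * permPath (shiftMat G y) (S.erase w) a b := by
  have hN : ({a, b} : Finset W) ⊆ S := by
    intro t ht
    simp only [Finset.mem_insert, Finset.mem_singleton] at ht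
    rcases ht with rfl | rfl <;> assumption
  rw [permOn_expand_nbrs G y hw hN (by simpa using h)]
  have h1 : a ∈ S.erase w := by
    rw [Finset.mem_erase]
    exact ⟨((h a ha).2 (Or.inl rfl)).ne', ha⟩
  have h2 : b ∈ S.erase w := by
    rw [Finset.mem_erase]
    exact ⟨((h b hb).2 (Or.inr rfl)).ne', hb⟩
  rw [Finset.sum_pair hab, Finset.sum_pair hab, Finset.sum_pair hab, permPath_self _ h1,
    permPath_self _ h2, permPath_comm _ (shiftMat_comm G y) _ b a]
  ring

theorem permPath_leaf {S : Finset W} {x z a : W} (hx : x ∈ S) (hxz : x ≠ z) (ha : a ∈ S)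
    (h : ∀ t ∈ S, G.Adj x t ↔ t = a) :
    permPath (shiftMat G y) S x z = permPath (shiftMat G y) (S.erase x) a z := by
  rw [permPath_expand_nbrs G y hx hxz (Finset.singleton_subset_iff.2 ha) (by simpa using h)]
  simp

theorem permPath_two {S : Finset W} {x z a b : W} (hx : x ∈ S) (hxz : x ≠ z) (ha : a ∈ S)
    (hb : b ∈ S) (hab : a ≠ b) (h : ∀ t ∈ S, G.Adj x t ↔ t = a ∨ t = b) :
    permPath (shiftMat G y) S x z =
      permPath (shiftMat G y) (S.erase x) a z + permPath (shiftMat G y) (S.erase x) b z := by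
  have hN : ({a, b} : Finset W) ⊆ S := by
    intro t ht
    simp only [Finset.mem_insert, Finset.mem_singleton] at ht
    rcases ht with rfl | rfl <;> assumption
  rw [permPath_expand_nbrs G y hx hxz hN (by simpa using h), Finset.sum_pair hab]

variable {G}

theorem shiftMat_self_of_degree_two {v : W} (h : G.degree v = 2) : shiftMat G y v v = y := by
  simp [shiftMat, h]

theorem shiftMat_self_of_degree_three {v : W} (h : G.degree v = 3) :
    shiftMat G y v v = y - 1 := by
  simp only [shiftMat, h, if_true]
  push_cast
  ring

/-- Removal of a pendant path `w 1, …, w L` that is attached to `w 0`. -/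
theorem permOn_pendant {S : Finset W} {w : ℕ → W} {L : ℕ} (h0 : w 0 ∈ S)
    (hmem : ∀ k < L, w (k + 1) ∉ S ∪ innerVerts w k)
    (hadj : ∀ k < L, ∀ t ∈ S ∪ innerVerts w k, G.Adj (w (k + 1)) t ↔ t = w k)
    (hdeg : ∀ k < L, G.degree (w (k + 1)) = 2) :
    permOn (shiftMat G y) (S ∪ innerVerts w L) = fibPoly y (L + 1) * permOn (shiftMat G y) S +
      fibPoly y L * permOn (shiftMat G y) (S.erase (w 0)) := by
  have hwk : ∀ k, w k ∈ S ∪ innerVerts w k := by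
    intro k
    cases k with
    | zero => exact Finset.mem_union_left _ h0
    | succ k => exact Finset.mem_union_right _ (mem_innerVerts.2 ⟨k, Nat.lt_succ_self k, rfl⟩)
  have step : ∀ k < L, permOn (shiftMat G y) (S ∪ innerVerts w (k + 1)) =
      y * permOn (shiftMat G y) (S ∪ innerVerts w k) +
        permOn (shiftMat G y) ((S ∪ innerVerts w k).erase (w k)) := by
    intro k hk
    have hsub : S ∪ innerVerts w k ⊆ S ∪ innerVerts w (k + 1) := by
      rw [innerVerts_succ, Finset.union_insert]
      exact Finset.subset_insert _ _
    rw [permOn_leaf G y (w := w (k + 1)) (a := w k) (hwk (k + 1)) (hsub (hwk k)),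
      shiftMat_self_of_degree_two y (hdeg k hk), union_innerVerts_succ_erase (hmem k hk)]
    intro t ht
    rw [innerVerts_succ, Finset.union_insert, Finset.mem_insert] at ht
    rcases ht with rfl | ht
    · simp only [SimpleGraph.irrefl, false_iff]
      intro h
      exact hmem k hk (h ▸ hwk k)
    · exact hadj k hk t ht
  induction L using Nat.twoStepInduction with
  | zero => simp [innerVerts_zero, fibPoly]
  | one =>
    rw [step 0 one_pos]
    simp [innerVerts_zero, fibPoly]
  | more n ih1 ih2 =>
    rw [step (n + 1) (by omega), union_innerVerts_succ_erase (hmem n (by omega)),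
      ih1 (fun k hk => hmem k (by omega)) (fun k hk => hadj k (by omega))
        (fun k hk => hdeg k (by omega)) (fun k hk => step k (by omega)),
      ih2 (fun k hk => hmem k (by omega)) (fun k hk => hadj k (by omega))
        (fun k hk => hdeg k (by omega)) (fun k hk => step k (by omega))]
    simp only [fibPoly]
    ring

/-- Removal of a path `w 1, …, w L` that has no neighbours outside. -/
theorem permOn_free_path {S : Finset W} {w : ℕ → W} {L : ℕ} (h0 : w 0 ∉ S)
    (hmem : ∀ k < L, w (k + 1) ∉ S ∪ innerVerts w k)
    (hadj : ∀ k < L, ∀ t ∈ S ∪ innerVerts w k, G.Adj (w (k + 1)) t ↔ t = w k)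
    (hdeg : ∀ k < L, G.degree (w (k + 1)) = 2) :
    permOn (shiftMat G y) (S ∪ innerVerts w L) = fibPoly y (L + 1) * permOn (shiftMat G y) S := by
  have hwk : ∀ k, w (k + 1) ∈ S ∪ innerVerts w (k + 1) := fun k =>
    Finset.mem_union_right _ (mem_innerVerts.2 ⟨k, Nat.lt_succ_self k, rfl⟩)
  have step : ∀ k, k + 1 < L → permOn (shiftMat G y) (S ∪ innerVerts w (k + 2)) =
      y * permOn (shiftMat G y) (S ∪ innerVerts w (k + 1)) +
        permOn (shiftMat G y) (S ∪ innerVerts w k) := by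
    intro k hk
    have hsub : S ∪ innerVerts w (k + 1) ⊆ S ∪ innerVerts w (k + 2) := by
      rw [innerVerts_succ w (k + 1), Finset.union_insert]
      exact Finset.subset_insert _ _
    rw [permOn_leaf G y (w := w (k + 2)) (a := w (k + 1)) (hwk (k + 1)) (hsub (hwk k)),
      shiftMat_self_of_degree_two y (hdeg _ hk), union_innerVerts_succ_erase (hmem _ hk),
      union_innerVerts_succ_erase (hmem k (by omega))]
    intro t ht
    rw [innerVerts_succ, Finset.union_insert, Finset.mem_insert] at ht
    rcases ht with rfl | ht
    · simp only [SimpleGraph.irrefl, false_iff]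
      intro h
      exact hmem _ hk (h ▸ hwk k)
    · exact hadj _ hk t ht
  induction L using Nat.twoStepInduction with
  | zero => simp [innerVerts_zero, fibPoly]
  | one =>
    have hm := hmem 0 one_pos
    rw [permOn_isolated G y (w := w 1) (hwk 0), shiftMat_self_of_degree_two y (hdeg 0 one_pos),
      union_innerVerts_succ_erase hm]
    · simp [innerVerts_zero, fibPoly]
    · intro t ht ha
      rw [innerVerts_succ, Finset.union_insert, Finset.mem_insert] at ht
      rcases ht with rfl | ht
      · exact G.irrefl ha
      · have := (hadj 0 one_pos t ht).1 ha
        rw [this] at ht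
        simp only [innerVerts_zero, Finset.union_empty] at ht
        exact h0 ht
  | more n ih1 ih2 =>
    rw [step n (by omega),
      ih1 (fun k hk => hmem k (by omega)) (fun k hk => hadj k (by omega))
        (fun k hk => hdeg k (by omega)) (fun k hk => step k (by omega)),
      ih2 (fun k hk => hmem k (by omega)) (fun k hk => hadj k (by omega))
        (fun k hk => hdeg k (by omega)) (fun k hk => step k (by omega))]
    simp only [fibPoly]
    ring

/-- A path that has to run through a pendant path can start at its foot. -/
theorem permPath_pendant {S : Finset W} {w : ℕ → W} {L : ℕ} {z : W} (hz : z ∈ S) (h0 : w 0 ∈ S)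
    (hmem : ∀ k < L, w (k + 1) ∉ S ∪ innerVerts w k)
    (hadj : ∀ k < L, ∀ t ∈ S ∪ innerVerts w k, G.Adj (w (k + 1)) t ↔ t = w k) :
    permPath (shiftMat G y) (S ∪ innerVerts w L) (w L) z = permPath (shiftMat G y) S (w 0) z := by
  induction L with
  | zero => simp [innerVerts_zero]
  | succ n ih =>
    have hwk : w n ∈ S ∪ innerVerts w n := by
      cases n with
      | zero => exact Finset.mem_union_left _ h0
      | succ k => exact Finset.mem_union_right _ (mem_innerVerts.2 ⟨k, Nat.lt_succ_self k, rfl⟩)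
    have hm := hmem n (Nat.lt_succ_self n)
    rw [← ih (fun k hk => hmem k (by omega)) (fun k hk => hadj k (by omega)),
      ← union_innerVerts_succ_erase hm]
    refine permPath_leaf G y ?_ ?_ ?_ ?_
    · exact Finset.mem_union_right _ (mem_innerVerts.2 ⟨n, Nat.lt_succ_self n, rfl⟩)
    · rintro rfl
      exact hm (Finset.mem_union_left _ hz)
    · rw [innerVerts_succ, Finset.union_insert]
      exact Finset.mem_insert_of_mem hwk
    · intro t ht
      rw [innerVerts_succ, Finset.union_insert, Finset.mem_insert] at ht
      rcases ht with rfl | ht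
      · simp only [SimpleGraph.irrefl, false_iff]
        intro h
        exact hm (h ▸ hwk)
      · exact hadj n (Nat.lt_succ_self n) t ht

end Expansion

/-! ### Threads -/

/-- `w 0, w 1, …, w (L + 1)` is a thread from `x` to `z`: a walk whose inner vertices
`w 1, …, w L` are distinct, differ from `x` and `z`, and have no neighbours except their neighbours
along the walk. The ends may coincide, in which case the thread closes to a cycle of length at least
three. -/
structure IsThread {W : Type*} (G : SimpleGraph W) (x z : W) (L : ℕ) (w : ℕ → W) : Prop where
  start : w 0 = x
  finish : w (L + 1) = z
  ne_start : ∀ k < L, w (k + 1) ≠ x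
  ne_finish : ∀ k < L, w (k + 1) ≠ z
  inj : ∀ j < L, ∀ k < L, w (j + 1) = w (k + 1) → j = k
  nbr : ∀ k < L, ∀ t, G.Adj (w (k + 1)) t ↔ t = w k ∨ t = w (k + 2)
  adj_of_zero : L = 0 → G.Adj x z
  two_le : x = z → 2 ≤ L

namespace IsThread

variable {W : Type*} {G : SimpleGraph W} {x z : W} {L : ℕ} {w : ℕ → W}

theorem adj (h : IsThread G x z L w) {k : ℕ} (hk : k ≤ L) : G.Adj (w k) (w (k + 1)) := by
  rcases Nat.eq_zero_or_pos k with rfl | hk0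
  · rcases Nat.eq_zero_or_pos L with h0 | h0
    · have := h.adj_of_zero h0
      have hf := h.finish
      rw [h0] at hf
      rwa [h.start, hf]
    · exact ((h.nbr 0 h0 _).2 (Or.inl rfl)).symm
  · obtain ⟨j, rfl⟩ : ∃ j, k = j + 1 := ⟨k - 1, by omega⟩
    exact (h.nbr j (by omega) _).2 (Or.inr rfl)

theorem ne_two_apart (h : IsThread G x z L w) {k : ℕ} (hk : k < L) : w k ≠ w (k + 2) := by
  intro he
  rcases Nat.eq_zero_or_pos k with rfl | hk0
  · rcases Nat.lt_or_ge 1 L with h1 | h1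
    · exact h.ne_start 1 h1 (he.symm.trans h.start)
    · have hL : L = 1 := by omega
      subst hL
      have := h.two_le (by rw [← h.start, he]; exact h.finish)
      omega
  · obtain ⟨j, rfl⟩ : ∃ j, k = j + 1 := ⟨k - 1, by omega⟩
    rcases Nat.lt_or_ge (j + 2) L with h1 | h1
    · have := h.inj j (by omega) (j + 2) h1 he
      omega
    · have hL : L = j + 2 := by omega
      subst hL
      exact h.ne_finish j (by omega) (he.trans h.finish)

theorem reverse (h : IsThread G x z L w) : IsThread G z x L fun k => w (L + 1 - k) where
  start := by simpa using h.finish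
  finish := by simpa using h.start
  ne_start k hk := by
    have := h.ne_finish (L - 1 - k) (by omega)
    rwa [show L - 1 - k + 1 = L + 1 - (k + 1) by omega] at this
  ne_finish k hk := by
    have := h.ne_start (L - 1 - k) (by omega)
    rwa [show L - 1 - k + 1 = L + 1 - (k + 1) by omega] at this
  inj j hj k hk he := by
    have := h.inj (L - 1 - j) (by omega) (L - 1 - k) (by omega)
      (by rwa [show L - 1 - j + 1 = L + 1 - (j + 1) by omega,
        show L - 1 - k + 1 = L + 1 - (k + 1) by omega])
    omega
  nbr k hk t := by
    have := h.nbr (L - 1 - k) (by omega) t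
    rw [show L - 1 - k + 1 = L + 1 - (k + 1) by omega,
      show L - 1 - k + 2 = L + 1 - k by omega,
      show L - 1 - k = L + 1 - (k + 2) by omega, or_comm] at this
    exact this
  adj_of_zero h0 := (h.adj_of_zero h0).symm
  two_le h0 := h.two_le h0.symm

section Finite

variable [Fintype W] [DecidableEq W] [DecidableRel G.Adj]

theorem degree_eq_two (h : IsThread G x z L w) {k : ℕ} (hk : k < L) :
    G.degree (w (k + 1)) = 2 := by
  have : G.neighborFinset (w (k + 1)) = {w k, w (k + 2)} := by
    ext t
    simp [h.nbr k hk]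
  rw [← G.card_neighborFinset_eq_degree, this, Finset.card_pair (h.ne_two_apart hk)]

omit [Fintype W] [DecidableRel G.Adj] in
theorem notMem_left (h : IsThread G x z L w) :
    x ∉ innerVerts w L := fun hm => by
  obtain ⟨k, hk, he⟩ := mem_innerVerts.1 hm
  exact h.ne_start k hk he

omit [Fintype W] [DecidableRel G.Adj] in
theorem notMem_right (h : IsThread G x z L w) :
    z ∉ innerVerts w L := fun hm => by
  obtain ⟨k, hk, he⟩ := mem_innerVerts.1 hm
  exact h.ne_finish k hk he

omit [Fintype W] [DecidableRel G.Adj] in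
theorem card_innerVerts (h : IsThread G x z L w) : (innerVerts w L).card = L := by
  rw [innerVerts, Finset.card_image_of_injOn, Finset.card_range]
  intro j hj k hk he
  exact h.inj j (by simpa using hj) k (by simpa using hk) he

omit [Fintype W] [DecidableRel G.Adj] in
theorem notMem_union (h : IsThread G x z L w) {S : Finset W} (hS : Disjoint S (innerVerts w L))
    {k : ℕ} (hk : k < L) : w (k + 1) ∉ S ∪ innerVerts w k := by
  rw [Finset.mem_union, not_or]
  constructor
  · exact fun hm => Finset.disjoint_left.1 hS hm (mem_innerVerts.2 ⟨k, hk, rfl⟩)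
  · intro hm
    obtain ⟨j, hj, he⟩ := mem_innerVerts.1 hm
    have := h.inj j (by omega) k hk he
    omega

omit [Fintype W] [DecidableRel G.Adj] in
theorem adj_iff_of_mem (h : IsThread G x z L w) {S : Finset W}
    (hS : Disjoint S (innerVerts w L)) {k : ℕ} (hk : k < L) (hz : z ∉ S ∨ k + 1 < L) {t : W}
    (ht : t ∈ S ∪ innerVerts w k) : G.Adj (w (k + 1)) t ↔ t = w k := by
  rw [h.nbr k hk, or_iff_left_iff_imp]
  rintro rfl
  exfalso
  rcases Nat.lt_or_ge (k + 1) L with h1 | h1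
  · refine h.notMem_union hS h1 (Finset.union_subset_union_right ?_ ht)
    intro s hs
    obtain ⟨j, hj, rfl⟩ := mem_innerVerts.1 hs
    exact mem_innerVerts.2 ⟨j, by omega, rfl⟩
  · have hL : L = k + 1 := by omega
    subst hL
    rw [h.finish, Finset.mem_union] at ht
    rcases ht with ht | ht
    · rcases hz with hz | hz
      · exact hz ht
      · omega
    · obtain ⟨j, hj, he⟩ := mem_innerVerts.1 ht
      exact h.ne_finish j (by omega) he

variable {R : Type*} [CommRing R] (y : R)

theorem permOn_left (h : IsThread G x z L w) {S : Finset W} (hS : Disjoint S (innerVerts w L))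
    (hx : x ∈ S) (hz : z ∉ S) :
    permOn (shiftMat G y) (S ∪ innerVerts w L) = fibPoly y (L + 1) * permOn (shiftMat G y) S +
      fibPoly y L * permOn (shiftMat G y) (S.erase x) := by
  have := permOn_pendant (G := G) y (S := S) (w := w) (L := L) (by rwa [h.start])
    (fun k hk => h.notMem_union hS hk)
    (fun k hk t ht => h.adj_iff_of_mem hS hk (Or.inl hz) ht) (fun k hk => h.degree_eq_two hk)
  rwa [h.start] at this

theorem permOn_right (h : IsThread G x z L w) {S : Finset W} (hS : Disjoint S (innerVerts w L))
    (hx : x ∉ S) (hz : z ∈ S) :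
    permOn (shiftMat G y) (S ∪ innerVerts w L) = fibPoly y (L + 1) * permOn (shiftMat G y) S +
      fibPoly y L * permOn (shiftMat G y) (S.erase z) := by
  have := h.reverse.permOn_left y (S := S) (by rwa [innerVerts_reverse]) hz hx
  rwa [innerVerts_reverse] at this

theorem permOn_free (h : IsThread G x z L w) {S : Finset W} (hS : Disjoint S (innerVerts w L))
    (hx : x ∉ S) (hz : z ∉ S) :
    permOn (shiftMat G y) (S ∪ innerVerts w L) =
      fibPoly y (L + 1) * permOn (shiftMat G y) S :=
  permOn_free_path (G := G) y (S := S) (w := w) (L := L) (by rwa [h.start])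
    (fun k hk => h.notMem_union hS hk)
    (fun k hk t ht => h.adj_iff_of_mem hS hk (Or.inl hz) ht) (fun k hk => h.degree_eq_two hk)

/-- Without its last inner vertex a thread is a pendant path. -/
theorem permOn_init (h : IsThread G x z (L + 1) w) {S : Finset W}
    (hS : Disjoint S (innerVerts w (L + 1))) (hx : x ∈ S) :
    permOn (shiftMat G y) (S ∪ innerVerts w L) = fibPoly y (L + 1) * permOn (shiftMat G y) S +
      fibPoly y L * permOn (shiftMat G y) (S.erase x) := by
  have := permOn_pendant (G := G) y (S := S) (w := w) (L := L) (by rwa [h.start])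
    (fun k hk => h.notMem_union hS (by omega))
    (fun k hk t ht => h.adj_iff_of_mem hS (by omega) (Or.inr (by omega)) ht)
    (fun k hk => h.degree_eq_two (by omega))
  rwa [h.start] at this

theorem permOn_init_free (h : IsThread G x z (L + 1) w) {S : Finset W}
    (hS : Disjoint S (innerVerts w (L + 1))) (hx : x ∉ S) :
    permOn (shiftMat G y) (S ∪ innerVerts w L) = fibPoly y (L + 1) * permOn (shiftMat G y) S :=
  permOn_free_path (G := G) y (S := S) (w := w) (L := L) (by rwa [h.start])
    (fun k hk => h.notMem_union hS (by omega))
    (fun k hk t ht => h.adj_iff_of_mem hS (by omega) (Or.inr (by omega)) ht)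
    (fun k hk => h.degree_eq_two (by omega))

theorem permPath_init (h : IsThread G x z (L + 1) w) {S : Finset W}
    (hS : Disjoint S (innerVerts w (L + 1))) (hx : x ∈ S) {t : W} (ht : t ∈ S) :
    permPath (shiftMat G y) (S ∪ innerVerts w L) (w L) t = permPath (shiftMat G y) S x t := by
  have := permPath_pendant (G := G) y (S := S) (w := w) (L := L) ht (by rwa [h.start])
    (fun k hk => h.notMem_union hS (by omega))
    (fun k hk t ht => h.adj_iff_of_mem hS (by omega) (Or.inr (by omega)) ht)
  rwa [h.start] at this

theorem permPath_left (h : IsThread G x z L w) {S : Finset W}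
    (hS : Disjoint S (innerVerts w L)) (hx : x ∈ S) (hz : z ∉ S) {t : W} (ht : t ∈ S) :
    permPath (shiftMat G y) (S ∪ innerVerts w L) (w L) t = permPath (shiftMat G y) S x t := by
  have := permPath_pendant (G := G) y (S := S) (w := w) (L := L) ht (by rwa [h.start])
    (fun k hk => h.notMem_union hS (by omega))
    (fun k hk t ht => h.adj_iff_of_mem hS hk (Or.inl hz) ht)
  rwa [h.start] at this

/-- Expansion of the permanent at the last inner vertex of a thread. -/
theorem permOn_last (h : IsThread G x z (L + 1) w) {S : Finset W}
    (hS : Disjoint S (innerVerts w (L + 1))) (hx : x ∈ S) (hz : z ∈ S) :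
    permOn (shiftMat G y) (S ∪ innerVerts w (L + 1)) =
      y * permOn (shiftMat G y) (S ∪ innerVerts w L) +
      permOn (shiftMat G y) ((S ∪ innerVerts w L).erase (w L)) +
      permOn (shiftMat G y) (S.erase z ∪ innerVerts w L) +
      2 * permPath (shiftMat G y) S x z := by
  have hm := h.notMem_union hS (Nat.lt_succ_self L)
  have hsub : S ∪ innerVerts w L ⊆ S ∪ innerVerts w (L + 1) := by
    rw [innerVerts_succ, Finset.union_insert]
    exact Finset.subset_insert _ _
  have hwL : w L ∈ S ∪ innerVerts w L := by
    cases L with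
    | zero =>
      rw [h.start]
      exact Finset.mem_union_left _ hx
    | succ k => exact Finset.mem_union_right _ (mem_innerVerts.2 ⟨k, Nat.lt_succ_self k, rfl⟩)
  have hne : w L ≠ z := by
    have := h.ne_two_apart (Nat.lt_succ_self L)
    rwa [h.finish] at this
  have hzI : z ∉ innerVerts w L := by
    intro hm
    obtain ⟨j, hj, he⟩ := mem_innerVerts.1 hm
    exact h.ne_finish j (by omega) he
  rw [permOn_two G y (w := w (L + 1)) (a := w L) (b := z)
      (Finset.mem_union_right _ (mem_innerVerts.2 ⟨L, Nat.lt_succ_self L, rfl⟩)) (hsub hwL)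
      (Finset.mem_union_left _ hz) hne
      (fun t _ => by rw [h.nbr L (Nat.lt_succ_self L), h.finish]),
    shiftMat_self_of_degree_two y (h.degree_eq_two (Nat.lt_succ_self L)),
    union_innerVerts_succ_erase hm, union_erase_of_notMem hzI, h.permPath_init y hS hx hz]

/-- Removal of a thread with distinct ends. -/
theorem permOn_both (h : IsThread G x z (L + 1) w) (hxz : x ≠ z) {S : Finset W}
    (hS : Disjoint S (innerVerts w (L + 1))) (hx : x ∈ S) (hz : z ∈ S) :
    permOn (shiftMat G y) (S ∪ innerVerts w (L + 1)) =
      fibPoly y (L + 2) * permOn (shiftMat G y) S +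
      fibPoly y (L + 1) *
        (permOn (shiftMat G y) (S.erase x) + permOn (shiftMat G y) (S.erase z)) +
      fibPoly y L * permOn (shiftMat G y) ((S.erase x).erase z) +
      2 * permPath (shiftMat G y) S x z := by
  have hSz : Disjoint (S.erase z) (innerVerts w (L + 1)) :=
    Finset.disjoint_of_subset_left (Finset.erase_subset _ _) hS
  rw [h.permOn_last y hS hx hz, h.permOn_init y hS hx,
    h.permOn_init y hSz (Finset.mem_erase.2 ⟨hxz, hx⟩), Finset.erase_right_comm (a := z)]
  have : permOn (shiftMat G y) ((S ∪ innerVerts w L).erase (w L)) =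
      fibPoly y L * permOn (shiftMat G y) S +
        (fibPoly y (L + 1) - y * fibPoly y L) * permOn (shiftMat G y) (S.erase x) := by
    cases L with
    | zero => simp [h.start, innerVerts_zero, fibPoly]
    | succ k =>
      have hm := h.notMem_union hS (k := k) (by omega)
      rw [union_innerVerts_succ_erase hm]
      have := permOn_pendant (G := G) y (S := S) (w := w) (L := k) (by rwa [h.start])
        (fun k hk => h.notMem_union hS (by omega))
        (fun k hk t ht => h.adj_iff_of_mem hS (by omega) (Or.inr (by omega)) ht)
        (fun k hk => h.degree_eq_two (by omega))
      rw [this, h.start]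
      simp only [fibPoly]
      ring
  rw [this]
  simp only [fibPoly]
  ring

/-- Removal of a thread that returns to its start. -/
theorem permOn_loop (h : IsThread G x x L w) {S : Finset W}
    (hS : Disjoint S (innerVerts w L)) (hx : x ∈ S) :
    permOn (shiftMat G y) (S ∪ innerVerts w L) =
      fibPoly y (L + 1) * permOn (shiftMat G y) S +
      2 * (fibPoly y L + 1) * permOn (shiftMat G y) (S.erase x) := by
  obtain ⟨k, rfl⟩ : ∃ k, L = k + 2 := ⟨L - 2, by have := h.two_le rfl; omega⟩
  have hSz : Disjoint (S.erase x) (innerVerts w (k + 2)) :=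
    Finset.disjoint_of_subset_left (Finset.erase_subset _ _) hS
  rw [h.permOn_last y hS hx hx, h.permOn_init y hS hx,
    h.permOn_init_free y hSz (Finset.notMem_erase _ _), permPath_self _ hx,
    union_innerVerts_succ_erase (h.notMem_union hS (k := k) (by omega))]
  have := permOn_pendant (G := G) y (S := S) (w := w) (L := k) (by rwa [h.start])
    (fun k hk => h.notMem_union hS (by omega))
    (fun k hk t ht => h.adj_iff_of_mem hS (by omega) (Or.inr (by omega)) ht)
    (fun k hk => h.degree_eq_two (by omega))
  rw [this, h.start]
  simp only [fibPoly]
  ring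

/-- Removal of a cycle that consists of the whole thread and its start. -/
theorem permOn_cycle (h : IsThread G x x L w) (hdeg : G.degree x = 2) {S : Finset W}
    (hS : Disjoint S (innerVerts w L)) (hx : x ∉ S) (hxS : ∀ t ∈ S, ¬ G.Adj x t) :
    permOn (shiftMat G y) (insert x S ∪ innerVerts w L) =
      (fibPoly y (L + 2) + fibPoly y L + 2) * permOn (shiftMat G y) S := by
  have hxI : x ∉ innerVerts w L := h.notMem_left
  rw [h.permOn_loop y (Finset.disjoint_insert_left.2 ⟨hxI, hS⟩) (Finset.mem_insert_self _ _),
    permOn_isolated G y (Finset.mem_insert_self x S), Finset.erase_insert hx,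
    shiftMat_self_of_degree_two y hdeg]
  · simp only [fibPoly]
    ring
  · intro t ht
    rw [Finset.mem_insert] at ht
    rcases ht with rfl | ht
    · exact G.irrefl
    · exact hxS t ht

end Finite

end IsThread

/-! ### Theta graphs, dumbbells and their values -/

/-- `G` contains a theta graph with ends `u`, `v` and paths `w i` with `L i` inner vertices as a
union of components: no edge leads from its vertices to other vertices. -/
structure IsTheta {W : Type*} (G : SimpleGraph W) (u v : W) (L : Fin 3 → ℕ) (w : Fin 3 → ℕ → W) :
    Prop where
  ne : u ≠ v
  thread : ∀ i, IsThread G u v (L i) (w i)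
  disj : ∀ i j, ∀ k < L i, ∀ l < L j, w i (k + 1) = w j (l + 1) → i = j
  nbr_left : ∀ t, G.Adj u t ↔ ∃ i, t = w i 1
  nbr_right : ∀ t, G.Adj v t ↔ ∃ i, t = w i (L i)

/-- `G` contains, as a union of components, a dumbbell: cycles through `u` and through `v` with `a`
and `b` further vertices, and a path from `u` to `v` with `c` inner vertices. -/
structure IsDumbbell {W : Type*} (G : SimpleGraph W) (u v : W) (a b c : ℕ) (wa wb wc : ℕ → W) :
    Prop where
  ne : u ≠ v
  loop_left : IsThread G u u a wa
  loop_right : IsThread G v v b wb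
  bridge : IsThread G u v c wc
  ne_left : ∀ k < a, wa (k + 1) ≠ v
  ne_right : ∀ k < b, wb (k + 1) ≠ u
  disj_ab : ∀ k < a, ∀ l < b, wa (k + 1) ≠ wb (l + 1)
  disj_ac : ∀ k < a, ∀ l < c, wa (k + 1) ≠ wc (l + 1)
  disj_bc : ∀ k < b, ∀ l < c, wb (k + 1) ≠ wc (l + 1)
  nbr_left : ∀ t, G.Adj u t ↔ t = wa 1 ∨ t = wa a ∨ t = wc 1
  nbr_right : ∀ t, G.Adj v t ↔ t = wb 1 ∨ t = wb b ∨ t = wc c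

/-- The permanent for a path with `a + 2` vertices whose ends have diagonal entry `y - 1`. -/
def pathVal {R : Type*} [CommRing R] (y : R) (a : ℕ) : R :=
  (y - 1) ^ 2 * fibPoly y (a + 1) + 2 * (y - 1) * fibPoly y a +
    (fibPoly y (a + 1) - y * fibPoly y a)

/-- The Laplacian permanental polynomial, at `x = y + 2`, of the theta graph with `a`, `b`, `c`
inner vertices on its paths. -/
def thetaVal {R : Type*} [CommRing R] (y : R) (a b c : ℕ) : R :=
  (y - 1) ^ 2 * (fibPoly y (a + 1) * fibPoly y (b + 1) * fibPoly y (c + 1)) +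
  2 * (y - 1) * (fibPoly y a * fibPoly y (b + 1) * fibPoly y (c + 1) +
    fibPoly y (a + 1) * fibPoly y b * fibPoly y (c + 1) +
    fibPoly y (a + 1) * fibPoly y (b + 1) * fibPoly y c) +
  2 * (fibPoly y a * fibPoly y b * fibPoly y (c + 1) +
    fibPoly y a * fibPoly y (b + 1) * fibPoly y c +
    fibPoly y (a + 1) * fibPoly y b * fibPoly y c) +
  ((fibPoly y (a + 1) - y * fibPoly y a) * fibPoly y (b + 1) * fibPoly y (c + 1) +
    fibPoly y (a + 1) * (fibPoly y (b + 1) - y * fibPoly y b) * fibPoly y (c + 1) +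
    fibPoly y (a + 1) * fibPoly y (b + 1) * (fibPoly y (c + 1) - y * fibPoly y c)) +
  2 * (fibPoly y (a + 1) + fibPoly y (b + 1) + fibPoly y (c + 1))

/-- The Laplacian permanental polynomial, at `x = y + 2`, of the dumbbell whose cycles have `a` and
`b` vertices of degree two and whose bridging path has `c` inner vertices. -/
def dumbbellVal {R : Type*} [CommRing R] (y : R) (a b c : ℕ) : R :=
  fibPoly y (a + 1) * (fibPoly y (b + 1) * pathVal y c +
    2 * (fibPoly y b + 1) * ((y - 1) * fibPoly y (c + 1) + fibPoly y c)) +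
  2 * (fibPoly y a + 1) * (fibPoly y (b + 1) * ((y - 1) * fibPoly y (c + 1) + fibPoly y c) +
    2 * (fibPoly y b + 1) * fibPoly y (c + 1))

/-- The Laplacian permanental polynomial, at `x = y + 2`, of the cycle with `k` vertices. -/
def cycleVal {R : Type*} [CommRing R] (y : R) (k : ℕ) : R :=
  fibPoly y (k + 1) + fibPoly y (k - 1) + 2

section Values

variable {W : Type*} [Fintype W] [DecidableEq W] {G : SimpleGraph W} [DecidableRel G.Adj]
  {u v : W} {R : Type*} [CommRing R] (y : R)

/-- The permanent for the path formed by one thread and its ends. -/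
theorem permOn_thread_ends {w : ℕ → W} {L : ℕ} {D : Finset W} (h : IsThread G u v L w)
    (huv : u ≠ v) (hu : G.degree u = 3) (hv : G.degree v = 3) (huD : u ∉ D) (hvD : v ∉ D)
    (hD : Disjoint D (innerVerts w L)) (hDu : ∀ t ∈ D, ¬ G.Adj u t)
    (hDv : ∀ t ∈ D ∪ innerVerts w L, G.Adj v t → t = w L)
    (hDv0 : G.Adj u v → L = 0) :
    permOn (shiftMat G y) (insert u (insert v D) ∪ innerVerts w L) =
      pathVal y L * permOn (shiftMat G y) D := by
  have huI := h.notMem_left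
  have hvI := h.notMem_right
  have hDuI : Disjoint (insert u D) (innerVerts w L) := Finset.disjoint_insert_left.2 ⟨huI, hD⟩
  have hPu : permOn (shiftMat G y) (insert u D) = (y - 1) * permOn (shiftMat G y) D := by
    rw [permOn_isolated G y (Finset.mem_insert_self u D), Finset.erase_insert huD,
      shiftMat_self_of_degree_three y hu]
    intro t ht
    rcases Finset.mem_insert.1 ht with rfl | ht
    · exact G.irrefl
    · exact hDu t ht
  have hvL : G.Adj (w L) v := by
    have := h.adj le_rfl
    rwa [h.finish] at this
  have hwL : w L ∈ insert u D ∪ innerVerts w L := by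
    rcases L with _ | k
    · rw [h.start]
      simp
    · exact Finset.mem_union_right _ (mem_innerVerts.2 ⟨k, Nat.lt_succ_self k, rfl⟩)
  have her : (insert u (insert v D) ∪ innerVerts w L).erase v = insert u D ∪ innerVerts w L := by
    rw [union_erase_of_notMem hvI, Finset.insert_comm, Finset.erase_insert]
    simp [huv.symm, hvD]
  rw [permOn_leaf G y (w := v) (a := w L) (by simp), her, shiftMat_self_of_degree_three y hv,
    h.permOn_left y hDuI (Finset.mem_insert_self u D) (by simp [huv.symm, hvD]),
    Finset.erase_insert huD, hPu]
  · have : permOn (shiftMat G y) ((insert u D ∪ innerVerts w L).erase (w L)) =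
        ((y - 1) * fibPoly y L + (fibPoly y (L + 1) - y * fibPoly y L)) *
          permOn (shiftMat G y) D := by
      rcases L with _ | k
      · rw [h.start, innerVerts_zero, Finset.union_empty, Finset.erase_insert huD]
        simp [fibPoly]
      · rw [union_innerVerts_succ_erase (h.notMem_union hDuI (Nat.lt_succ_self k)),
          h.permOn_init y hDuI (Finset.mem_insert_self u D), Finset.erase_insert huD, hPu]
        simp only [fibPoly]
        ring
    rw [this, pathVal]
    ring
  · rw [Finset.insert_comm, Finset.insert_union]
    exact Finset.mem_insert_of_mem hwL
  · intro t ht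
    refine ⟨fun ha => ?_, fun he => he ▸ hvL.symm⟩
    simp only [Finset.mem_union, Finset.mem_insert] at ht
    rcases ht with (rfl | rfl | ht) | ht
    · have := hDv0 ha.symm
      subst this
      exact h.start.symm
    · exact absurd ha G.irrefl
    · exact hDv t (Finset.mem_union_left _ ht) ha
    · exact hDv t (Finset.mem_union_right _ ht) ha

theorem IsTheta.permOn_eq {L : Fin 3 → ℕ} {w : Fin 3 → ℕ → W} (h : IsTheta G u v L w)
    (hu : G.degree u = 3) (hv : G.degree v = 3) (h1 : L 1 ≠ 0) (h2 : L 2 ≠ 0) {D : Finset W}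
    (huD : u ∉ D) (hvD : v ∉ D) (hD : ∀ i, Disjoint D (innerVerts (w i) (L i))) :
    permOn (shiftMat G y) (insert u (insert v D) ∪ innerVerts (w 0) (L 0) ∪
      innerVerts (w 1) (L 1) ∪ innerVerts (w 2) (L 2)) =
      thetaVal y (L 0) (L 1) (L 2) * permOn (shiftMat G y) D := by
  have huI : ∀ i, u ∉ innerVerts (w i) (L i) := fun i => (h.thread i).notMem_left
  have hvI : ∀ i, v ∉ innerVerts (w i) (L i) := fun i => (h.thread i).notMem_right
  have hII : ∀ i j, i ≠ j → Disjoint (innerVerts (w i) (L i)) (innerVerts (w j) (L j)) := by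
    intro i j hij
    rw [Finset.disjoint_left]
    intro t hi hj
    obtain ⟨k, hk, rfl⟩ := mem_innerVerts.1 hi
    obtain ⟨l, hl, he⟩ := mem_innerVerts.1 hj
    exact hij (h.disj i j k hk l hl he.symm)
  have hlast : ∀ i, L i ≠ 0 → w i (L i) ∈ innerVerts (w i) (L i) := fun i hi =>
    mem_innerVerts.2 ⟨L i - 1, by omega, by congr 1; omega⟩
  have hfirst : ∀ i, L i ≠ 0 → w i 1 ∈ innerVerts (w i) (L i) := fun i hi =>
    mem_innerVerts.2 ⟨0, by omega, rfl⟩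
  have hcases : ∀ i, w i (L i) ∈ innerVerts (w i) (L i) ∨ w i (L i) = u := by
    intro i
    by_cases hi : L i = 0
    · right
      rw [hi]
      exact (h.thread i).start
    · exact Or.inl (hlast i hi)
  have hcases' : ∀ i, w i 1 ∈ innerVerts (w i) (L i) ∨ w i 1 = v := by
    intro i
    by_cases hi : L i = 0
    · right
      have := (h.thread i).finish
      rwa [hi] at this
    · exact Or.inl (hfirst i hi)
  have hDu : ∀ t ∈ D, ¬ G.Adj u t := by
    intro t ht ha
    obtain ⟨i, rfl⟩ := (h.nbr_left t).1 ha
    rcases hcases' i with hi | hi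
    · exact Finset.disjoint_left.1 (hD i) ht hi
    · exact hvD (hi ▸ ht)
  have hDv : ∀ t ∈ D, ¬ G.Adj v t := by
    intro t ht ha
    obtain ⟨i, rfl⟩ := (h.nbr_right t).1 ha
    rcases hcases i with hi | hi
    · exact Finset.disjoint_left.1 (hD i) ht hi
    · exact huD (hi ▸ ht)
  have hIv : ∀ i, ∀ t ∈ innerVerts (w i) (L i), G.Adj v t → t = w i (L i) := by
    intro i t ht ha
    obtain ⟨j, rfl⟩ := (h.nbr_right t).1 ha
    rcases hcases j with hj | hj
    · by_cases hij : i = j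
      · rw [hij]
      · exact absurd hj (Finset.disjoint_left.1 (hII i j hij) ht)
    · exact absurd (hj ▸ ht) (huI i)
  have huv0 : G.Adj u v → L 0 = 0 := by
    intro ha
    obtain ⟨i, hi⟩ := (h.nbr_left v).1 ha
    have hi0 : L i = 0 := by
      by_contra hne
      exact hvI i (hi ▸ hfirst i hne)
    fin_cases i
    · exact hi0
    · exact absurd hi0 h1
    · exact absurd hi0 h2
  set I0 := innerVerts (w 0) (L 0) with hI0
  set I1 := innerVerts (w 1) (L 1) with hI1
  set I2 := innerVerts (w 2) (L 2) with hI2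
  have h01 : Disjoint I0 I1 := hII 0 1 (by decide)
  have h02 : Disjoint I0 I2 := hII 0 2 (by decide)
  have h12 : Disjoint I1 I2 := hII 1 2 (by decide)
  have hD0 := hD 0
  have hD1 := hD 1
  have hD2 := hD 2
  have hu0 := huI 0
  have hu1 := huI 1
  have hu2 := huI 2
  have hv0 := hvI 0
  have hv1 := hvI 1
  have hv2 := hvI 2
  rw [← hI0] at hD0 hu0 hv0
  rw [← hI1] at hD1 hu1 hv1
  rw [← hI2] at hD2 hu2 hv2
  have huv := h.ne
  set U := insert u (insert v D) with hU
  have hUu : U.erase u = insert v D := Finset.erase_insert (by simp [huv, huD])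
  have hUv : U.erase v = insert u D := by
    rw [hU, Finset.insert_comm]
    exact Finset.erase_insert (by simp [huv.symm, hvD])
  have hU0 : Disjoint U I0 := by simp [hU, Finset.disjoint_insert_left, hu0, hv0, hD0]
  have hU1 : Disjoint U I1 := by simp [hU, Finset.disjoint_insert_left, hu1, hv1, hD1]
  have hU2 : Disjoint U I2 := by simp [hU, Finset.disjoint_insert_left, hu2, hv2, hD2]
  have huU : u ∈ U := by simp [hU]
  have hvU : v ∈ U := by simp [hU]
  have hPu : permOn (shiftMat G y) (insert u D) = (y - 1) * permOn (shiftMat G y) D := by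
    rw [permOn_isolated G y (Finset.mem_insert_self u D), Finset.erase_insert huD,
      shiftMat_self_of_degree_three y hu]
    intro t ht
    rcases Finset.mem_insert.1 ht with rfl | ht
    · exact G.irrefl
    · exact hDu t ht
  have hPv : permOn (shiftMat G y) (insert v D) = (y - 1) * permOn (shiftMat G y) D := by
    rw [permOn_isolated G y (Finset.mem_insert_self v D), Finset.erase_insert hvD,
      shiftMat_self_of_degree_three y hv]
    intro t ht
    rcases Finset.mem_insert.1 ht with rfl | ht
    · exact G.irrefl
    · exact hDv t ht
  -- the sets without `u` and `v`, with one and with two threads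
  have e0 : permOn (shiftMat G y) (D ∪ I0) = fibPoly y (L 0 + 1) * permOn (shiftMat G y) D :=
    (h.thread 0).permOn_free y hD0 huD hvD
  have e1 : permOn (shiftMat G y) (D ∪ I1) = fibPoly y (L 1 + 1) * permOn (shiftMat G y) D :=
    (h.thread 1).permOn_free y hD1 huD hvD
  have e01 : permOn (shiftMat G y) (D ∪ I0 ∪ I1) =
      fibPoly y (L 1 + 1) * (fibPoly y (L 0 + 1) * permOn (shiftMat G y) D) := by
    rw [← e0]
    exact (h.thread 1).permOn_free y (Finset.disjoint_union_left.2 ⟨hD1, h01⟩)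
      (by simp [huD, hu0]) (by simp [hvD, hv0])
  have u0 : permOn (shiftMat G y) (insert u D ∪ I0) =
      ((y - 1) * fibPoly y (L 0 + 1) + fibPoly y (L 0)) * permOn (shiftMat G y) D := by
    rw [(h.thread 0).permOn_left y (Finset.disjoint_insert_left.2 ⟨hu0, hD0⟩) (by simp)
      (by simp [huv.symm, hvD]), hPu, Finset.erase_insert huD]
    ring
  have v0 : permOn (shiftMat G y) (insert v D ∪ I0) =
      ((y - 1) * fibPoly y (L 0 + 1) + fibPoly y (L 0)) * permOn (shiftMat G y) D := by
    rw [(h.thread 0).permOn_right y (Finset.disjoint_insert_left.2 ⟨hv0, hD0⟩)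
      (by simp [huv, huD]) (by simp), hPv, Finset.erase_insert hvD]
    ring
  have u01 : permOn (shiftMat G y) (insert u D ∪ I0 ∪ I1) =
      (fibPoly y (L 1 + 1) * ((y - 1) * fibPoly y (L 0 + 1) + fibPoly y (L 0)) +
        fibPoly y (L 1) * fibPoly y (L 0 + 1)) * permOn (shiftMat G y) D := by
    rw [(h.thread 1).permOn_left y (S := insert u D ∪ I0)
      (Finset.disjoint_union_left.2 ⟨Finset.disjoint_insert_left.2 ⟨hu1, hD1⟩, h01⟩) (by simp)
      (by simp [huv.symm, hvD, hv0]), u0, union_erase_of_notMem hu0, Finset.erase_insert huD, e0]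
    ring
  have v01 : permOn (shiftMat G y) (insert v D ∪ I0 ∪ I1) =
      (fibPoly y (L 1 + 1) * ((y - 1) * fibPoly y (L 0 + 1) + fibPoly y (L 0)) +
        fibPoly y (L 1) * fibPoly y (L 0 + 1)) * permOn (shiftMat G y) D := by
    rw [(h.thread 1).permOn_right y (S := insert v D ∪ I0)
      (Finset.disjoint_union_left.2 ⟨Finset.disjoint_insert_left.2 ⟨hv1, hD1⟩, h01⟩)
      (by simp [huv, huD, hu0]) (by simp), v0, union_erase_of_notMem hv0,
      Finset.erase_insert hvD, e0]
    ring
  have p0 : permOn (shiftMat G y) (U ∪ I0) = pathVal y (L 0) * permOn (shiftMat G y) D := by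
    refine permOn_thread_ends y (h.thread 0) huv hu hv huD hvD hD0 hDu ?_ huv0
    intro t ht ha
    rcases Finset.mem_union.1 ht with ht | ht
    · exact absurd ha (hDv t ht)
    · exact hIv 0 t ht ha
  have huvw : ∀ i, G.Adj v (w i (L i)) := fun i => (h.nbr_right _).2 ⟨i, rfl⟩
  have hUI0v : (U ∪ I0).erase v = insert u D ∪ I0 := by rw [union_erase_of_notMem hv0, hUv]
  have hUI0u : (U ∪ I0).erase u = insert v D ∪ I0 := by rw [union_erase_of_notMem hu0, hUu]
  have hw0 : w 0 (L 0) ∈ U ∪ I0 := by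
    rcases hcases 0 with h0 | h0
    · exact Finset.mem_union_right _ h0
    · rw [h0]
      exact Finset.mem_union_left _ huU
  have hAdjU : ∀ t ∈ U ∪ I0, G.Adj v t → t = w 0 (L 0) := by
    intro t ht ha
    simp only [hU, Finset.mem_union, Finset.mem_insert] at ht
    rcases ht with (rfl | rfl | ht) | ht
    · rw [huv0 ha.symm, (h.thread 0).start]
    · exact absurd ha G.irrefl
    · exact absurd ha (hDv t ht)
    · exact hIv 0 t ht ha
  have q0 : permPath (shiftMat G y) (U ∪ I0) v u = permOn (shiftMat G y) D := by
    rw [permPath_leaf G y (a := w 0 (L 0)) (Finset.mem_union_left _ hvU) huv.symm hw0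
      (fun t ht => ⟨hAdjU t ht, fun he => he ▸ huvw 0⟩), hUI0v,
      (h.thread 0).permPath_left y (Finset.disjoint_insert_left.2 ⟨hu0, hD0⟩) (by simp)
      (by simp [huv.symm, hvD]) (by simp), permPath_self _ (by simp), Finset.erase_insert huD]
  have hw1 : w 1 (L 1) ∈ I1 := hlast 1 h1
  have hUI1v : (U ∪ I0 ∪ I1).erase v = insert u D ∪ I0 ∪ I1 := by
    rw [union_erase_of_notMem hv1, hUI0v]
  have hUI1u : (U ∪ I0 ∪ I1).erase u = insert v D ∪ I0 ∪ I1 := by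
    rw [union_erase_of_notMem hu1, hUI0u]
  have hw01 : w 0 (L 0) ≠ w 1 (L 1) := by
    intro he
    rcases hcases 0 with h0 | h0
    · rw [he] at h0
      exact Finset.disjoint_left.1 h01 h0 hw1
    · rw [← he, h0] at hw1
      exact hu1 hw1
  have q1 : permPath (shiftMat G y) (U ∪ I0 ∪ I1) v u =
      (fibPoly y (L 0 + 1) + fibPoly y (L 1 + 1)) * permOn (shiftMat G y) D := by
    rw [permPath_two G y (a := w 0 (L 0)) (b := w 1 (L 1)) (by simp [hvU]) huv.symm
      (Finset.mem_union_left _ hw0) (Finset.mem_union_right _ hw1) hw01, hUI1v]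
    · have t1 : permPath (shiftMat G y) (insert u D ∪ I0 ∪ I1) (w 1 (L 1)) u =
          permOn (shiftMat G y) (D ∪ I0) := by
        rw [(h.thread 1).permPath_left y (S := insert u D ∪ I0)
          (Finset.disjoint_union_left.2 ⟨Finset.disjoint_insert_left.2 ⟨hu1, hD1⟩, h01⟩)
          (by simp) (by simp [huv.symm, hvD, hv0]) (by simp), permPath_self _ (by simp),
          union_erase_of_notMem hu0, Finset.erase_insert huD]
      have t0 : permPath (shiftMat G y) (insert u D ∪ I0 ∪ I1) (w 0 (L 0)) u =
          permOn (shiftMat G y) (D ∪ I1) := by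
        rw [Finset.union_right_comm, (h.thread 0).permPath_left y (S := insert u D ∪ I1)
          (Finset.disjoint_union_left.2 ⟨Finset.disjoint_insert_left.2 ⟨hu0, hD0⟩, h01.symm⟩)
          (by simp) (by simp [huv.symm, hvD, hv1]) (by simp), permPath_self _ (by simp),
          union_erase_of_notMem hu1, Finset.erase_insert huD]
      rw [t0, t1, e0, e1]
      ring
    · intro t ht
      constructor
      · intro ha
        rcases Finset.mem_union.1 ht with ht | ht
        · exact Or.inl (hAdjU t ht ha)
        · exact Or.inr (hIv 1 t ht ha)
      · rintro (rfl | rfl)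
        · exact huvw 0
        · exact huvw 1
  obtain ⟨b, hb⟩ : ∃ b, L 1 = b + 1 := ⟨L 1 - 1, by omega⟩
  obtain ⟨c, hc⟩ : ∃ c, L 2 = c + 1 := ⟨L 2 - 1, by omega⟩
  have hth1 := h.thread 1
  have hth2 := h.thread 2
  have p1 : permOn (shiftMat G y) (U ∪ I0 ∪ I1) =
      fibPoly y (L 1 + 1) * permOn (shiftMat G y) (U ∪ I0) +
      fibPoly y (L 1) * (permOn (shiftMat G y) (insert v D ∪ I0) +
        permOn (shiftMat G y) (insert u D ∪ I0)) +
      (fibPoly y (L 1 + 1) - y * fibPoly y (L 1)) * permOn (shiftMat G y) (D ∪ I0) +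
      2 * permPath (shiftMat G y) (U ∪ I0) u v := by
    have hdis : Disjoint (U ∪ I0) I1 := Finset.disjoint_union_left.2 ⟨hU1, h01⟩
    rw [hb] at hth1 hI1 ⊢
    rw [hI1] at hdis ⊢
    rw [hth1.permOn_both y huv hdis (Finset.mem_union_left _ huU) (Finset.mem_union_left _ hvU),
      hUI0v, hUI0u, union_erase_of_notMem hv0, Finset.erase_insert hvD]
    simp only [fibPoly]
    ring
  have p2 : permOn (shiftMat G y) (U ∪ I0 ∪ I1 ∪ I2) =
      fibPoly y (L 2 + 1) * permOn (shiftMat G y) (U ∪ I0 ∪ I1) +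
      fibPoly y (L 2) * (permOn (shiftMat G y) (insert v D ∪ I0 ∪ I1) +
        permOn (shiftMat G y) (insert u D ∪ I0 ∪ I1)) +
      (fibPoly y (L 2 + 1) - y * fibPoly y (L 2)) * permOn (shiftMat G y) (D ∪ I0 ∪ I1) +
      2 * permPath (shiftMat G y) (U ∪ I0 ∪ I1) u v := by
    have hdis : Disjoint (U ∪ I0 ∪ I1) I2 :=
      Finset.disjoint_union_left.2 ⟨Finset.disjoint_union_left.2 ⟨hU2, h02⟩, h12⟩
    rw [hc] at hth2 hI2 ⊢
    rw [hI2] at hdis ⊢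
    rw [hth2.permOn_both y huv hdis (by simp [huU]) (by simp [hvU]),
      hUI1v, hUI1u, union_erase_of_notMem hv1, union_erase_of_notMem hv0,
      Finset.erase_insert hvD]
    simp only [fibPoly]
    ring
  rw [p2, p1, permPath_comm _ (shiftMat_comm G y) (U ∪ I0 ∪ I1) u v, q1,
    permPath_comm _ (shiftMat_comm G y) (U ∪ I0) u v, q0, p0, u0, v0, u01, v01, e0, e01,
    thetaVal, pathVal]
  ring

theorem IsDumbbell.permOn_eq {a b c : ℕ} {wa wb wc : ℕ → W}
    (h : IsDumbbell G u v a b c wa wb wc)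
    (hu : G.degree u = 3) (hv : G.degree v = 3) {D : Finset W}
    (huD : u ∉ D) (hvD : v ∉ D) (hDa : Disjoint D (innerVerts wa a))
    (hDb : Disjoint D (innerVerts wb b)) (hDc : Disjoint D (innerVerts wc c)) :
    permOn (shiftMat G y) (insert u (insert v D) ∪ innerVerts wc c ∪ innerVerts wb b ∪
      innerVerts wa a) = dumbbellVal y a b c * permOn (shiftMat G y) D := by
  have huv := h.ne
  have ha2 := h.loop_left.two_le rfl
  have hb2 := h.loop_right.two_le rfl
  have hua := h.loop_left.notMem_left
  have hvb := h.loop_right.notMem_left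
  have huc := h.bridge.notMem_left
  have hvc := h.bridge.notMem_right
  have hva : v ∉ innerVerts wa a := fun hm => by
    obtain ⟨k, hk, he⟩ := mem_innerVerts.1 hm
    exact h.ne_left k hk he
  have hub : u ∉ innerVerts wb b := fun hm => by
    obtain ⟨k, hk, he⟩ := mem_innerVerts.1 hm
    exact h.ne_right k hk he
  have hab : Disjoint (innerVerts wb b) (innerVerts wa a) := by
    rw [Finset.disjoint_left]
    intro t hi hj
    obtain ⟨k, hk, rfl⟩ := mem_innerVerts.1 hi
    obtain ⟨l, hl, he⟩ := mem_innerVerts.1 hj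
    exact h.disj_ab l hl k hk he
  have hac : Disjoint (innerVerts wc c) (innerVerts wa a) := by
    rw [Finset.disjoint_left]
    intro t hi hj
    obtain ⟨k, hk, rfl⟩ := mem_innerVerts.1 hi
    obtain ⟨l, hl, he⟩ := mem_innerVerts.1 hj
    exact h.disj_ac l hl k hk he
  have hbc : Disjoint (innerVerts wc c) (innerVerts wb b) := by
    rw [Finset.disjoint_left]
    intro t hi hj
    obtain ⟨k, hk, rfl⟩ := mem_innerVerts.1 hi
    obtain ⟨l, hl, he⟩ := mem_innerVerts.1 hj
    exact h.disj_bc l hl k hk he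
  have hmem : ∀ {w : ℕ → W} {L k : ℕ}, 1 ≤ k → k ≤ L → w k ∈ innerVerts w L :=
    fun {w L k} h1 h2 => mem_innerVerts.2 ⟨k - 1, by omega, by congr 1; omega⟩
  have hwc1 : wc 1 ∈ innerVerts wc c ∨ wc 1 = v := by
    rcases Nat.eq_zero_or_pos c with h0 | h0
    · right
      have := h.bridge.finish
      rwa [h0] at this
    · exact Or.inl (hmem le_rfl h0)
  have hwcc : wc c ∈ innerVerts wc c ∨ wc c = u := by
    rcases Nat.eq_zero_or_pos c with h0 | h0
    · right
      rw [h0]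
      exact h.bridge.start
    · exact Or.inl (hmem h0 le_rfl)
  have ma1 : wa 1 ∈ innerVerts wa a := hmem le_rfl (by omega)
  have maa : wa a ∈ innerVerts wa a := hmem (by omega) le_rfl
  have mb1 : wb 1 ∈ innerVerts wb b := hmem le_rfl (by omega)
  have mbb : wb b ∈ innerVerts wb b := hmem (by omega) le_rfl
  have hDu : ∀ t ∈ D, ¬ G.Adj u t := by
    intro t ht had
    rcases (h.nbr_left t).1 had with rfl | rfl | rfl
    · exact Finset.disjoint_left.1 hDa ht ma1
    · exact Finset.disjoint_left.1 hDa ht maa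
    · rcases hwc1 with hi | hi
      · exact Finset.disjoint_left.1 hDc ht hi
      · exact hvD (hi ▸ ht)
  have hDv : ∀ t ∈ D ∪ innerVerts wc c, G.Adj v t → t = wc c := by
    intro t ht had
    rcases (h.nbr_right t).1 had with rfl | rfl | rfl
    · rcases Finset.mem_union.1 ht with ht | ht
      · exact absurd mb1 (Finset.disjoint_left.1 hDb ht)
      · exact absurd mb1 (Finset.disjoint_left.1 hbc ht)
    · rcases Finset.mem_union.1 ht with ht | ht
      · exact absurd mbb (Finset.disjoint_left.1 hDb ht)
      · exact absurd mbb (Finset.disjoint_left.1 hbc ht)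
    · rfl
  have hDv' : ∀ t ∈ D, ¬ G.Adj v t := by
    intro t ht had
    have := hDv t (Finset.mem_union_left _ ht) had
    subst this
    rcases hwcc with hi | hi
    · exact Finset.disjoint_left.1 hDc ht hi
    · exact huD (hi ▸ ht)
  have huv0 : G.Adj u v → c = 0 := by
    intro had
    by_contra hc
    rcases (h.nbr_left v).1 had with he | he | he
    · exact hva (he ▸ ma1)
    · exact hva (he ▸ maa)
    · exact hvc (he ▸ hmem le_rfl (by omega))
  set Ia := innerVerts wa a with hIa
  set Ib := innerVerts wb b with hIb
  set Ic := innerVerts wc c with hIc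
  set U := insert u (insert v D) with hU
  have hUu : U.erase u = insert v D := Finset.erase_insert (by simp [huv, huD])
  have hUv : U.erase v = insert u D := by
    rw [hU, Finset.insert_comm]
    exact Finset.erase_insert (by simp [huv.symm, hvD])
  have hUa : Disjoint U Ia := by simp [hU, Finset.disjoint_insert_left, hua, hva, hDa]
  have hUb : Disjoint U Ib := by simp [hU, Finset.disjoint_insert_left, hub, hvb, hDb]
  have huU : u ∈ U := by simp [hU]
  have hvU : v ∈ U := by simp [hU]
  have hPu : permOn (shiftMat G y) (insert u D) = (y - 1) * permOn (shiftMat G y) D := by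
    rw [permOn_isolated G y (Finset.mem_insert_self u D), Finset.erase_insert huD,
      shiftMat_self_of_degree_three y hu]
    intro t ht
    rcases Finset.mem_insert.1 ht with rfl | ht
    · exact G.irrefl
    · exact hDu t ht
  have hPv : permOn (shiftMat G y) (insert v D) = (y - 1) * permOn (shiftMat G y) D := by
    rw [permOn_isolated G y (Finset.mem_insert_self v D), Finset.erase_insert hvD,
      shiftMat_self_of_degree_three y hv]
    intro t ht
    rcases Finset.mem_insert.1 ht with rfl | ht
    · exact G.irrefl
    · exact hDv' t ht
  have pc : permOn (shiftMat G y) (U ∪ Ic) = pathVal y c * permOn (shiftMat G y) D :=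
    permOn_thread_ends y h.bridge huv hu hv huD hvD hDc hDu hDv huv0
  have ec : permOn (shiftMat G y) (D ∪ Ic) = fibPoly y (c + 1) * permOn (shiftMat G y) D :=
    h.bridge.permOn_free y hDc huD hvD
  have uc : permOn (shiftMat G y) (insert u D ∪ Ic) =
      ((y - 1) * fibPoly y (c + 1) + fibPoly y c) * permOn (shiftMat G y) D := by
    rw [h.bridge.permOn_left y (Finset.disjoint_insert_left.2 ⟨huc, hDc⟩) (by simp)
      (by simp [huv.symm, hvD]), hPu, Finset.erase_insert huD]
    ring
  have vc : permOn (shiftMat G y) (insert v D ∪ Ic) =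
      ((y - 1) * fibPoly y (c + 1) + fibPoly y c) * permOn (shiftMat G y) D := by
    rw [h.bridge.permOn_right y (Finset.disjoint_insert_left.2 ⟨hvc, hDc⟩)
      (by simp [huv, huD]) (by simp), hPv, Finset.erase_insert hvD]
    ring
  rw [h.loop_left.permOn_loop y (S := U ∪ Ic ∪ Ib) (Finset.disjoint_union_left.2
      ⟨Finset.disjoint_union_left.2 ⟨hUa, hac⟩, hab⟩) (by simp [huU]),
    h.loop_right.permOn_loop y (S := U ∪ Ic) (Finset.disjoint_union_left.2 ⟨hUb, hbc⟩)
      (by simp [hvU]), union_erase_of_notMem hub, union_erase_of_notMem huc,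
    h.loop_right.permOn_loop y (S := U.erase u ∪ Ic) (Finset.disjoint_union_left.2
      ⟨Finset.disjoint_of_subset_left (Finset.erase_subset _ _) hUb, hbc⟩)
      (by simp [hUu]), union_erase_of_notMem hvc, union_erase_of_notMem hvc, hUu, hUv,
    Finset.erase_insert hvD, pc, uc, vc, ec, dumbbellVal]
  ring

end Values

/-! ### Following vertices of degree two -/

section Extraction

variable {W : Type*} [Fintype W] [DecidableEq W] {G : SimpleGraph W} [DecidableRel G.Adj]

omit [DecidableEq W] in
theorem exists_other_neighbor {p : W} (hp : 2 ≤ G.degree p) (a : W) :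
    ∃ b, b ≠ a ∧ G.Adj p b := by
  rw [← G.card_neighborFinset_eq_degree] at hp
  obtain ⟨b, hb, hba⟩ := Finset.exists_mem_ne (by omega : 1 < (G.neighborFinset p).card) a
  exact ⟨b, hba, by simpa using hb⟩

theorem adj_iff_of_degree_two {p a b : W} (hp : G.degree p = 2) (ha : G.Adj p a) (hb : G.Adj p b)
    (hab : a ≠ b) (t : W) : G.Adj p t ↔ t = a ∨ t = b := by
  have hsub : ({a, b} : Finset W) ⊆ G.neighborFinset p := by
    intro s hs
    simp only [Finset.mem_insert, Finset.mem_singleton] at hs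
    rcases hs with rfl | rfl <;> simpa
  have := Finset.eq_of_subset_of_card_le hsub (by
    rw [G.card_neighborFinset_eq_degree, hp, Finset.card_pair hab])
  rw [← G.mem_neighborFinset, ← this]
  simp

theorem adj_iff_of_degree_three {p a b c : W} (hp : G.degree p = 3) (ha : G.Adj p a)
    (hb : G.Adj p b) (hc : G.Adj p c) (hab : a ≠ b) (hac : a ≠ c) (hbc : b ≠ c) (t : W) :
    G.Adj p t ↔ t = a ∨ t = b ∨ t = c := by
  have hsub : ({a, b, c} : Finset W) ⊆ G.neighborFinset p := by
    intro s hs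
    simp only [Finset.mem_insert, Finset.mem_singleton] at hs
    rcases hs with rfl | rfl | rfl <;> simpa
  have := Finset.eq_of_subset_of_card_le hsub (by
    rw [G.card_neighborFinset_eq_degree, hp, Finset.card_eq_three.2 ⟨a, b, c, hab, hac, hbc, rfl⟩])
  rw [← G.mem_neighborFinset, ← this]
  simp

/-- Following the vertices of degree two from `u` through its neighbour `x` leads to `u` or `v`. The
proof prolongs an initial piece as long as possible: it cannot run into itself, since its vertices
have their two neighbours on it already. -/
theorem exists_thread {u v x : W} {S : Finset W}
    (hdeg : ∀ s ∈ S, s ≠ u → s ≠ v → G.degree s = 2)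
    (hcl : ∀ s ∈ S, s ≠ u → s ≠ v → ∀ t, G.Adj s t → t ∈ S)
    (hxS : x ∈ S) (hxu : x ≠ u) (hxv : x ≠ v) (hux : G.Adj u x) :
    ∃ z L w, (z = u ∨ z = v) ∧ IsThread G u z L w ∧ 0 < L ∧ w 1 = x ∧
      (∀ k < L, w (k + 1) ∈ S ∧ w (k + 1) ≠ u ∧ w (k + 1) ≠ v) := by
  suffices H : ∀ m n : ℕ, ∀ w : ℕ → W, Fintype.card W ≤ n + m → w 0 = u → w 1 = x →
      (∀ k < n + 1, w (k + 1) ∈ S ∧ w (k + 1) ≠ u ∧ w (k + 1) ≠ v) →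
      (∀ j < n + 1, ∀ k < n + 1, w (j + 1) = w (k + 1) → j = k) →
      (∀ k ≤ n, G.Adj (w k) (w (k + 1))) →
      ∃ z L w, (z = u ∨ z = v) ∧ IsThread G u z L w ∧ 0 < L ∧ w 1 = x ∧
        (∀ k < L, w (k + 1) ∈ S ∧ w (k + 1) ≠ u ∧ w (k + 1) ≠ v) by
    refine H (Fintype.card W) 0 (fun k => if k = 0 then u else x) (by simp) (by simp) (by simp)
      ?_ ?_ ?_
    · intro k hk
      simp [hxS, hxu, hxv]
    · intro j hj k hk _
      omega
    · intro k hk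
      obtain rfl : k = 0 := by omega
      simpa using hux
  intro m
  induction m with
  | zero =>
    intro n w hcard _ _ _ hinj _
    exfalso
    have : Function.Injective fun k : Fin (n + 1) => w (k + 1) := fun j k hjk =>
      Fin.ext (hinj j j.2 k k.2 hjk)
    have := Fintype.card_le_of_injective _ this
    rw [Fintype.card_fin] at this
    omega
  | succ m ih =>
    intro n w hcard h0 h1 hmem hinj hadj
    obtain ⟨hpS, hpu, hpv⟩ := hmem n (Nat.lt_succ_self n)
    have hpdeg := hdeg _ hpS hpu hpv
    obtain ⟨t, htn, hpt⟩ := exists_other_neighbor hpdeg.ge (w n)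
    -- consecutive neighbours on the piece are distinct
    have hne2 : ∀ k < n, w k ≠ w (k + 2) := by
      intro k hk he
      rcases k with _ | k
      · exact (hmem 1 (by omega)).2.1 (he.symm.trans h0)
      · have := hinj k (by omega) (k + 2) (by omega) he
        omega
    have hnbr : ∀ k < n, ∀ s, G.Adj (w (k + 1)) s ↔ s = w k ∨ s = w (k + 2) := by
      intro k hk s
      obtain ⟨q1, q2, q3⟩ := hmem k (by omega)
      exact adj_iff_of_degree_two (hdeg _ q1 q2 q3) (hadj k (by omega)).symm
        (hadj (k + 1) (by omega))
        (hne2 k hk) s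
    have hnbrn : ∀ s, G.Adj (w (n + 1)) s ↔ s = w n ∨ s = t :=
      adj_iff_of_degree_two hpdeg (hadj n le_rfl).symm hpt htn.symm
    set w' : ℕ → W := fun k => if k ≤ n + 1 then w k else t with hw'
    have hw'le : ∀ k ≤ n + 1, w' k = w k := fun k hk => if_pos hk
    have hw'gt : w' (n + 2) = t := if_neg (by omega)
    by_cases ht : t = u ∨ t = v
    · refine ⟨t, n + 1, w', ht, ?_, Nat.succ_pos n, ?_, ?_⟩
      · have hnt : ∀ k < n + 1, w (k + 1) ≠ t := by
          intro k hk he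
          rcases ht with rfl | rfl
          · exact (hmem k hk).2.1 he
          · exact (hmem k hk).2.2 he
        refine ⟨?_, hw'gt, ?_, ?_, ?_, ?_, ?_, ?_⟩
        · rw [hw'le 0 (by omega), h0]
        · intro k hk
          rw [hw'le _ (by omega)]
          exact (hmem k hk).2.1
        · intro k hk
          rw [hw'le _ (by omega)]
          exact hnt k hk
        · intro j hj k hk
          rw [hw'le _ (by omega), hw'le _ (by omega)]
          exact hinj j hj k hk
        · intro k hk s
          rw [hw'le (k + 1) (by omega), hw'le k (by omega)]
          rcases Nat.lt_or_ge k n with hkn | hkn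
          · rw [hw'le (k + 2) (by omega)]
            exact hnbr k hkn s
          · obtain rfl : k = n := by omega
            rw [hw'gt]
            exact hnbrn s
        · intro h
          omega
        · intro hut
          by_contra hlt
          obtain rfl : n = 0 := by omega
          exact htn (hut.symm.trans h0.symm)
      · rw [hw'le 1 (by omega), h1]
      · intro k hk
        rw [hw'le _ (by omega)]
        exact hmem k hk
    · rw [not_or] at ht
      have hnew : ∀ j < n + 1, w (j + 1) ≠ t := by
        rintro j hj rfl
        rcases Nat.lt_or_ge j n with hjn | hjn
        · rcases (hnbr j hjn _).1 hpt.symm with he | he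
          · rcases j with _ | j
            · exact hpu (he.trans h0)
            · have := hinj n (by omega) j (by omega) he
              omega
          · have := hinj n (by omega) (j + 1) (by omega) he
            subst this
            exact htn rfl
        · obtain rfl : j = n := by omega
          exact G.irrefl hpt
      refine ih (n + 1) w' (by omega) ?_ ?_ ?_ ?_ ?_
      · rw [hw'le 0 (by omega), h0]
      · rw [hw'le 1 (by omega), h1]
      · intro k hk
        rcases Nat.lt_or_ge k (n + 1) with hkn | hkn
        · rw [hw'le _ (by omega)]
          exact hmem k hkn
        · obtain rfl : k = n + 1 := by omega
          rw [hw'gt]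
          exact ⟨hcl _ hpS hpu hpv _ hpt, ht.1, ht.2⟩
      · intro j hj k hk he
        rcases Nat.lt_or_ge j (n + 1) with hjn | hjn <;>
          rcases Nat.lt_or_ge k (n + 1) with hkn | hkn
        · rw [hw'le _ (by omega), hw'le _ (by omega)] at he
          exact hinj j hjn k hkn he
        · obtain rfl : k = n + 1 := by omega
          rw [hw'le _ (by omega), hw'gt] at he
          exact absurd he (hnew j hjn)
        · obtain rfl : j = n + 1 := by omega
          rw [hw'le (k + 1) (by omega), hw'gt] at he
          exact absurd he.symm (hnew k hkn)
        · omega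
      · intro k hk
        rcases Nat.lt_or_ge k (n + 1) with hkn | hkn
        · rw [hw'le _ (by omega), hw'le _ (by omega)]
          exact hadj k (by omega)
        · obtain rfl : k = n + 1 := by omega
          rw [hw'gt, hw'le _ (by omega)]
          exact hpt

omit [Fintype W] [DecidableRel G.Adj] in
/-- Removing the inner vertices of a thread keeps a set closed under adjacency, up to the ends. -/
theorem IsThread.sdiff_closed {u v x z : W} {L : ℕ} {w : ℕ → W} (h : IsThread G x z L w)
    {S : Finset W} (hx : x = u ∨ x = v) (hz : z = u ∨ z = v)
    (hcl : ∀ s ∈ S, s ≠ u → s ≠ v → ∀ t, G.Adj s t → t ∈ S) :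
    ∀ s ∈ S \ innerVerts w L, s ≠ u → s ≠ v → ∀ t, G.Adj s t → t ∈ S \ innerVerts w L := by
  intro s hs hsu hsv t hst
  rw [Finset.mem_sdiff] at hs ⊢
  refine ⟨hcl s hs.1 hsu hsv t hst, fun ht => hs.2 ?_⟩
  obtain ⟨k, hk, rfl⟩ := mem_innerVerts.1 ht
  rcases (h.nbr k hk s).1 hst.symm with rfl | rfl
  · rcases k with _ | k
    · rw [h.start] at hsu hsv
      rcases hx with rfl | rfl
      · exact absurd rfl hsu
      · exact absurd rfl hsv
    · exact mem_innerVerts.2 ⟨k, by omega, rfl⟩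
  · rcases Nat.lt_or_ge (k + 1) L with h1 | h1
    · exact mem_innerVerts.2 ⟨k + 1, h1, rfl⟩
    · obtain rfl : L = k + 1 := by omega
      rw [h.finish] at hsu hsv
      rcases hz with rfl | rfl
      · exact absurd rfl hsu
      · exact absurd rfl hsv

/-- The permanent for a set that is a union of cycles is a product over the cycles. -/
theorem exists_cycles (n : ℕ) : ∀ D : Finset W, D.card = n → (∀ s ∈ D, G.degree s = 2) →
    (∀ s ∈ D, ∀ t, G.Adj s t → t ∈ D) →
    ∃ ks : Multiset ℕ, (∀ k ∈ ks, 3 ≤ k) ∧ ks.sum = D.card ∧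
      ∀ (R : Type) [CommRing R] (y : R),
        permOn (shiftMat G y) D = (ks.map fun k => cycleVal y k).prod := by
  induction n using Nat.strong_induction_on with
  | _ n ih =>
    intro D hn hdeg hcl
    rcases D.eq_empty_or_nonempty with rfl | ⟨d, hd⟩
    · exact ⟨0, by simp, by simp, fun R _ y => by simp [permOn_empty]⟩
    obtain ⟨x, hx⟩ : ∃ x, G.Adj d x := by
      have h2 := hdeg d hd
      rw [← G.card_neighborFinset_eq_degree] at h2
      obtain ⟨x, hx⟩ := Finset.card_pos.1 (by omega : 0 < (G.neighborFinset d).card)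
      exact ⟨x, by simpa using hx⟩
    obtain ⟨z, L, w, hz, hth, hL, hw1, hw⟩ := exists_thread (G := G) (u := d) (v := d) (S := D)
      (fun s hs _ _ => hdeg s hs) (fun s hs _ _ => hcl s hs) (hcl d hd x hx) hx.ne' hx.ne' hx
    obtain rfl : d = z := by
      rcases hz with rfl | rfl <;> rfl
    have hL2 := hth.two_le rfl
    set I := innerVerts w L with hI
    have hID : insert d I ⊆ D := by
      intro t ht
      rcases Finset.mem_insert.1 ht with rfl | ht
      · exact hd
      · obtain ⟨k, hk, rfl⟩ := mem_innerVerts.1 ht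
        exact (hw k hk).1
    have hdI : d ∉ I := hth.notMem_left
    have hIcard : I.card = L := hth.card_innerVerts
    set D' := D \ insert d I with hD'
    have hdw1 : G.Adj d (w 1) := hw1 ▸ hx
    have hdwL : G.Adj d (w L) := by
      have := (hth.adj le_rfl).symm
      rwa [hth.finish] at this
    have hne : w 1 ≠ w L := by
      intro he
      have := hth.inj 0 (by omega) (L - 1) (by omega) (by
        rw [show L - 1 + 1 = L by omega]
        exact he)
      omega
    have hw1I : w 1 ∈ I := mem_innerVerts.2 ⟨0, by omega, rfl⟩
    have hwLI : w L ∈ I := mem_innerVerts.2 ⟨L - 1, by omega, by congr 1; omega⟩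
    have hdnbr := adj_iff_of_degree_two (hdeg d hd) hdw1 hdwL hne
    have hdcl : ∀ t ∈ D', ¬ G.Adj d t := by
      intro t ht ha
      rw [hD', Finset.mem_sdiff, Finset.mem_insert, not_or] at ht
      rcases (hdnbr t).1 ha with rfl | rfl
      · exact ht.2.2 hw1I
      · exact ht.2.2 hwLI
    have hcl' : ∀ s ∈ D', ∀ t, G.Adj s t → t ∈ D' := by
      intro s hs t hst
      have hsd : s ≠ d := by
        rintro rfl
        simp [hD'] at hs
      have h3 := hth.sdiff_closed (u := d) (v := d) (S := D) (Or.inl rfl) (Or.inl rfl)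
        (fun s hs _ _ => hcl s hs) s (by
          rw [hD', Finset.mem_sdiff, Finset.mem_insert, not_or] at hs
          exact Finset.mem_sdiff.2 ⟨hs.1, hs.2.2⟩) hsd hsd t hst
      rw [Finset.mem_sdiff] at h3
      rw [hD', Finset.mem_sdiff, Finset.mem_insert, not_or]
      refine ⟨h3.1, ?_, h3.2⟩
      rintro rfl
      exact hdcl s hs hst.symm
    have hcard : D'.card + (L + 1) = D.card := by
      rw [hD', Finset.card_sdiff_of_subset hID, Finset.card_insert_of_notMem hdI, hIcard]
      have := Finset.card_le_card hID
      rw [Finset.card_insert_of_notMem hdI, hIcard] at this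
      omega
    obtain ⟨ks, hks, hsum, hprod⟩ := ih D'.card (by omega) D' rfl
      (fun s hs => hdeg s (Finset.mem_sdiff.1 hs).1) hcl'
    refine ⟨(L + 1) ::ₘ ks, ?_, ?_, ?_⟩
    · intro k hk
      rcases Multiset.mem_cons.1 hk with rfl | hk
      · omega
      · exact hks k hk
    · rw [Multiset.sum_cons, hsum]
      omega
    · intro R _ y
      rw [Multiset.map_cons, Multiset.prod_cons, ← hprod]
      have hDeq : D = insert d D' ∪ I := by
        ext t
        simp only [hD', Finset.mem_union, Finset.mem_insert, Finset.mem_sdiff]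
        constructor
        · intro ht
          tauto
        · rintro ((rfl | ht) | ht)
          · exact hd
          · exact ht.1
          · exact hID (Finset.mem_insert_of_mem ht)
      have hdis : Disjoint D' I := by
        rw [Finset.disjoint_left]
        intro t ht hti
        rw [hD', Finset.mem_sdiff, Finset.mem_insert, not_or] at ht
        exact ht.2.2 hti
      conv_lhs => rw [hDeq]
      rw [hth.permOn_cycle y (hdeg d hd) hdis (by simp [hD']) hdcl]
      rfl

end Extraction

/-! ### Graphs with two vertices of degree three, the others of degree two -/

section Classification

namespace IsThread

variable {W : Type*} {G : SimpleGraph W} {x z : W} {L : ℕ} {w : ℕ → W}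

theorem eq_zero_of_adj_start (h : IsThread G x z L w) {k : ℕ} (hk : k < L)
    (ha : G.Adj x (w (k + 1))) : k = 0 ∨ k + 1 = L ∧ x = z := by
  rcases (h.nbr k hk x).1 ha.symm with he | he
  · rcases k with _ | k
    · exact Or.inl rfl
    · exact absurd he.symm (h.ne_start k (by omega))
  · rcases Nat.lt_or_ge (k + 1) L with h1 | h1
    · exact absurd he.symm (h.ne_start (k + 1) h1)
    · obtain rfl : L = k + 1 := by omega
      exact Or.inr ⟨rfl, he.trans h.finish⟩

theorem eq_last_of_adj_finish (h : IsThread G x z L w) {k : ℕ} (hk : k < L)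
    (ha : G.Adj z (w (k + 1))) : k + 1 = L ∨ k = 0 ∧ x = z := by
  rcases (h.nbr k hk z).1 ha.symm with he | he
  · rcases k with _ | k
    · exact Or.inr ⟨rfl, h.start.symm.trans he.symm⟩
    · exact absurd he.symm (h.ne_finish k (by omega))
  · rcases Nat.lt_or_ge (k + 1) L with h1 | h1
    · exact absurd he.symm (h.ne_finish (k + 1) h1)
    · left
      omega

theorem adj_last (h : IsThread G x z L w) : G.Adj z (w L) := by
  have := (h.adj le_rfl).symm
  rwa [h.finish] at this

theorem adj_first (h : IsThread G x z L w) : G.Adj x (w 1) := by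
  have := h.adj (Nat.zero_le L)
  rwa [h.start] at this

theorem first_ne_last (h : IsThread G x x L w) : w 1 ≠ w L := by
  have h2 := h.two_le rfl
  intro he
  have := h.inj 0 (by omega) (L - 1) (by omega) (by
    rw [show L - 1 + 1 = L by omega]
    exact he)
  omega

theorem adj_inner (h : IsThread G x z L w) {k : ℕ} (hk : k < L) {t : W}
    (ha : G.Adj t (w (k + 1))) : t = x ∨ t = z ∨ ∃ j < L, t = w (j + 1) := by
  rcases (h.nbr k hk t).1 ha.symm with rfl | rfl
  · rcases k with _ | k
    · exact Or.inl h.start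
    · exact Or.inr (Or.inr ⟨k, by omega, rfl⟩)
  · rcases Nat.lt_or_ge (k + 1) L with h1 | h1
    · exact Or.inr (Or.inr ⟨k + 1, h1, rfl⟩)
    · obtain rfl : L = k + 1 := by omega
      exact Or.inr (Or.inl h.finish)

end IsThread

/-- An edge is a thread without inner vertices. -/
theorem isThread_edge {W : Type*} {G : SimpleGraph W} {u v : W} (h : G.Adj u v) :
    IsThread G u v 0 fun k => if k = 0 then u else v where
  start := by simp
  finish := by simp
  ne_start := by simp
  ne_finish := by simp
  inj := by simp
  nbr := by simp
  adj_of_zero _ := h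
  two_le he := absurd he h.ne

variable {W : Type*} [Fintype W] [DecidableEq W] {G : SimpleGraph W} [DecidableRel G.Adj]

/-- A thread starts with any given edge at `u`; it may consist of that edge only. -/
theorem exists_thread_or_edge {u v x : W} {S : Finset W}
    (hdeg : ∀ s ∈ S, s ≠ u → s ≠ v → G.degree s = 2)
    (hcl : ∀ s ∈ S, s ≠ u → s ≠ v → ∀ t, G.Adj s t → t ∈ S)
    (hxS : x ∈ S) (hux : G.Adj u x) :
    ∃ z L w, (z = u ∨ z = v) ∧ IsThread G u z L w ∧ w 1 = x ∧
      (∀ k < L, w (k + 1) ∈ S ∧ w (k + 1) ≠ u ∧ w (k + 1) ≠ v) := by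
  by_cases hxv : x = v
  · subst hxv
    exact ⟨x, 0, _, Or.inr rfl, isThread_edge hux, by simp, by simp⟩
  · obtain ⟨z, L, w, hz, hth, _, hw1, hw⟩ := exists_thread hdeg hcl hxS hux.ne' hxv hux
    exact ⟨z, L, w, hz, hth, hw1, hw⟩

/-- The third neighbour of `u` starts a thread that cannot return to `u`, so it ends at `v`; a
thread from `v` that leaves it cannot end at `u`, whose neighbours are used up, and returns to `v`. -/
theorem exists_dumbbell_of_loop {u v : W} (huv : u ≠ v) (hu : G.degree u = 3)
    (hv : G.degree v = 3) (hdeg : ∀ s, s ≠ u → s ≠ v → G.degree s = 2) {a : ℕ} {wa : ℕ → W}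
    (ha : IsThread G u u a wa) (hav : ∀ k < a, wa (k + 1) ≠ v) :
    ∃ b c wb wc, IsDumbbell G u v a b c wa wb wc := by
  have ha2 := ha.two_le rfl
  have hwa1 : wa 1 ∈ innerVerts wa a := mem_innerVerts.2 ⟨0, by omega, rfl⟩
  have hwaa : wa a ∈ innerVerts wa a := mem_innerVerts.2 ⟨a - 1, by omega, by congr 1; omega⟩
  obtain ⟨x, hxN, hx⟩ : ∃ x ∈ G.neighborFinset u, x ∉ ({wa 1, wa a} : Finset W) := by
    refine Finset.exists_mem_notMem_of_card_lt_card ?_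
    rw [G.card_neighborFinset_eq_degree, hu]
    exact lt_of_le_of_lt Finset.card_le_two (by omega)
  rw [SimpleGraph.mem_neighborFinset] at hxN
  simp only [Finset.mem_insert, Finset.mem_singleton, not_or] at hx
  have hnu := adj_iff_of_degree_three hu ha.adj_first ha.adj_last hxN ha.first_ne_last
    (Ne.symm hx.1) (Ne.symm hx.2)
  set S := Finset.univ \ innerVerts wa a with hS
  have hclS : ∀ s ∈ S, s ≠ u → s ≠ v → ∀ t, G.Adj s t → t ∈ S :=
    ha.sdiff_closed (Or.inl rfl) (Or.inl rfl) (by simp)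
  have hxS : x ∈ S := by
    rw [hS, Finset.mem_sdiff]
    refine ⟨Finset.mem_univ _, fun hm => ?_⟩
    obtain ⟨k, hk, rfl⟩ := mem_innerVerts.1 hm
    rcases ha.eq_zero_of_adj_start hk hxN with rfl | ⟨rfl, _⟩
    · exact hx.1 rfl
    · exact hx.2 rfl
  obtain ⟨z, c, wc, hz, hc, hc1, hcm⟩ := exists_thread_or_edge (G := G) (u := u) (v := v)
    (fun s _ => hdeg s) hclS hxS hxN
  obtain rfl : v = z := by
    rcases hz with rfl | rfl
    · exfalso
      have h2 := hc.two_le rfl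
      have hm := (hcm (c - 1) (by omega)).1
      rw [show c - 1 + 1 = c by omega, hS, Finset.mem_sdiff] at hm
      rcases (hnu _).1 hc.adj_last with he | he | he
      · exact hm.2 (he ▸ hwa1)
      · exact hm.2 (he ▸ hwaa)
      · exact hc.first_ne_last (hc1.trans he.symm)
    · rfl
  obtain ⟨t, htc, hvt⟩ := exists_other_neighbor (G := G) (p := v) (by omega) (wc c)
  have hwc1 : wc 1 ∈ innerVerts wc c ∨ wc 1 = v := by
    rcases Nat.eq_zero_or_pos c with h0 | h0
    · right
      have := hc.finish
      rwa [h0] at this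
    · exact Or.inl (mem_innerVerts.2 ⟨0, h0, rfl⟩)
  have hwcc : wc c ∈ innerVerts wc c ∨ wc c = u := by
    rcases Nat.eq_zero_or_pos c with h0 | h0
    · right
      rw [h0]
      exact hc.start
    · exact Or.inl (last_mem_innerVerts h0.ne')
  have htu : t ≠ u := by
    rintro rfl
    rcases (hnu v).1 hvt.symm with he | he | he
    · exact hav 0 (by omega) he.symm
    · exact hav (a - 1) (by omega) (by rw [show a - 1 + 1 = a by omega]; exact he.symm)
    · rcases Nat.eq_zero_or_pos c with h0 | h0
      · rw [h0] at htc
        exact htc hc.start.symm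
      · exact hc.ne_finish 0 h0 (hc1.trans he.symm)
  set S' := S \ innerVerts wc c with hS'
  have hclS' : ∀ s ∈ S', s ≠ v → s ≠ u → ∀ t, G.Adj s t → t ∈ S' :=
    hc.sdiff_closed (Or.inr rfl) (Or.inl rfl) (fun s hs h1 h2 => hclS s hs h2 h1)
  have htS' : t ∈ S' := by
    rw [hS', hS, Finset.mem_sdiff, Finset.mem_sdiff]
    refine ⟨⟨Finset.mem_univ _, fun hm => ?_⟩, fun hm => ?_⟩
    · obtain ⟨k, hk, rfl⟩ := mem_innerVerts.1 hm
      rcases ha.adj_inner hk hvt with he | he | ⟨j, hj, he⟩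
      · exact huv he.symm
      · exact huv he.symm
      · exact hav j hj he.symm
    · obtain ⟨k, hk, rfl⟩ := mem_innerVerts.1 hm
      rcases hc.eq_last_of_adj_finish hk hvt with rfl | ⟨_, he⟩
      · exact htc rfl
      · exact huv he
  obtain ⟨z, b, wb, hz, hb, hb0, hb1, hbm⟩ := exists_thread (G := G) (u := v) (v := u)
    (fun s _ h1 h2 => hdeg s h2 h1) hclS' htS' hvt.ne' htu hvt
  have hwbS : ∀ k < b, wb (k + 1) ∉ innerVerts wa a ∧ wb (k + 1) ∉ innerVerts wc c := by
    intro k hk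
    have := (hbm k hk).1
    simp only [hS', hS, Finset.mem_sdiff] at this
    exact ⟨this.1.2, this.2⟩
  obtain rfl : v = z := by
    rcases hz with rfl | rfl
    · rfl
    · exfalso
      have hm := hwbS (b - 1) (by omega)
      have hmv := (hbm (b - 1) (by omega)).2.1
      rw [show b - 1 + 1 = b by omega] at hm hmv
      rcases (hnu _).1 hb.adj_last with he | he | he
      · exact hm.1 (he ▸ hwa1)
      · exact hm.1 (he ▸ hwaa)
      · rcases hwc1 with h1 | h1
        · exact hm.2 (he ▸ hc1 ▸ h1)
        · exact hmv (he.trans (hc1.symm.trans h1))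
  have hb2 := hb.two_le rfl
  have hbne : ∀ k < b, wc c ≠ wb (k + 1) := by
    intro k hk he
    rcases hwcc with h1 | h1
    · exact (hwbS k hk).2 (he ▸ h1)
    · exact (hbm k hk).2.2 (he.symm.trans h1)
  have hnv := adj_iff_of_degree_three hv hb.adj_first hb.adj_last hc.adj_last hb.first_ne_last
    (hbne 0 (by omega)).symm (by
      have := (hbne (b - 1) (by omega)).symm
      rwa [show b - 1 + 1 = b by omega] at this)
  refine ⟨b, c, wb, wc, huv, ha, hb, hc, hav, fun k hk => (hbm k hk).2.2, ?_, ?_, ?_, ?_, hnv⟩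
  · intro k hk l hl he
    exact (hwbS l hl).1 (mem_innerVerts.2 ⟨k, hk, he⟩)
  · intro k hk l hl he
    have := (hcm l hl).1
    rw [hS, Finset.mem_sdiff] at this
    exact this.2 (mem_innerVerts.2 ⟨k, hk, he⟩)
  · intro k hk l hl he
    exact (hwbS k hk).2 (mem_innerVerts.2 ⟨l, hl, he.symm⟩)
  · rw [hc1]
    exact hnu

/-- The threads from `u` through its three neighbours all end at `v`. They are found one after the
other, each outside the preceding ones, and so are disjoint. -/
theorem exists_theta_of_no_loop {u v : W} (huv : u ≠ v) (hu : G.degree u = 3)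
    (hv : G.degree v = 3) (hdeg : ∀ s, s ≠ u → s ≠ v → G.degree s = 2)
    (hno : ¬ ∃ a wa, IsThread G u u a wa ∧ ∀ k < a, wa (k + 1) ≠ v) :
    ∃ L w, IsTheta G u v L w := by
  have key : ∀ (S : Finset W) (x : W),
      (∀ s ∈ S, s ≠ u → s ≠ v → ∀ t, G.Adj s t → t ∈ S) → x ∈ S → G.Adj u x →
      ∃ L w, IsThread G u v L w ∧ w 1 = x ∧
        (∀ k < L, w (k + 1) ∈ S ∧ w (k + 1) ≠ u ∧ w (k + 1) ≠ v) := by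
    intro S x hcl hx hux
    obtain ⟨z, L, w, hz, hth, hw1, hw⟩ := exists_thread_or_edge (G := G) (u := u) (v := v)
      (fun s _ => hdeg s) hcl hx hux
    rcases hz with rfl | rfl
    · exact absurd ⟨L, w, hth, fun k hk => (hw k hk).2.2⟩ hno
    · exact ⟨L, w, hth, hw1, hw⟩
  have hout : ∀ {x x' : W} {L : ℕ} {w : ℕ → W}, IsThread G u v L w → w 1 = x → G.Adj u x' →
      x' ≠ x → x' ∉ innerVerts w L := by
    intro x x' L w hth hw1 hux hne hm
    obtain ⟨k, hk, rfl⟩ := mem_innerVerts.1 hm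
    rcases hth.eq_zero_of_adj_start hk hux with rfl | ⟨_, he⟩
    · exact hne hw1
    · exact huv he
  -- the third thread may be the edge `u v`, the first two are not
  obtain ⟨x, hxN, y, hyN, hxy⟩ : ∃ x ∈ (G.neighborFinset u).erase v,
      ∃ y ∈ (G.neighborFinset u).erase v, x ≠ y := by
    refine Finset.one_lt_card.1 ?_
    have := Finset.pred_card_le_card_erase (s := G.neighborFinset u) (a := v)
    rw [G.card_neighborFinset_eq_degree, hu] at this
    omega
  rw [Finset.mem_erase, SimpleGraph.mem_neighborFinset] at hxN hyN
  obtain ⟨t, htN, ht⟩ : ∃ t ∈ G.neighborFinset u, t ∉ ({x, y} : Finset W) := by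
    refine Finset.exists_mem_notMem_of_card_lt_card ?_
    rw [G.card_neighborFinset_eq_degree, hu]
    exact lt_of_le_of_lt Finset.card_le_two (by omega)
  rw [SimpleGraph.mem_neighborFinset] at htN
  simp only [Finset.mem_insert, Finset.mem_singleton, not_or] at ht
  have hnu := adj_iff_of_degree_three hu htN hxN.2 hyN.2 ht.1 ht.2 hxy
  obtain ⟨L1, w1, h1, e1, m1⟩ := key Finset.univ x (by simp) (Finset.mem_univ _) hxN.2
  set S1 := Finset.univ \ innerVerts w1 L1 with hS1
  have hcl1 : ∀ s ∈ S1, s ≠ u → s ≠ v → ∀ t, G.Adj s t → t ∈ S1 :=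
    h1.sdiff_closed (Or.inl rfl) (Or.inr rfl) (by simp)
  obtain ⟨L2, w2, h2, e2, m2⟩ := key S1 y hcl1 (by
    rw [hS1, Finset.mem_sdiff]
    exact ⟨Finset.mem_univ _, hout h1 e1 hyN.2 hxy.symm⟩) hyN.2
  set S2 := S1 \ innerVerts w2 L2 with hS2
  have hcl2 : ∀ s ∈ S2, s ≠ u → s ≠ v → ∀ t, G.Adj s t → t ∈ S2 :=
    h2.sdiff_closed (Or.inl rfl) (Or.inr rfl) hcl1
  obtain ⟨L0, w0, h0, e0, m0⟩ := key S2 t hcl2 (by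
    rw [hS2, hS1, Finset.mem_sdiff, Finset.mem_sdiff]
    exact ⟨⟨Finset.mem_univ _, hout h1 e1 htN ht.1⟩, hout h2 e2 htN ht.2⟩) htN
  have d21 : ∀ k < L2, w2 (k + 1) ∉ innerVerts w1 L1 := fun k hk =>
    (Finset.mem_sdiff.1 (m2 k hk).1).2
  have d02 : ∀ k < L0, w0 (k + 1) ∉ innerVerts w2 L2 := fun k hk =>
    (Finset.mem_sdiff.1 (m0 k hk).1).2
  have d01 : ∀ k < L0, w0 (k + 1) ∉ innerVerts w1 L1 := fun k hk =>
    (Finset.mem_sdiff.1 (Finset.mem_sdiff.1 (m0 k hk).1).1).2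
  have hL1 : L1 ≠ 0 := by
    rintro rfl
    exact hxN.1 (e1.symm.trans h1.finish)
  have hL2 : L2 ≠ 0 := by
    rintro rfl
    exact hyN.1 (e2.symm.trans h2.finish)
  have l1 := last_mem_innerVerts (w := w1) hL1
  have l2 := last_mem_innerVerts (w := w2) hL2
  have n12 : w1 L1 ≠ w2 L2 := by
    intro he
    refine d21 (L2 - 1) (by omega) ?_
    rw [show L2 - 1 + 1 = L2 by omega, ← he]
    exact l1
  have n01 : w0 L0 ≠ w1 L1 := by
    intro he
    rcases Nat.eq_zero_or_pos L0 with hz | hz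
    · rw [hz, h0.start] at he
      exact h1.notMem_left (he ▸ l1)
    · refine d01 (L0 - 1) (by omega) ?_
      rw [show L0 - 1 + 1 = L0 by omega, he]
      exact l1
  have n02 : w0 L0 ≠ w2 L2 := by
    intro he
    rcases Nat.eq_zero_or_pos L0 with hz | hz
    · rw [hz, h0.start] at he
      exact h2.notMem_left (he ▸ l2)
    · refine d02 (L0 - 1) (by omega) ?_
      rw [show L0 - 1 + 1 = L0 by omega, he]
      exact l2
  have hnv := adj_iff_of_degree_three hv h0.adj_last h1.adj_last h2.adj_last n01 n02 n12
  refine ⟨![L0, L1, L2], ![w0, w1, w2], huv, ?_, ?_, ?_, ?_⟩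
  · intro i
    fin_cases i
    · exact h0
    · exact h1
    · exact h2
  · have d01' : ∀ k < L0, ∀ l < L1, w0 (k + 1) ≠ w1 (l + 1) := fun k hk l hl he =>
      d01 k hk (mem_innerVerts.2 ⟨l, hl, he.symm⟩)
    have d02' : ∀ k < L0, ∀ l < L2, w0 (k + 1) ≠ w2 (l + 1) := fun k hk l hl he =>
      d02 k hk (mem_innerVerts.2 ⟨l, hl, he.symm⟩)
    have d21' : ∀ k < L2, ∀ l < L1, w2 (k + 1) ≠ w1 (l + 1) := fun k hk l hl he =>
      d21 k hk (mem_innerVerts.2 ⟨l, hl, he.symm⟩)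
    intro i j k hk l hl he
    fin_cases i <;> fin_cases j
    · rfl
    · exact absurd he (d01' k hk l hl)
    · exact absurd he (d02' k hk l hl)
    · exact absurd he.symm (d01' l hl k hk)
    · rfl
    · exact absurd he.symm (d21' l hl k hk)
    · exact absurd he.symm (d02' l hl k hk)
    · exact absurd he (d21' k hk l hl)
    · rfl
  · intro s
    rw [hnu]
    simp [Fin.exists_fin_succ, e0, e1, e2]
  · intro s
    rw [hnv]
    simp [Fin.exists_fin_succ]

theorem exists_theta_or_dumbbell {u v : W} (huv : u ≠ v) (hu : G.degree u = 3)
    (hv : G.degree v = 3) (hdeg : ∀ s, s ≠ u → s ≠ v → G.degree s = 2) :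
    (∃ L w, IsTheta G u v L w) ∨ ∃ a b c wa wb wc, IsDumbbell G u v a b c wa wb wc := by
  by_cases hlo : ∃ a wa, IsThread G u u a wa ∧ ∀ k < a, wa (k + 1) ≠ v
  · obtain ⟨a, wa, ha, hav⟩ := hlo
    obtain ⟨b, c, wb, wc, h⟩ := exists_dumbbell_of_loop huv hu hv hdeg ha hav
    exact Or.inr ⟨a, b, c, wa, wb, wc, h⟩
  · exact Or.inl (exists_theta_of_no_loop huv hu hv hdeg hlo)

end Classification

/-! ### The polynomial as a product of values -/

section Evaluation

variable {W : Type*} [Fintype W] [DecidableEq W] (G : SimpleGraph W) [DecidableRel G.Adj]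

theorem eval₂_lapPermPoly {R : Type*} [CommRing R] (y : R) :
    (lapPermPoly G).eval₂ (Int.castRingHom R) (y + 2) = permOn (shiftMat G y) Finset.univ := by
  rw [permOn_univ, lapPermPoly, ← coe_eval₂RingHom, Matrix.permanent, Matrix.permanent, map_sum]
  refine Finset.sum_congr rfl fun σ _ => ?_
  rw [map_prod]
  refine Finset.prod_congr rfl fun i _ => ?_
  rw [Matrix.of_apply, coe_eval₂RingHom, Matrix.charmatrix_apply, SimpleGraph.lapMatrix,
    Matrix.sub_apply, SimpleGraph.degMatrix, SimpleGraph.adjMatrix_apply, shiftMat]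
  by_cases h : σ i = i
  · rw [h]
    simp
  · simp only [Matrix.diagonal_apply_ne _ h, h, if_false, zero_sub, map_neg, sub_neg_eq_add,
      zero_add, eval₂_C]
    split_ifs <;> simp

end Evaluation

section Structure

variable {W : Type*} [Fintype W] [DecidableEq W] {G : SimpleGraph W} [DecidableRel G.Adj]
  {u v : W}

omit [Fintype W] [DecidableEq W] [DecidableRel G.Adj] in
theorem IsTheta.comp {L : Fin 3 → ℕ} {w : Fin 3 → ℕ → W} (h : IsTheta G u v L w)
    (e : Equiv.Perm (Fin 3)) : IsTheta G u v (L ∘ e) (w ∘ e) where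
  ne := h.ne
  thread i := h.thread (e i)
  disj i j k hk l hl he := e.injective (h.disj (e i) (e j) k hk l hl he)
  nbr_left t := by rw [h.nbr_left, ← e.exists_congr_right]; rfl
  nbr_right t := by rw [h.nbr_right, ← e.exists_congr_right]; rfl

/-- Only one of the three paths can be an edge, since `u` has three neighbours. -/
theorem IsTheta.eq_of_length_zero {L : Fin 3 → ℕ} {w : Fin 3 → ℕ → W} (h : IsTheta G u v L w)
    (hu : G.degree u = 3) {i j : Fin 3} (hi : L i = 0) (hj : L j = 0) : i = j := by
  have himg : G.neighborFinset u = Finset.univ.image fun i => w i 1 := by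
    ext t
    simp [h.nbr_left, eq_comm]
  have hinj : Function.Injective fun i => w i 1 := by
    rw [← Set.injOn_univ, ← Finset.coe_univ, ← Finset.card_image_iff, ← himg,
      G.card_neighborFinset_eq_degree, hu]
    rfl
  apply hinj
  have h1 := (h.thread i).finish
  have h2 := (h.thread j).finish
  rw [hi] at h1
  rw [hj] at h2
  exact h1.trans h2.symm

/-- A graph with a theta graph as a union of components, and vertices of degree two otherwise,
consists of the theta graph and cycles. -/
theorem IsTheta.exists_cycles {L : Fin 3 → ℕ} {w : Fin 3 → ℕ → W} (h : IsTheta G u v L w)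
    (hu : G.degree u = 3) (hv : G.degree v = 3) (hdeg : ∀ s, s ≠ u → s ≠ v → G.degree s = 2)
    (h1 : L 1 ≠ 0) (h2 : L 2 ≠ 0) :
    ∃ ks : Multiset ℕ, (∀ k ∈ ks, 3 ≤ k) ∧ L 0 + L 1 + L 2 + 2 + ks.sum = Fintype.card W ∧
      ∀ (R : Type) [CommRing R] (y : R), permOn (shiftMat G y) Finset.univ =
        thetaVal y (L 0) (L 1) (L 2) * (ks.map fun k => cycleVal y k).prod := by
  set I := fun i => innerVerts (w i) (L i) with hI
  set C := insert u (insert v ∅) ∪ I 0 ∪ I 1 ∪ I 2 with hC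
  have hmC : ∀ t, t ∈ C ↔ t = u ∨ t = v ∨ ∃ i, t ∈ I i := by
    intro t
    simp only [hC, Finset.mem_union, Finset.mem_insert, Finset.notMem_empty, or_false,
      Fin.exists_fin_succ]
    simp only [Fin.succ_zero_eq_one, Fin.succ_one_eq_two, IsEmpty.exists_iff, or_false]
    tauto
  have huI : ∀ i, u ∉ I i := fun i => (h.thread i).notMem_left
  have hvI : ∀ i, v ∉ I i := fun i => (h.thread i).notMem_right
  have hII : ∀ i j, i ≠ j → Disjoint (I i) (I j) := by
    intro i j hij
    rw [Finset.disjoint_left]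
    intro t hi hj
    obtain ⟨k, hk, rfl⟩ := mem_innerVerts.1 hi
    obtain ⟨l, hl, he⟩ := mem_innerVerts.1 hj
    exact hij (h.disj i j k hk l hl he.symm)
  have hcard : C.card = L 0 + L 1 + L 2 + 2 := by
    rw [hC, Finset.card_union_of_disjoint, Finset.card_union_of_disjoint,
      Finset.card_union_of_disjoint, (h.thread 0).card_innerVerts, (h.thread 1).card_innerVerts,
      (h.thread 2).card_innerVerts, Finset.card_insert_of_notMem (by simp [h.ne])]
    · simp
      ring
    · simp [Finset.disjoint_insert_left, huI, hvI]
    · simp [Finset.disjoint_insert_left, huI, hvI, hII 0 1 (by decide)]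
    · simp [Finset.disjoint_insert_left, Finset.disjoint_union_left, huI, hvI,
        hII 0 2 (by decide), hII 1 2 (by decide)]
  -- no edge leaves the theta graph
  have hCcl : ∀ s ∈ C, ∀ t, G.Adj s t → t ∈ C := by
    intro s hs t hst
    rw [hmC] at hs ⊢
    rcases hs with rfl | rfl | ⟨i, hi⟩
    · obtain ⟨i, rfl⟩ := (h.nbr_left t).1 hst
      by_cases h0 : L i = 0
      · have := (h.thread i).finish
        rw [h0] at this
        exact Or.inr (Or.inl this)
      · exact Or.inr (Or.inr ⟨i, first_mem_innerVerts h0⟩)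
    · obtain ⟨i, rfl⟩ := (h.nbr_right t).1 hst
      by_cases h0 : L i = 0
      · rw [h0]
        exact Or.inl (h.thread i).start
      · exact Or.inr (Or.inr ⟨i, last_mem_innerVerts h0⟩)
    · obtain ⟨k, hk, rfl⟩ := mem_innerVerts.1 hi
      rcases (h.thread i).adj_inner hk hst.symm with he | he | ⟨j, hj, he⟩
      · exact Or.inl he
      · exact Or.inr (Or.inl he)
      · exact Or.inr (Or.inr ⟨i, mem_innerVerts.2 ⟨j, hj, he.symm⟩⟩)
  set D := Finset.univ \ C with hD
  have hmD : ∀ t, t ∈ D ↔ t ∉ C := by simp [hD]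
  obtain ⟨ks, hks, hsum, hprod⟩ := _root_.exists_cycles (G := G) D.card D rfl (by
      intro s hs
      rw [hmD, hmC, not_or, not_or] at hs
      exact hdeg s hs.1 hs.2.1) (by
      intro s hs t hst
      rw [hmD] at hs ⊢
      exact fun ht => hs (hCcl t ht s hst.symm))
  have hDC : D.card + C.card = Fintype.card W := by
    rw [hD, Finset.card_sdiff_add_card_eq_card (Finset.subset_univ _), Finset.card_univ]
  refine ⟨ks, hks, by omega, fun R _ y => ?_⟩
  rw [← hprod, ← h.permOn_eq y hu hv h1 h2 (D := D)]
  · congr 1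
    ext t
    have hm := hmD t
    rw [hC] at hm
    simp only [Finset.mem_union, Finset.mem_insert, Finset.notMem_empty, or_false,
      Finset.mem_univ, true_iff] at hm ⊢
    tauto
  · rw [hmD, hmC]
    simp
  · rw [hmD, hmC]
    simp
  · intro i
    rw [Finset.disjoint_left]
    intro t ht hi
    rw [hmD, hmC] at ht
    exact ht (Or.inr (Or.inr ⟨i, hi⟩))

/-- A graph with a dumbbell as a union of components, and vertices of degree two otherwise, consists
of the dumbbell and cycles. -/
theorem IsDumbbell.exists_cycles {a b c : ℕ} {wa wb wc : ℕ → W}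
    (h : IsDumbbell G u v a b c wa wb wc)
    (hu : G.degree u = 3) (hv : G.degree v = 3) (hdeg : ∀ s, s ≠ u → s ≠ v → G.degree s = 2) :
    ∃ ks : Multiset ℕ, (∀ k ∈ ks, 3 ≤ k) ∧ a + b + c + 2 + ks.sum = Fintype.card W ∧
      ∀ (R : Type) [CommRing R] (y : R), permOn (shiftMat G y) Finset.univ =
        dumbbellVal y a b c * (ks.map fun k => cycleVal y k).prod := by
  have ha2 := h.loop_left.two_le rfl
  have hb2 := h.loop_right.two_le rfl
  set Ia := innerVerts wa a with hIa
  set Ib := innerVerts wb b with hIb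
  set Ic := innerVerts wc c with hIc
  set C := insert u (insert v ∅) ∪ Ic ∪ Ib ∪ Ia with hC
  have hmC : ∀ t, t ∈ C ↔ t = u ∨ t = v ∨ t ∈ Ia ∨ t ∈ Ib ∨ t ∈ Ic := by
    intro t
    simp only [hC, Finset.mem_union, Finset.mem_insert, Finset.notMem_empty, or_false]
    tauto
  have hua : u ∉ Ia := h.loop_left.notMem_left
  have hvb : v ∉ Ib := h.loop_right.notMem_left
  have huc : u ∉ Ic := h.bridge.notMem_left
  have hvc : v ∉ Ic := h.bridge.notMem_right
  have hva : v ∉ Ia := fun hm => by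
    obtain ⟨k, hk, he⟩ := mem_innerVerts.1 hm
    exact h.ne_left k hk he
  have hub : u ∉ Ib := fun hm => by
    obtain ⟨k, hk, he⟩ := mem_innerVerts.1 hm
    exact h.ne_right k hk he
  have hab : Disjoint Ib Ia := by
    rw [Finset.disjoint_left]
    intro t hi hj
    obtain ⟨k, hk, rfl⟩ := mem_innerVerts.1 hi
    obtain ⟨l, hl, he⟩ := mem_innerVerts.1 hj
    exact h.disj_ab l hl k hk he
  have hac : Disjoint Ic Ia := by
    rw [Finset.disjoint_left]
    intro t hi hj
    obtain ⟨k, hk, rfl⟩ := mem_innerVerts.1 hi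
    obtain ⟨l, hl, he⟩ := mem_innerVerts.1 hj
    exact h.disj_ac l hl k hk he
  have hbc : Disjoint Ic Ib := by
    rw [Finset.disjoint_left]
    intro t hi hj
    obtain ⟨k, hk, rfl⟩ := mem_innerVerts.1 hi
    obtain ⟨l, hl, he⟩ := mem_innerVerts.1 hj
    exact h.disj_bc l hl k hk he
  have hcard : C.card = a + b + c + 2 := by
    rw [hC, Finset.card_union_of_disjoint, Finset.card_union_of_disjoint,
      Finset.card_union_of_disjoint, h.loop_left.card_innerVerts, h.loop_right.card_innerVerts,
      h.bridge.card_innerVerts, Finset.card_insert_of_notMem (by simp [h.ne])]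
    · simp
      ring
    · simp [Finset.disjoint_insert_left, huc, hvc]
    · simp [Finset.disjoint_insert_left, hub, hvb, hbc]
    · simp [Finset.disjoint_insert_left, Finset.disjoint_union_left, hua, hva, hab, hac]
  -- no edge leaves the dumbbell
  have hCcl : ∀ s ∈ C, ∀ t, G.Adj s t → t ∈ C := by
    intro s hs t hst
    rw [hmC] at hs ⊢
    rcases hs with rfl | rfl | hs | hs | hs
    · rcases (h.nbr_left t).1 hst with rfl | rfl | rfl
      · exact Or.inr (Or.inr (Or.inl (first_mem_innerVerts (by omega))))
      · exact Or.inr (Or.inr (Or.inl (last_mem_innerVerts (by omega))))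
      · by_cases h0 : c = 0
        · have := h.bridge.finish
          rw [h0] at this
          exact Or.inr (Or.inl this)
        · exact Or.inr (Or.inr (Or.inr (Or.inr (first_mem_innerVerts h0))))
    · rcases (h.nbr_right t).1 hst with rfl | rfl | rfl
      · exact Or.inr (Or.inr (Or.inr (Or.inl (first_mem_innerVerts (by omega)))))
      · exact Or.inr (Or.inr (Or.inr (Or.inl (last_mem_innerVerts (by omega)))))
      · by_cases h0 : c = 0
        · rw [h0]
          exact Or.inl h.bridge.start
        · exact Or.inr (Or.inr (Or.inr (Or.inr (last_mem_innerVerts h0))))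
    · obtain ⟨k, hk, rfl⟩ := mem_innerVerts.1 hs
      rcases h.loop_left.adj_inner hk hst.symm with he | he | ⟨j, hj, he⟩
      · exact Or.inl he
      · exact Or.inl he
      · exact Or.inr (Or.inr (Or.inl (mem_innerVerts.2 ⟨j, hj, he.symm⟩)))
    · obtain ⟨k, hk, rfl⟩ := mem_innerVerts.1 hs
      rcases h.loop_right.adj_inner hk hst.symm with he | he | ⟨j, hj, he⟩
      · exact Or.inr (Or.inl he)
      · exact Or.inr (Or.inl he)
      · exact Or.inr (Or.inr (Or.inr (Or.inl (mem_innerVerts.2 ⟨j, hj, he.symm⟩))))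
    · obtain ⟨k, hk, rfl⟩ := mem_innerVerts.1 hs
      rcases h.bridge.adj_inner hk hst.symm with he | he | ⟨j, hj, he⟩
      · exact Or.inl he
      · exact Or.inr (Or.inl he)
      · exact Or.inr (Or.inr (Or.inr (Or.inr (mem_innerVerts.2 ⟨j, hj, he.symm⟩))))
  set D := Finset.univ \ C with hD
  have hmD : ∀ t, t ∈ D ↔ t ∉ C := by simp [hD]
  obtain ⟨ks, hks, hsum, hprod⟩ := _root_.exists_cycles (G := G) D.card D rfl (by
      intro s hs
      rw [hmD, hmC, not_or, not_or] at hs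
      exact hdeg s hs.1 hs.2.1) (by
      intro s hs t hst
      rw [hmD] at hs ⊢
      exact fun ht => hs (hCcl t ht s hst.symm))
  have hDC : D.card + C.card = Fintype.card W := by
    rw [hD, Finset.card_sdiff_add_card_eq_card (Finset.subset_univ _), Finset.card_univ]
  have hdis : ∀ I : Finset W, I ⊆ C → Disjoint D I := fun I hI =>
    Finset.disjoint_of_subset_right hI Finset.sdiff_disjoint
  refine ⟨ks, hks, by omega, fun R _ y => ?_⟩
  rw [← hprod, ← h.permOn_eq y hu hv (D := D)]
  · congr 1
    ext t
    have hm := hmD t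
    rw [hC] at hm
    simp only [Finset.mem_union, Finset.mem_insert, Finset.notMem_empty, or_false,
      Finset.mem_univ, true_iff] at hm ⊢
    tauto
  · rw [hmD, hmC]
    simp
  · rw [hmD, hmC]
    simp
  · exact hdis _ fun t ht => (hmC t).2 (Or.inr (Or.inr (Or.inl ht)))
  · exact hdis _ fun t ht => (hmC t).2 (Or.inr (Or.inr (Or.inr (Or.inl ht))))
  · exact hdis _ fun t ht => (hmC t).2 (Or.inr (Or.inr (Or.inr (Or.inr ht))))

end Structure

/-! ### The theta graph -/

section Model

variable {p q r : ℕ}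

theorem thetaPath_zero (i : Fin 3) : thetaPath p q r i 0 = Sum.inl 0 := by simp [thetaPath]

theorem thetaPath_inner (i : Fin 3) {k : ℕ} (hk : k < ![p, q, r] i) :
    thetaPath p q r i (k + 1) = Sum.inr ⟨i, ⟨k, hk⟩⟩ := by
  simp [thetaPath, hk]

theorem thetaPath_last (i : Fin 3) : thetaPath p q r i (![p, q, r] i + 1) = Sum.inl 1 := by
  simp [thetaPath]

theorem thetaPath_cases (i : Fin 3) {k : ℕ} (hk : k ≤ ![p, q, r] i + 1) :
    (k = 0 ∧ thetaPath p q r i k = Sum.inl 0) ∨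
    (∃ j, ∃ hj : j < ![p, q, r] i, k = j + 1 ∧ thetaPath p q r i k = Sum.inr ⟨i, ⟨j, hj⟩⟩) ∨
    (k = ![p, q, r] i + 1 ∧ thetaPath p q r i k = Sum.inl 1) := by
  rcases k with _ | j
  · exact Or.inl ⟨rfl, thetaPath_zero i⟩
  · rcases Nat.lt_or_ge j (![p, q, r] i) with hj | hj
    · exact Or.inr (Or.inl ⟨j, hj, rfl, thetaPath_inner i hj⟩)
    · obtain rfl : j = ![p, q, r] i := by omega
      exact Or.inr (Or.inr ⟨rfl, thetaPath_last i⟩)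

theorem thetaPath_injective (i : Fin 3) {j k : ℕ} (hj : j ≤ ![p, q, r] i + 1)
    (hk : k ≤ ![p, q, r] i + 1) (he : thetaPath p q r i j = thetaPath p q r i k) : j = k := by
  rcases thetaPath_cases i hj with ⟨h1, h2⟩ | ⟨a, ha, h1, h2⟩ | ⟨h1, h2⟩ <;>
  rcases thetaPath_cases i hk with ⟨h3, h4⟩ | ⟨b, hb, h3, h4⟩ | ⟨h3, h4⟩ <;>
  rw [h2, h4] at he <;> simp at he <;> omega

theorem thetaGraph_adj {x y : ThetaVertex p q r} : (thetaGraph p q r).Adj x y ↔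
    ∃ i, ∃ k ≤ ![p, q, r] i, (x = thetaPath p q r i k ∧ y = thetaPath p q r i (k + 1)) ∨
      (y = thetaPath p q r i k ∧ x = thetaPath p q r i (k + 1)) := by
  rw [thetaGraph, SimpleGraph.fromRel_adj]
  constructor
  · rintro ⟨_, ⟨i, k, h⟩ | ⟨i, k, h⟩⟩
    · exact ⟨i, k, by omega, Or.inl h⟩
    · exact ⟨i, k, by omega, Or.inr h⟩
  · rintro ⟨i, k, hk, h⟩
    have hne : thetaPath p q r i k ≠ thetaPath p q r i (k + 1) := fun he => by
      have := thetaPath_injective i (by omega) (by omega) he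
      omega
    rcases h with ⟨rfl, rfl⟩ | ⟨rfl, rfl⟩
    · exact ⟨hne, Or.inl ⟨i, ⟨k, by omega⟩, rfl, rfl⟩⟩
    · exact ⟨hne.symm, Or.inr ⟨i, ⟨k, by omega⟩, rfl, rfl⟩⟩

theorem thetaPath_eq_inl_zero (i : Fin 3) {k : ℕ} (hk : k ≤ ![p, q, r] i + 1) :
    Sum.inl 0 = thetaPath p q r i k ↔ k = 0 := by
  rcases thetaPath_cases i hk with ⟨h1, h2⟩ | ⟨a, ha, h1, h2⟩ | ⟨h1, h2⟩ <;> rw [h2] <;> simp [h1]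

theorem thetaPath_eq_inl_one (i : Fin 3) {k : ℕ} (hk : k ≤ ![p, q, r] i + 1) :
    Sum.inl 1 = thetaPath p q r i k ↔ k = ![p, q, r] i + 1 := by
  rcases thetaPath_cases i hk with ⟨h1, h2⟩ | ⟨a, ha, h1, h2⟩ | ⟨h1, h2⟩ <;> rw [h2] <;>
    simp [h1]; omega

theorem thetaPath_eq_inr {i j : Fin 3} {l : ℕ} (hl : l < ![p, q, r] j) {k : ℕ}
    (hk : k ≤ ![p, q, r] i + 1) (he : thetaPath p q r j (l + 1) = thetaPath p q r i k) :
    i = j ∧ k = l + 1 := by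
  rw [thetaPath_inner j hl] at he
  rcases thetaPath_cases i hk with ⟨h1, h2⟩ | ⟨a, ha, h1, h2⟩ | ⟨h1, h2⟩
  · rw [h2] at he
    simp at he
  · rw [h2] at he
    simp only [Sum.inr.injEq, Sigma.mk.injEq] at he
    obtain ⟨rfl, he⟩ := he
    simp only [heq_eq_eq, Fin.mk.injEq] at he
    exact ⟨rfl, by omega⟩
  · rw [h2] at he
    simp at he

theorem isTheta_thetaGraph :
    IsTheta (thetaGraph p q r) (Sum.inl 0) (Sum.inl 1) ![p, q, r] (thetaPath p q r) where
  ne := by simp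
  thread i :=
    { start := thetaPath_zero i
      finish := thetaPath_last i
      ne_start := fun k hk => by simp [thetaPath_inner i hk]
      ne_finish := fun k hk => by simp [thetaPath_inner i hk]
      inj := fun j hj k hk he => by
        have := thetaPath_injective i (by omega) (by omega) he
        omega
      nbr := fun l hl t => by
        rw [thetaGraph_adj]
        constructor
        · rintro ⟨j, k, hk, ⟨h1, h2⟩ | ⟨h1, h2⟩⟩
          · obtain ⟨rfl, rfl⟩ := thetaPath_eq_inr hl (by omega) h1
            exact Or.inr h2
          · obtain ⟨rfl, hkl⟩ := thetaPath_eq_inr hl (by omega) h2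
            obtain rfl : k = l := by omega
            exact Or.inl h1
        · rintro (rfl | rfl)
          · exact ⟨i, l, by omega, Or.inr ⟨rfl, rfl⟩⟩
          · exact ⟨i, l + 1, by omega, Or.inl ⟨rfl, rfl⟩⟩
      adj_of_zero := fun h0 => by
        rw [thetaGraph_adj]
        refine ⟨i, 0, by omega, Or.inl ⟨(thetaPath_zero i).symm, ?_⟩⟩
        have := thetaPath_last (p := p) (q := q) (r := r) i
        rw [h0] at this
        exact this.symm
      two_le := fun h => by simp at h }
  disj i j k hk l hl he := (thetaPath_eq_inr hl (by omega) he.symm).1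
  nbr_left t := by
    rw [thetaGraph_adj]
    constructor
    · rintro ⟨i, k, hk, ⟨h1, h2⟩ | ⟨h1, h2⟩⟩
      · rw [thetaPath_eq_inl_zero i (by omega)] at h1
        subst h1
        exact ⟨i, h2⟩
      · rw [thetaPath_eq_inl_zero i (by omega)] at h2
        omega
    · rintro ⟨i, rfl⟩
      exact ⟨i, 0, by omega, Or.inl ⟨(thetaPath_zero i).symm, rfl⟩⟩
  nbr_right t := by
    rw [thetaGraph_adj]
    constructor
    · rintro ⟨i, k, hk, ⟨h1, h2⟩ | ⟨h1, h2⟩⟩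
      · rw [thetaPath_eq_inl_one i (by omega)] at h1
        omega
      · rw [thetaPath_eq_inl_one i (by omega)] at h2
        obtain rfl : k = ![p, q, r] i := by omega
        exact ⟨i, h1⟩
    · rintro ⟨i, rfl⟩
      exact ⟨i, _, le_rfl, Or.inr ⟨rfl, (thetaPath_last i).symm⟩⟩

theorem card_thetaVertex : Fintype.card (ThetaVertex p q r) = p + q + r + 2 := by
  simp [Fin.sum_univ_three]
  omega

theorem thetaGraph_degree_ends (hpq : p ≠ 0 ∨ q ≠ 0) (hpr : p ≠ 0 ∨ r ≠ 0) (hqr : q ≠ 0 ∨ r ≠ 0) :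
    (thetaGraph p q r).degree (Sum.inl 0) = 3 ∧ (thetaGraph p q r).degree (Sum.inl 1) = 3 := by
  have h := isTheta_thetaGraph (p := p) (q := q) (r := r)
  have hz : ∀ i j, ![p, q, r] i = 0 → ![p, q, r] j = 0 → i = j := by
    intro i j hi hj
    fin_cases i <;> fin_cases j <;> simp at hi hj ⊢ <;> omega
  constructor
  · have himg : (thetaGraph p q r).neighborFinset (Sum.inl 0) =
        Finset.univ.image fun i => thetaPath p q r i 1 := by
      ext t
      simp only [SimpleGraph.mem_neighborFinset, h.nbr_left, Finset.mem_image, Finset.mem_univ,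
        true_and, eq_comm]
    rw [← SimpleGraph.card_neighborFinset_eq_degree, himg, Finset.card_image_of_injective]
    · rfl
    · intro i j he
      simp only at he
      rcases Nat.eq_zero_or_pos (![p, q, r] i) with hi | hi
      · rcases Nat.eq_zero_or_pos (![p, q, r] j) with hj | hj
        · exact hz i j hi hj
        · exact (thetaPath_eq_inr hj (by omega) he.symm).1
      · exact (thetaPath_eq_inr hi (by omega) he).1.symm
  · have himg : (thetaGraph p q r).neighborFinset (Sum.inl 1) =
        Finset.univ.image fun i => thetaPath p q r i (![p, q, r] i) := by
      ext t
      simp only [SimpleGraph.mem_neighborFinset, h.nbr_right, Finset.mem_image, Finset.mem_univ,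
        true_and, eq_comm]
    rw [← SimpleGraph.card_neighborFinset_eq_degree, himg, Finset.card_image_of_injective]
    · rfl
    · intro i j he
      simp only at he
      have hlast : ∀ i, 0 < ![p, q, r] i →
          ![p, q, r] i = ![p, q, r] i - 1 + 1 := fun i hi => by omega
      rcases Nat.eq_zero_or_pos (![p, q, r] i) with hi | hi
      · rcases Nat.eq_zero_or_pos (![p, q, r] j) with hj | hj
        · exact hz i j hi hj
        · rw [hlast j hj] at he
          exact (thetaPath_eq_inr (by omega) (by omega) he.symm).1
      · rw [hlast i hi] at he
        exact (thetaPath_eq_inr (by omega) (by omega) he).1.symm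

theorem thetaGraph_degree_inner {s : ThetaVertex p q r} (h0 : s ≠ Sum.inl 0)
    (h1 : s ≠ Sum.inl 1) : (thetaGraph p q r).degree s = 2 := by
  rcases s with s | ⟨i, k⟩
  · fin_cases s
    · exact absurd rfl h0
    · exact absurd rfl h1
  · have := (isTheta_thetaGraph.thread i).degree_eq_two k.2
    rwa [thetaPath_inner i k.2] at this

/-- By the number of vertices nothing lies outside the theta graph. -/
theorem IsTheta.nonempty_iso {W : Type*} [Fintype W] [DecidableEq W] {G : SimpleGraph W} {u v : W}
    {w : Fin 3 → ℕ → W} (h : IsTheta G u v ![p, q, r] w)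
    (hcard : Fintype.card W = p + q + r + 2) : Nonempty (G ≃g thetaGraph p q r) := by
  set φ : ThetaVertex p q r → W := Sum.elim (fun i => if i = 0 then u else v)
    (fun ik => w ik.1 (ik.2 + 1)) with hφ
  have φ0 : φ (Sum.inl 0) = u := by simp [hφ]
  have φ1 : φ (Sum.inl 1) = v := by simp [hφ]
  have φr : ∀ i k, φ (Sum.inr ⟨i, k⟩) = w i (k + 1) := fun i k => rfl
  have hinj : Function.Injective φ := by
    have h01 : ∀ s : Fin 2, s = 0 ∨ s = 1 := by decide
    rintro (s | ⟨i, k⟩) (t | ⟨j, l⟩) he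
    · rcases h01 s with rfl | rfl <;> rcases h01 t with rfl | rfl
      · rfl
      · exact absurd (φ0.symm.trans (he.trans φ1)) h.ne
      · exact absurd (φ0.symm.trans (he.symm.trans φ1)) h.ne
      · rfl
    · rw [φr] at he
      rcases h01 s with rfl | rfl
      · rw [φ0] at he
        exact absurd he.symm ((h.thread j).ne_start l l.2)
      · rw [φ1] at he
        exact absurd he.symm ((h.thread j).ne_finish l l.2)
    · rw [φr] at he
      rcases h01 t with rfl | rfl
      · rw [φ0] at he
        exact absurd he ((h.thread i).ne_start k k.2)
      · rw [φ1] at he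
        exact absurd he ((h.thread i).ne_finish k k.2)
    · rw [φr, φr] at he
      obtain rfl := h.disj i j k k.2 l l.2 he
      have := (h.thread i).inj k k.2 l l.2 he
      rw [Fin.ext this]
  have hbij : Function.Bijective φ := by
    rw [Fintype.bijective_iff_injective_and_card]
    exact ⟨hinj, by rw [card_thetaVertex, hcard]⟩
  have hpath : ∀ i k, k ≤ ![p, q, r] i + 1 → φ (thetaPath p q r i k) = w i k := by
    intro i k hk
    rcases thetaPath_cases i hk with ⟨rfl, h2⟩ | ⟨a, ha, rfl, h2⟩ | ⟨rfl, h2⟩ <;> rw [h2]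
    · rw [φ0, (h.thread i).start]
    · rw [φr]
    · rw [φ1, (h.thread i).finish]
  refine ⟨(RelIso.symm ⟨Equiv.ofBijective φ hbij, ?_⟩)⟩
  intro a b
  rw [Equiv.ofBijective_apply, Equiv.ofBijective_apply, thetaGraph_adj]
  constructor
  · intro hab
    rcases a with s | ⟨i, k⟩
    · have h01 : s = 0 ∨ s = 1 := by fin_cases s <;> simp
      rcases h01 with rfl | rfl
      · rw [φ0] at hab
        obtain ⟨i, hi⟩ := (h.nbr_left _).1 hab
        exact ⟨i, 0, by omega, Or.inl ⟨(thetaPath_zero i).symm,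
          hinj (by rw [hi, hpath i _ (by omega)])⟩⟩
      · rw [φ1] at hab
        obtain ⟨i, hi⟩ := (h.nbr_right _).1 hab
        exact ⟨i, _, le_rfl, Or.inr ⟨hinj (by rw [hi, hpath i _ (by omega)]),
          (thetaPath_last i).symm⟩⟩
    · rw [φr] at hab
      have hk := k.2
      rcases ((h.thread i).nbr k hk _).1 hab with he | he
      · exact ⟨i, k, hk.le, Or.inr ⟨hinj (by rw [he, hpath i _ (by omega)]),
          (thetaPath_inner i hk).symm⟩⟩
      · exact ⟨i, k + 1, hk, Or.inl ⟨(thetaPath_inner i hk).symm,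
          hinj (by rw [he, hpath i _ (by omega)])⟩⟩
  · rintro ⟨i, k, hk, ⟨rfl, rfl⟩ | ⟨rfl, rfl⟩⟩
    · rw [hpath i k (by omega), hpath i (k + 1) (by omega)]
      exact (h.thread i).adj hk
    · rw [hpath i k (by omega), hpath i (k + 1) (by omega)]
      exact ((h.thread i).adj hk).symm

end Model

/-! ### The leading coefficients and the degrees -/

section Coefficients

theorem two_mul_sq_mul_prod_X_sub_C {ι : Type*} [DecidableEq ι] (s : Finset ι) (d : ι → ℤ) :
    ∃ f : ℤ[X], f.degree < s.card ∧ 2 * X ^ 2 * ∏ i ∈ s, (X - C (d i)) =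
      X ^ s.card * (2 * X ^ 2 - 2 * C (∑ i ∈ s, d i) * X +
        C ((∑ i ∈ s, d i) ^ 2 - ∑ i ∈ s, d i ^ 2)) + f := by
  induction s using Finset.induction_on with
  | empty => exact ⟨0, by simp, by simp⟩
  | insert a s ha ih =>
    obtain ⟨f, hf, he⟩ := ih
    rw [Finset.card_insert_of_notMem ha, Finset.prod_insert ha, Finset.sum_insert ha,
      Finset.sum_insert ha]
    set p1 := ∑ i ∈ s, d i
    set p2 := ∑ i ∈ s, d i ^ 2
    refine ⟨(X - C (d a)) * f - C (d a * (p1 ^ 2 - p2)) * X ^ s.card, ?_, ?_⟩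
    · refine lt_of_le_of_lt (degree_sub_le _ _) (max_lt ?_ ?_)
      · rw [degree_mul, degree_X_sub_C, add_comm]
        push_cast
        exact WithBot.add_lt_add_right (by decide) hf
      · refine lt_of_le_of_lt (degree_C_mul_X_pow_le _ _) ?_
        exact_mod_cast Nat.lt_succ_self _
    · have : 2 * X ^ 2 * ((X - C (d a)) * ∏ i ∈ s, (X - C (d i))) =
          (X - C (d a)) * (2 * X ^ 2 * ∏ i ∈ s, (X - C (d i))) := by ring
      rw [this, he]
      simp only [map_add, map_sub, map_mul, map_pow]
      ring

theorem coeff_prod_X_sub_C {ι : Type*} [DecidableEq ι] (s : Finset ι) (d : ι → ℤ) {m : ℕ}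
    (hm : s.card = m + 2) :
    (∏ i ∈ s, (X - C (d i))).coeff (m + 1) = -∑ i ∈ s, d i ∧
    2 * (∏ i ∈ s, (X - C (d i))).coeff m = (∑ i ∈ s, d i) ^ 2 - ∑ i ∈ s, d i ^ 2 := by
  obtain ⟨f, hf, he⟩ := two_mul_sq_mul_prod_X_sub_C s d
  have hf0 : ∀ k, m + 2 ≤ k → f.coeff k = 0 := fun k hk => by
    refine coeff_eq_zero_of_degree_lt (lt_of_lt_of_le hf ?_)
    rw [hm]
    exact_mod_cast hk
  set P := ∏ i ∈ s, (X - C (d i))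
  set p1 := ∑ i ∈ s, d i
  set e := p1 ^ 2 - ∑ i ∈ s, d i ^ 2
  have hl : (2 : ℤ[X]) * X ^ 2 * P = C 2 * (P * X ^ 2) := by
    simp only [map_ofNat]
    ring
  have hr : (X : ℤ[X]) ^ s.card * (2 * X ^ 2 - 2 * C p1 * X + C e) =
      C 2 * X ^ (m + 4) - C (2 * p1) * X ^ (m + 3) + C e * X ^ (m + 2) := by
    rw [hm]
    simp only [map_mul, map_ofNat]
    ring
  rw [hl, hr] at he
  constructor
  · have := congrArg (fun g => coeff g (m + 1 + 2)) he
    simp only [coeff_C_mul, coeff_mul_X_pow, coeff_add, coeff_sub, coeff_X_pow,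
      hf0 (m + 1 + 2) (by omega)] at this
    norm_num at this
    linarith
  · have := congrArg (fun g => coeff g (m + 2)) he
    simp only [coeff_C_mul, coeff_mul_X_pow, coeff_add, coeff_sub, coeff_X_pow,
      hf0 (m + 2) le_rfl] at this
    norm_num at this
    linarith

variable {W : Type*} [Fintype W] [DecidableEq W] (G : SimpleGraph W) [DecidableRel G.Adj]

/-- The summand of a permutation in the Laplacian permanental polynomial. -/
noncomputable def lapTerm (σ : Equiv.Perm W) : ℤ[X] :=
  ∏ i, (G.lapMatrix ℤ).charmatrix (σ i) i

theorem natDegree_lapTerm_le (σ : Equiv.Perm W) :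
    (lapTerm G σ).natDegree ≤ Fintype.card W - σ.support.card := by
  refine (natDegree_prod_le _ _).trans ((Finset.sum_le_sum fun i _ =>
    Matrix.charmatrix_apply_natDegree_le (σ i) i).trans ?_)
  rw [Finset.sum_ite, Finset.sum_const_zero, add_zero, Finset.sum_const, smul_eq_mul, mul_one]
  have : σ.support = Finset.univ \ (Finset.univ.filter fun i => σ i = i) := by
    ext i
    simp
  rw [this, Finset.card_sdiff_of_subset (Finset.filter_subset _ _), Finset.card_univ]
  have := Finset.card_le_univ (Finset.univ.filter fun i => σ i = i)
  omega

theorem lapTerm_one : lapTerm G 1 = ∏ i, (X - C (G.degree i : ℤ)) := by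
  refine Finset.prod_congr rfl fun i _ => ?_
  simp [SimpleGraph.lapMatrix, SimpleGraph.degMatrix]

theorem coeff_lapTerm_swap {m : ℕ} (hm : Fintype.card W = m + 2) {i j : W} (hij : i ≠ j) :
    (lapTerm G (Equiv.swap i j)).coeff m = if G.Adj i j then 1 else 0 := by
  have hoff : ∀ a b, a ≠ b → (G.lapMatrix ℤ).charmatrix a b = if G.Adj a b then 1 else 0 := by
    intro a b hab
    rw [Matrix.charmatrix_apply, SimpleGraph.lapMatrix, Matrix.sub_apply, SimpleGraph.degMatrix,
      SimpleGraph.adjMatrix_apply, Matrix.diagonal_apply_ne _ hab, Matrix.diagonal_apply_ne _ hab]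
    split_ifs <;> simp
  have hj : j ∈ (Finset.univ : Finset W).erase i := by simp [hij.symm]
  have hrest : ∏ k ∈ (Finset.univ.erase i).erase j,
      (G.lapMatrix ℤ).charmatrix (Equiv.swap i j k) k =
      ∏ k ∈ (Finset.univ.erase i).erase j, (X - C (G.degree k : ℤ)) := by
    refine Finset.prod_congr rfl fun k hk => ?_
    simp only [Finset.mem_erase, Finset.mem_univ, and_true] at hk
    rw [Equiv.swap_apply_of_ne_of_ne hk.2 hk.1]
    simp [SimpleGraph.lapMatrix, SimpleGraph.degMatrix]
  have hcard : ((Finset.univ.erase i).erase j).card = m := by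
    rw [Finset.card_erase_of_mem hj, Finset.card_erase_of_mem (Finset.mem_univ i),
      Finset.card_univ, hm]
    rfl
  have hmonic : (∏ k ∈ (Finset.univ.erase i).erase j, (X - C (G.degree k : ℤ))).coeff m = 1 := by
    have h1 := monic_prod_of_monic ((Finset.univ.erase i).erase j)
      (fun k => X - C (G.degree k : ℤ)) fun k _ => monic_X_sub_C _
    have h2 := natDegree_prod_of_monic ((Finset.univ.erase i).erase j)
      (fun k => X - C (G.degree k : ℤ)) fun k _ => monic_X_sub_C _
    simp only [natDegree_X_sub_C, Finset.sum_const, hcard, smul_eq_mul, mul_one] at h2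
    rw [Monic, leadingCoeff, h2] at h1
    exact h1
  rw [lapTerm, ← Finset.mul_prod_erase _ _ (Finset.mem_univ i), ← Finset.mul_prod_erase _ _ hj,
    hrest, Equiv.swap_apply_left, Equiv.swap_apply_right, hoff _ _ hij.symm, hoff _ _ hij]
  by_cases h : G.Adj i j
  · rw [if_pos h, if_pos h, if_pos h.symm, one_mul, one_mul, hmonic]
  · simp [h]

/-- Every edge gives one transposition. -/
theorem two_mul_sum_coeff_lapTerm {m : ℕ} (hm : Fintype.card W = m + 2) :
    2 * ∑ σ ∈ Finset.univ.erase (1 : Equiv.Perm W), (lapTerm G σ).coeff m =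
      ∑ i, (G.degree i : ℤ) := by
  have hterm : ∀ σ ∈ Finset.univ.erase (1 : Equiv.Perm W), 2 * (lapTerm G σ).coeff m =
      ∑ i, if σ = Equiv.swap i (σ i) ∧ G.Adj i (σ i) then (1 : ℤ) else 0 := by
    intro σ hσ
    have hσ1 : σ ≠ 1 := (Finset.mem_erase.1 hσ).1
    by_cases hs : σ.IsSwap
    · obtain ⟨a, b, hab, rfl⟩ := hs
      rw [coeff_lapTerm_swap G hm hab, ← Finset.sum_subset (Finset.subset_univ {a, b}),
        Finset.sum_pair hab]
      · simp [Equiv.swap_comm b a, G.adj_comm b a]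
        split_ifs <;> norm_num
      · intro k _ hk
        simp only [Finset.mem_insert, Finset.mem_singleton, not_or] at hk
        simp [Equiv.swap_apply_of_ne_of_ne hk.1 hk.2]
    · have h3 : 3 ≤ σ.support.card := by
        have h0 : σ.support.card ≠ 0 := by simpa using hσ1
        have h1 := Equiv.Perm.card_support_ne_one σ
        have h2 : σ.support.card ≠ 2 := fun h => hs (Equiv.Perm.card_support_eq_two.1 h)
        omega
      have hle : σ.support.card ≤ Fintype.card W := Finset.card_le_univ _
      rw [coeff_eq_zero_of_natDegree_lt, Finset.sum_eq_zero, mul_zero]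
      · intro i _
        rw [if_neg]
        rintro ⟨h, ha⟩
        exact hs ⟨i, σ i, ha.ne, h⟩
      · have := natDegree_lapTerm_le G σ
        omega
  rw [Finset.mul_sum, Finset.sum_congr rfl hterm, Finset.sum_comm]
  refine Finset.sum_congr rfl fun i _ => ?_
  rw [Finset.sum_boole, ← G.card_neighborFinset_eq_degree]
  congr 1
  refine Finset.card_bij' (fun σ _ => σ i) (fun j _ => Equiv.swap i j) ?_ ?_ ?_ ?_
  · intro σ hσ
    simp only [Finset.mem_filter] at hσ
    simpa using hσ.2.2
  · intro j hj
    rw [SimpleGraph.mem_neighborFinset] at hj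
    simp only [Finset.mem_filter, Finset.mem_erase, Finset.mem_univ, and_true,
      Equiv.swap_apply_left, hj]
    intro h
    have := Equiv.swap_apply_left i j
    rw [h] at this
    exact hj.ne this
  · intro σ hσ
    simp only [Finset.mem_filter] at hσ
    exact hσ.2.1.symm
  · intro j _
    simp

theorem lapPermPoly_eq_sum : lapPermPoly G = ∑ σ : Equiv.Perm W, lapTerm G σ := rfl

theorem natDegree_lapPermPoly : (lapPermPoly G).natDegree = Fintype.card W := by
  have hle : (lapPermPoly G).natDegree ≤ Fintype.card W := by
    rw [lapPermPoly_eq_sum]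
    refine natDegree_sum_le_of_forall_le _ _ fun σ _ => ?_
    have := natDegree_lapTerm_le G σ
    omega
  refine le_antisymm hle (le_natDegree_of_ne_zero ?_)
  rw [lapPermPoly_eq_sum, finsetSum_coeff, ← Finset.add_sum_erase _ _ (Finset.mem_univ 1),
    Finset.sum_eq_zero, add_zero, lapTerm_one]
  · have h1 := monic_prod_of_monic Finset.univ
      (fun k => X - C (G.degree k : ℤ)) fun k _ => monic_X_sub_C _
    have h2 := natDegree_prod_of_monic Finset.univ
      (fun k => X - C (G.degree k : ℤ)) fun k _ => monic_X_sub_C _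
    simp only [natDegree_X_sub_C, Finset.sum_const, Finset.card_univ, smul_eq_mul, mul_one] at h2
    rw [Monic, leadingCoeff, h2] at h1
    rw [h1]
    exact one_ne_zero
  · intro σ hσ
    have hσ1 : σ ≠ 1 := (Finset.mem_erase.1 hσ).1
    have h0 : σ.support.card ≠ 0 := by simpa using hσ1
    have hle : σ.support.card ≤ Fintype.card W := Finset.card_le_univ _
    have := natDegree_lapTerm_le G σ
    exact coeff_eq_zero_of_natDegree_lt (by omega)

/-- Only the identity contributes to the coefficient below the leading one, and only the identity
and transpositions to the next one. -/
theorem coeff_lapPermPoly {m : ℕ} (hm : Fintype.card W = m + 2) :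
    (lapPermPoly G).coeff (m + 1) = -∑ i, (G.degree i : ℤ) ∧
    2 * (lapPermPoly G).coeff m =
      (∑ i, (G.degree i : ℤ)) ^ 2 - ∑ i, (G.degree i : ℤ) ^ 2 + ∑ i, (G.degree i : ℤ) := by
  obtain ⟨h1, h2⟩ := coeff_prod_X_sub_C (Finset.univ : Finset W) (fun i => (G.degree i : ℤ))
    (m := m) (by rw [Finset.card_univ, hm])
  rw [← lapTerm_one] at h1 h2
  constructor
  · rw [lapPermPoly_eq_sum, finsetSum_coeff, ← Finset.add_sum_erase _ _ (Finset.mem_univ 1),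
      Finset.sum_eq_zero, add_zero, h1]
    intro σ hσ
    have hσ1 : σ ≠ 1 := (Finset.mem_erase.1 hσ).1
    have h0 : σ.support.card ≠ 0 := by simpa using hσ1
    have h1 := Equiv.Perm.card_support_ne_one σ
    have hle : σ.support.card ≤ Fintype.card W := Finset.card_le_univ _
    have := natDegree_lapTerm_le G σ
    exact coeff_eq_zero_of_natDegree_lt (by omega)
  · rw [lapPermPoly_eq_sum, finsetSum_coeff, ← Finset.add_sum_erase _ _ (Finset.mem_univ 1),
      mul_add, h2, two_mul_sum_coeff_lapTerm G hm]

end Coefficients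

/-- A graph with the Laplacian permanental polynomial of a theta graph has the same degrees: two
vertices of degree three, and all others of degree two. For the excess `d - 2` of the degrees the
sum and the sum of the squares are both `2`. -/
theorem exists_degrees_of_copermanental {p q r : ℕ}
    (hpq : p ≠ 0 ∨ q ≠ 0) (hpr : p ≠ 0 ∨ r ≠ 0) (hqr : q ≠ 0 ∨ r ≠ 0)
    {W : Type*} [Fintype W] [DecidableEq W] (H : SimpleGraph W) [DecidableRel H.Adj]
    (h : lapPermPoly H = lapPermPoly (thetaGraph p q r)) :
    Fintype.card W = p + q + r + 2 ∧ ∃ u v, u ≠ v ∧ H.degree u = 3 ∧ H.degree v = 3 ∧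
      ∀ s, s ≠ u → s ≠ v → H.degree s = 2 := by
  have hcard : Fintype.card W = p + q + r + 2 := by
    rw [← natDegree_lapPermPoly H, h, natDegree_lapPermPoly, card_thetaVertex]
  refine ⟨hcard, ?_⟩
  obtain ⟨a1, a2⟩ := coeff_lapPermPoly H hcard
  obtain ⟨b1, b2⟩ := coeff_lapPermPoly (thetaGraph p q r) (card_thetaVertex (p := p))
  obtain ⟨d0, d1⟩ := thetaGraph_degree_ends hpq hpr hqr
  have hsum : ∀ f : ℕ → ℤ, ∑ i, f ((thetaGraph p q r).degree i) =
      2 * f 3 + (p + q + r) * f 2 := by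
    intro f
    have hin : ∀ x, (thetaGraph p q r).degree (Sum.inr x) = 2 := fun x =>
      thetaGraph_degree_inner (by simp) (by simp)
    rw [Fintype.sum_sum_type, Fin.sum_univ_two, d0, d1]
    simp only [hin, Finset.sum_const, Finset.card_univ, Fintype.card_sigma, Fintype.card_fin,
      Fin.sum_univ_three, nsmul_eq_mul]
    simp
    ring
  have s1 := hsum fun n => (n : ℤ)
  have s2 := hsum fun n => (n : ℤ) ^ 2
  rw [h, b1] at a1
  rw [h, b2] at a2
  have e1 : ∑ i, (H.degree i : ℤ) = 6 + (p + q + r) * 2 := by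
    rw [s1] at a1
    push_cast at a1
    linarith
  have e2 : ∑ i, (H.degree i : ℤ) ^ 2 = 18 + (p + q + r) * 4 := by
    rw [s1, s2, e1] at a2
    push_cast at a2
    linarith
  have ecard : ∑ _i : W, (1 : ℤ) = p + q + r + 2 := by
    rw [Finset.sum_const, Finset.card_univ, hcard]
    simp
  have hx1 : ∑ i, ((H.degree i : ℤ) - 2) = 2 := by
    have : ∑ i, ((H.degree i : ℤ) - 2) = ∑ i, (H.degree i : ℤ) - 2 * ∑ _i : W, (1 : ℤ) := by
      rw [Finset.sum_sub_distrib, Finset.mul_sum]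
      simp
    rw [this, e1, ecard]
    ring
  have hx2 : ∑ i, ((H.degree i : ℤ) - 2) * ((H.degree i : ℤ) - 3) = 0 := by
    have : ∑ i, ((H.degree i : ℤ) - 2) * ((H.degree i : ℤ) - 3) =
        ∑ i, (H.degree i : ℤ) ^ 2 - 5 * ∑ i, (H.degree i : ℤ) + 6 * ∑ _i : W, (1 : ℤ) := by
      rw [Finset.mul_sum, Finset.mul_sum, ← Finset.sum_sub_distrib, ← Finset.sum_add_distrib]
      exact Finset.sum_congr rfl fun i _ => by ring
    rw [this, e1, e2, ecard]
    ring
  -- consecutive integers have a nonnegative product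
  have hd : ∀ i, H.degree i = 2 ∨ H.degree i = 3 := by
    intro i
    have hnn : ∀ i ∈ Finset.univ, 0 ≤ ((H.degree i : ℤ) - 2) * ((H.degree i : ℤ) - 3) := by
      intro i _
      rcases le_or_gt (H.degree i) 2 with hle | hlt
      · have : (H.degree i : ℤ) ≤ 2 := by exact_mod_cast hle
        exact mul_nonneg_of_nonpos_of_nonpos (by linarith) (by linarith)
      · have : (3 : ℤ) ≤ H.degree i := by exact_mod_cast hlt
        exact mul_nonneg (by linarith) (by linarith)
    have := (Finset.sum_eq_zero_iff_of_nonneg hnn).1 hx2 i (Finset.mem_univ i)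
    rcases mul_eq_zero.1 this with h0 | h0
    · left
      omega
    · right
      omega
  have hc2 : (Finset.univ.filter fun i => H.degree i = 3).card = 2 := by
    have : ∑ i, ((H.degree i : ℤ) - 2) = ∑ i, if H.degree i = 3 then (1 : ℤ) else 0 := by
      refine Finset.sum_congr rfl fun i _ => ?_
      rcases hd i with h0 | h0 <;> simp [h0]
    rw [this, Finset.sum_boole] at hx1
    exact_mod_cast hx1
  obtain ⟨u, v, huv, hset⟩ := Finset.card_eq_two.1 hc2
  have hm : ∀ s, H.degree s = 3 ↔ s = u ∨ s = v := by
    intro s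
    have : s ∈ Finset.univ.filter (fun i => H.degree i = 3) ↔ s ∈ ({u, v} : Finset W) := by
      rw [hset]
    simpa using this
  refine ⟨u, v, huv, (hm u).2 (Or.inl rfl), (hm v).2 (Or.inr rfl), fun s h1 h2 => ?_⟩
  rcases hd s with h0 | h0
  · exact h0
  · rcases (hm s).1 h0 with h3 | h3
    · exact absurd h3 h1
    · exact absurd h3 h2

/-! ### Values to first order at `y = 0` -/

section FirstOrder

open DualNumber

/-- Modulo `y ^ 2` the Fibonacci polynomials are `m y` and `1`. -/
theorem fibPoly_eps (m : ℕ) : fibPoly (ε : ℤ[ε]) (2 * m) = (m : ℤ[ε]) * ε ∧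
    fibPoly (ε : ℤ[ε]) (2 * m + 1) = 1 := by
  induction m with
  | zero => simp [fibPoly]
  | succ m ih =>
    obtain ⟨h1, h2⟩ := ih
    have h3 : fibPoly (ε : ℤ[ε]) (2 * (m + 1)) = ((m + 1 : ℕ) : ℤ[ε]) * ε := by
      rw [show 2 * (m + 1) = 2 * m + 2 by ring, fibPoly, h1, h2]
      push_cast
      ring
    refine ⟨h3, ?_⟩
    rw [show 2 * (m + 1) + 1 = 2 * m + 1 + 2 by ring, fibPoly, h2,
      show 2 * m + 1 + 1 = 2 * (m + 1) by ring, h3]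
    linear_combination ((m + 1 : ℕ) : ℤ[ε]) * DualNumber.eps_mul_eps (R := ℤ)

theorem fibPoly_eps_even (m : ℕ) : fibPoly (ε : ℤ[ε]) (2 * m) = (m : ℤ[ε]) * ε :=
  (fibPoly_eps m).1

theorem fibPoly_eps_odd (m : ℕ) : fibPoly (ε : ℤ[ε]) (2 * m + 1) = 1 := (fibPoly_eps m).2

theorem fibPoly_eps_odd_succ (m : ℕ) :
    fibPoly (ε : ℤ[ε]) (2 * m + 1 + 1) = ((m + 1 : ℕ) : ℤ[ε]) * ε :=
  (fibPoly_eps (m + 1)).1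

theorem fst_two_eps : TrivSqZeroExt.fst (2 : ℤ[ε]) = 2 := rfl

theorem snd_two_eps : TrivSqZeroExt.snd (2 : ℤ[ε]) = 0 := rfl

/-- The constant coefficient `f` and the linear coefficient `l` of `thetaVal`, according to the
parities of the three parameters. Where single parities do not matter, only that of the sum is
recorded. -/
theorem thetaVal_eps_cases (a b c : ℕ) :
    ∃ f l : ℤ, (thetaVal (ε : ℤ[ε]) a b c).fst = f ∧ (thetaVal (ε : ℤ[ε]) a b c).snd = l ∧
      ((f = 0 ∧ l = 2 * (a + b + c + 3) ∧ a % 2 = 1 ∧ b % 2 = 1 ∧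
          c % 2 = 1) ∨
        (f = 4 ∧ l = 0 ∧ (a + b + c) % 2 = 0) ∨
        (f = 2 ∧ (a + b + c : ℤ) + 6 ≤ l ∧ (a + b + c) % 2 = 1) ∨
        (f = 10 ∧ (a + b + c) % 2 = 0)) := by
  refine ⟨_, _, rfl, rfl, ?_⟩
  obtain ⟨m, rfl | rfl⟩ := a.even_or_odd' <;> obtain ⟨n, rfl | rfl⟩ := b.even_or_odd' <;>
    obtain ⟨k, rfl | rfl⟩ := c.even_or_odd' <;>
    simp only [thetaVal, fibPoly_eps_even, fibPoly_eps_odd, fibPoly_eps_odd_succ, pow_two,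
      TrivSqZeroExt.fst_add, TrivSqZeroExt.snd_add, TrivSqZeroExt.fst_mul, TrivSqZeroExt.snd_mul,
      TrivSqZeroExt.fst_sub, TrivSqZeroExt.snd_sub, TrivSqZeroExt.fst_natCast,
      TrivSqZeroExt.snd_natCast, TrivSqZeroExt.fst_one, TrivSqZeroExt.snd_one, fst_two_eps,
      snd_two_eps, DualNumber.fst_eps, DualNumber.snd_eps, smul_eq_mul,
      MulOpposite.smul_eq_mul_unop, MulOpposite.unop_op, mul_zero, zero_mul, mul_one, one_mul,
      add_zero, zero_add] <;>
    push_cast <;> ring_nf <;>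
    simp only [true_and, false_and, false_or, or_false] <;>
    omega

/-- The constant coefficient `f` and the linear coefficient `l` of `dumbbellVal`, according to the
parities of its parameters. -/
theorem dumbbellVal_eps_cases {a b c : ℕ} (ha : 2 ≤ a) (hb : 2 ≤ b) :
    ∃ f l : ℤ, (dumbbellVal (ε : ℤ[ε]) a b c).fst = f ∧ (dumbbellVal (ε : ℤ[ε]) a b c).snd = l ∧
      ((f = 2 ∧ l = a + b + c + 2 ∧ (a + b + c) % 2 = 1) ∨
        (f = 2 ∧ (a + b + c) % 2 = 0) ∨
        (f = 4 ∧ 0 < l ∧ (a + b + c) % 2 = 0) ∨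
        (f = 4 ∧ (a + b + c) % 2 = 1) ∨
        (f = 0 ∧ 2 * (a + b + c + 3 : ℤ) < l) ∨ f = 16) := by
  refine ⟨_, _, rfl, rfl, ?_⟩
  obtain ⟨m, rfl | rfl⟩ := a.even_or_odd' <;> obtain ⟨n, rfl | rfl⟩ := b.even_or_odd' <;>
    obtain ⟨k, rfl | rfl⟩ := c.even_or_odd' <;>
    simp only [dumbbellVal, pathVal, fibPoly_eps_even, fibPoly_eps_odd, fibPoly_eps_odd_succ,
      pow_two,
      TrivSqZeroExt.fst_add, TrivSqZeroExt.snd_add, TrivSqZeroExt.fst_mul, TrivSqZeroExt.snd_mul,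
      TrivSqZeroExt.fst_sub, TrivSqZeroExt.snd_sub, TrivSqZeroExt.fst_natCast,
      TrivSqZeroExt.snd_natCast, TrivSqZeroExt.fst_one, TrivSqZeroExt.snd_one, fst_two_eps,
      snd_two_eps, DualNumber.fst_eps, DualNumber.snd_eps, smul_eq_mul,
      MulOpposite.smul_eq_mul_unop, MulOpposite.unop_op, mul_zero, zero_mul, mul_one, one_mul,
      add_zero, zero_add] <;>
    push_cast <;> ring_nf <;>
    simp only [true_and, false_and, or_true, false_or, or_false] <;>
    omega

theorem cycleVal_eps_cases {k : ℕ} (hk : 3 ≤ k) :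
    ((cycleVal (ε : ℤ[ε]) k).fst = 4 ∧ k % 2 = 0) ∨
      ((cycleVal (ε : ℤ[ε]) k).fst = 2 ∧ (cycleVal (ε : ℤ[ε]) k).snd = k ∧ k % 2 = 1) := by
  obtain ⟨m, rfl | rfl⟩ := k.even_or_odd'
  · left
    obtain ⟨j, rfl⟩ : ∃ j, m = j + 1 := ⟨m - 1, by omega⟩
    refine ⟨?_, by omega⟩
    rw [cycleVal, fibPoly_eps_odd, show 2 * (j + 1) - 1 = 2 * j + 1 by omega, fibPoly_eps_odd]
    simp only [TrivSqZeroExt.fst_add, TrivSqZeroExt.fst_one, fst_two_eps]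
    norm_num
  · right
    refine ⟨?_, ?_, by omega⟩ <;>
    rw [cycleVal, fibPoly_eps_odd_succ, show 2 * m + 1 - 1 = 2 * m by omega, fibPoly_eps_even] <;>
    simp [fst_two_eps, snd_two_eps]
    ring

/-- Two cycles, or an even one, contribute a factor divisible by four at `y = 0`. -/
theorem cycles_eps_cases (ks : Multiset ℕ) (hks : ∀ k ∈ ks, 3 ≤ k) :
    ∃ f l : ℤ, (ks.map fun k => cycleVal (ε : ℤ[ε]) k).prod.fst = f ∧
      (ks.map fun k => cycleVal (ε : ℤ[ε]) k).prod.snd = l ∧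
      ((ks = 0 ∧ f = 1 ∧ l = 0) ∨ (f = 2 ∧ 0 < l ∧ ks.sum % 2 = 1) ∨
        ∃ M : ℤ, 0 < M ∧ f = 4 * M) := by
  refine ⟨_, _, rfl, rfl, ?_⟩
  induction ks using Multiset.induction_on with
  | empty => simp
  | cons k ks ih =>
    specialize ih fun j hj => hks j (Multiset.mem_cons_of_mem hj)
    have hk := hks k (Multiset.mem_cons_self k ks)
    right
    rw [Multiset.map_cons, Multiset.prod_cons, Multiset.sum_cons]
    set P := (ks.map fun k => cycleVal (ε : ℤ[ε]) k).prod
    simp only [TrivSqZeroExt.fst_mul, TrivSqZeroExt.snd_mul, smul_eq_mul,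
      MulOpposite.smul_eq_mul_unop, MulOpposite.unop_op]
    rcases cycleVal_eps_cases hk with ⟨h1, h2⟩ | ⟨h1, h2, h3⟩ <;> rw [h1]
    · right
      refine ⟨P.fst, ?_, rfl⟩
      rcases ih with ⟨_, h, _⟩ | ⟨h, _⟩ | ⟨M, hM, h⟩ <;> omega
    · rcases ih with ⟨rfl, h, h'⟩ | ⟨h, _⟩ | ⟨M, hM, h⟩
      · left
        rw [h, h', h2]
        refine ⟨by ring, by omega, ?_⟩
        simpa using h3
      · right
        exact ⟨1, by omega, by omega⟩
      · right
        exact ⟨2 * M, by omega, by omega⟩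

/-- A theta value is not a theta value times cycle values. The case of three odd parameters, where
the constant coefficient is zero, is left to the hypothesis `hodd`. -/
theorem cycles_eq_zero_of_thetaVal_eq {a b c a' b' c' : ℕ} {ks : Multiset ℕ}
    (hks : ∀ k ∈ ks, 3 ≤ k) (hs : a' + b' + c' + ks.sum = a + b + c)
    (h : thetaVal (ε : ℤ[ε]) a b c =
      thetaVal ε a' b' c' * (ks.map fun k => cycleVal (ε : ℤ[ε]) k).prod)
    (hodd : a % 2 = 1 → b % 2 = 1 → c % 2 = 1 → ks = 0) : ks = 0 := by
  obtain ⟨f, l, hf, hl, hT⟩ := thetaVal_eps_cases a b c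
  obtain ⟨f', l', hf', hl', hC⟩ := thetaVal_eps_cases a' b' c'
  obtain ⟨f₁, l₁, hf₁, hl₁, hK⟩ := cycles_eps_cases ks hks
  rw [h, TrivSqZeroExt.fst_mul, hf', hf₁] at hf
  rw [h, TrivSqZeroExt.snd_mul, hf', hf₁, hl', hl₁, smul_eq_mul, MulOpposite.smul_eq_mul_unop,
    MulOpposite.unop_op] at hl
  -- one odd cycle doubles the constant coefficient and adds a positive linear one, further cycles
  -- make it divisible by four; neither fits the values of theta graphs
  rcases hK with ⟨h0, -⟩ | ⟨rfl, h1, h2⟩ | ⟨M, hM, rfl⟩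
  · exact h0
  · rcases hT with ⟨-, -, ha, hb, hc⟩ | hT
    · exact hodd ha hb hc
    · exfalso
      rcases hC with hC | hC | hC | hC <;> obtain ⟨rfl, hC⟩ := hC <;> omega
  · rcases hT with ⟨-, -, ha, hb, hc⟩ | hT
    · exact hodd ha hb hc
    · exfalso
      rcases hC with hC | hC | hC | hC <;> obtain ⟨rfl, hC⟩ := hC <;> omega

/-- A theta value is not a dumbbell value times cycle values. For three odd parameters this is shown
only without cycles, by comparing the linear coefficients. -/
theorem thetaVal_ne_dumbbellVal {a b c a' b' c' : ℕ} {ks : Multiset ℕ}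
    (hks : ∀ k ∈ ks, 3 ≤ k) (ha' : 2 ≤ a') (hb' : 2 ≤ b')
    (hs : a' + b' + c' + ks.sum = a + b + c)
    (hodd : a % 2 = 1 → b % 2 = 1 → c % 2 = 1 → ks = 0) :
    thetaVal (ε : ℤ[ε]) a b c ≠
      dumbbellVal ε a' b' c' * (ks.map fun k => cycleVal (ε : ℤ[ε]) k).prod := by
  intro h
  obtain ⟨f, l, hf, hl, hT⟩ := thetaVal_eps_cases a b c
  obtain ⟨f', l', hf', hl', hC⟩ := dumbbellVal_eps_cases (c := c') ha' hb'
  obtain ⟨f₁, l₁, hf₁, hl₁, hK⟩ := cycles_eps_cases ks hks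
  rw [h, TrivSqZeroExt.fst_mul, hf', hf₁] at hf
  rw [h, TrivSqZeroExt.snd_mul, hf', hf₁, hl', hl₁, smul_eq_mul, MulOpposite.smul_eq_mul_unop,
    MulOpposite.unop_op] at hl
  have hz : ks = 0 → ks.sum = 0 := by rintro rfl; rfl
  rcases hT with ⟨hfz, hlz, ha, hb, hc⟩ | hT
  · obtain rfl := hodd ha hb hc
    simp only [Multiset.map_zero, Multiset.prod_zero, TrivSqZeroExt.fst_one,
      TrivSqZeroExt.snd_one] at hf₁ hl₁
    subst hf₁ hl₁
    simp only [Multiset.sum_zero] at hs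
    omega
  rcases hK with ⟨h0, rfl, rfl⟩ | ⟨rfl, h1, h2⟩ | ⟨M, hM, rfl⟩
  · have := hz h0
    omega
  · rcases hC with hC | hC | hC | hC | hC | hC <;> obtain ⟨rfl, hC⟩ := hC <;> omega
  · rcases hC with hC | hC | hC | hC | hC | hC <;> obtain ⟨rfl, hC⟩ := hC <;> omega

end FirstOrder

/-! ### Odd cycles are not factors -/

section OddCycle

theorem fibPoly_neg {R : Type*} [CommRing R] (y : R) (m : ℕ) :
    fibPoly (-y) (2 * m) = -fibPoly y (2 * m) ∧
      fibPoly (-y) (2 * m + 1) = fibPoly y (2 * m + 1) := by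
  induction m with
  | zero => simp [fibPoly]
  | succ m ih =>
    obtain ⟨h1, h2⟩ := ih
    have h3 : fibPoly (-y) (2 * (m + 1)) = -fibPoly y (2 * (m + 1)) := by
      rw [show 2 * (m + 1) = 2 * m + 2 by ring, fibPoly, fibPoly, h1, h2]
      ring
    refine ⟨h3, ?_⟩
    rw [show 2 * (m + 1) + 1 = 2 * m + 1 + 2 by ring, fibPoly.eq_3 (-y), fibPoly.eq_3 y, h2,
      show 2 * m + 1 + 1 = 2 * (m + 1) by ring, h3]
    ring

theorem continuous_fibPoly (n : ℕ) : Continuous fun y : ℝ => fibPoly y n := by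
  suffices h : (Continuous fun y : ℝ => fibPoly y n) ∧
      Continuous fun y : ℝ => fibPoly y (n + 1) from h.1
  induction n with
  | zero => exact ⟨continuous_const, continuous_const⟩
  | succ n ih =>
    refine ⟨ih.2, ?_⟩
    simp only [fibPoly]
    exact (continuous_id.mul ih.2).add ih.1

theorem fibPoly_pos {y : ℝ} (hy : 0 < y) (n : ℕ) : 0 ≤ fibPoly y n ∧ 0 < fibPoly y (n + 1) := by
  induction n with
  | zero => simp [fibPoly]
  | succ n ih =>
    refine ⟨ih.2.le, ?_⟩
    rw [fibPoly]
    have := mul_pos hy ih.2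
    linarith [ih.1]

theorem one_le_fibPoly {y : ℝ} (hy : 1 ≤ y) (n : ℕ) : 1 ≤ fibPoly y (n + 1) := by
  induction n with
  | zero => simp [fibPoly]
  | succ n ih =>
    rw [fibPoly]
    nlinarith [(fibPoly_pos (by linarith : 0 < y) n).1]

/-- The value of an odd cycle has a negative root, by the intermediate value theorem. -/
theorem exists_cycleVal_neg_eq_zero {k : ℕ} (hk : k % 2 = 1) :
    ∃ η : ℝ, 0 < η ∧ cycleVal (-η) k = 0 := by
  obtain ⟨m, rfl⟩ : ∃ m, k = 2 * m + 1 := ⟨k / 2, by omega⟩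
  have hval : ∀ y : ℝ, cycleVal (-y) (2 * m + 1) =
      2 - fibPoly y (2 * (m + 1)) - fibPoly y (2 * m) := by
    intro y
    rw [cycleVal, show 2 * m + 1 + 1 = 2 * (m + 1) by ring, (fibPoly_neg y (m + 1)).1,
      Nat.add_sub_cancel, (fibPoly_neg y m).1]
    ring
  have hc : ContinuousOn (fun y : ℝ => 2 - fibPoly y (2 * (m + 1)) - fibPoly y (2 * m))
      (Set.Icc 0 3) :=
    ((continuous_const.sub (continuous_fibPoly _)).sub (continuous_fibPoly _)).continuousOn
  have h0 : ∀ j, fibPoly (0 : ℝ) (2 * j) = 0 := by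
    intro j
    have := (fibPoly_neg (0 : ℝ) j).1
    rw [neg_zero] at this
    linarith
  have h3 : 3 ≤ fibPoly (3 : ℝ) (2 * (m + 1)) := by
    rw [show 2 * (m + 1) = 2 * m + 2 by ring, fibPoly]
    linarith [one_le_fibPoly (by norm_num : (1 : ℝ) ≤ 3) (2 * m),
      (fibPoly_pos (by norm_num : (0 : ℝ) < 3) (2 * m)).1]
  have h3' := (fibPoly_pos (by norm_num : (0 : ℝ) < 3) (2 * m)).1
  obtain ⟨η, hη, hη0⟩ := intermediate_value_Icc' (by norm_num : (0 : ℝ) ≤ 3) hc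
    (show (0 : ℝ) ∈ Set.Icc _ _ by
      refine ⟨?_, ?_⟩
      · linarith
      · simp only [h0]
        norm_num)
  refine ⟨η, lt_of_le_of_ne hη.1 ?_, (hval η).trans hη0⟩
  rintro rfl
  simp only [h0] at hη0
  norm_num at hη0

/-- By the parities of the Fibonacci polynomials all terms of a theta value with three odd
parameters are nonpositive to the left of zero. -/
theorem thetaVal_neg_ne_zero {η : ℝ} (hη : 0 < η) {a b c : ℕ} (ha : a % 2 = 1) (hb : b % 2 = 1)
    (hc : c % 2 = 1) : thetaVal (-η) a b c ≠ 0 := by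
  have key : ∀ {a : ℕ}, a % 2 = 1 → fibPoly (-η) (a + 1) = -fibPoly η (a + 1) ∧
      fibPoly (-η) a = fibPoly η a ∧ 0 < fibPoly η (a + 1) ∧ 0 ≤ fibPoly η a ∧
      0 ≤ fibPoly η (a + 1) - η * fibPoly η a := by
    intro a ha
    obtain ⟨m, rfl⟩ : ∃ m, a = 2 * m + 1 := ⟨a / 2, by omega⟩
    refine ⟨(fibPoly_neg η (m + 1)).1, (fibPoly_neg η m).2, (fibPoly_pos hη _).2,
      (fibPoly_pos hη _).1, ?_⟩
    rw [fibPoly]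
    linarith [(fibPoly_pos hη (2 * m)).1]
  obtain ⟨a1, a2, a3, a4, a5⟩ := key ha
  obtain ⟨b1, b2, b3, b4, b5⟩ := key hb
  obtain ⟨c1, c2, c3, c4, c5⟩ := key hc
  rw [thetaVal, a1, a2, b1, b2, c1, c2]
  generalize fibPoly η (a + 1) = A at *
  generalize fibPoly η (b + 1) = B at *
  generalize fibPoly η (c + 1) = C at *
  generalize fibPoly η a = A' at *
  generalize fibPoly η b = B' at *
  generalize fibPoly η c = C' at *
  apply ne_of_lt
  rw [← neg_pos]
  have : 0 < (η + 1) ^ 2 * (A * B * C) + 2 * (η + 1) * (A' * B * C + A * B' * C + A * B * C') +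
      2 * (A' * B' * C + A' * B * C' + A * B' * C') +
      ((A - η * A') * B * C + A * (B - η * B') * C + A * B * (C - η * C')) + 2 * (A + B + C) := by
    positivity
  linarith

end OddCycle

/-! ### Even cycles are not factors -/

section EvenCycle

open DualNumber

/-- `sin (n t)` for the dual angle `t = ψ + ε`. -/
noncomputable def dualSin (ψ : ℝ) (n : ℕ) : ℂ[ε] :=
  TrivSqZeroExt.inl (Real.sin (n * ψ) : ℂ) + TrivSqZeroExt.inr (n * Real.cos (n * ψ) : ℂ)

/-- `cos (n t)` for the dual angle `t = ψ + ε`. -/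
noncomputable def dualCos (ψ : ℝ) (n : ℕ) : ℂ[ε] :=
  TrivSqZeroExt.inl (Real.cos (n * ψ) : ℂ) + TrivSqZeroExt.inr (-(n * Real.sin (n * ψ)) : ℂ)

@[simp] theorem fst_dualSin (ψ : ℝ) (n : ℕ) : (dualSin ψ n).fst = Real.sin (n * ψ) := by
  simp [dualSin]

@[simp] theorem snd_dualSin (ψ : ℝ) (n : ℕ) : (dualSin ψ n).snd = n * Real.cos (n * ψ) := by
  simp [dualSin]

@[simp] theorem fst_dualCos (ψ : ℝ) (n : ℕ) : (dualCos ψ n).fst = Real.cos (n * ψ) := by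
  simp [dualCos]

@[simp] theorem snd_dualCos (ψ : ℝ) (n : ℕ) : (dualCos ψ n).snd = -(n * Real.sin (n * ψ)) := by
  simp [dualCos]

theorem dualSin_zero (ψ : ℝ) : dualSin ψ 0 = 0 := by
  ext <;> simp

theorem dualSin_succ (ψ : ℝ) (n : ℕ) :
    dualSin ψ (n + 1) = dualCos ψ 1 * dualSin ψ n + dualSin ψ 1 * dualCos ψ n := by
  ext
  · simp only [TrivSqZeroExt.fst_add, TrivSqZeroExt.fst_mul, fst_dualSin, fst_dualCos, Nat.cast_one,
      one_mul]
    push_cast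
    rw [add_mul, Complex.sin_add, one_mul]
    ring
  · simp only [TrivSqZeroExt.snd_add, TrivSqZeroExt.snd_mul, snd_dualSin, snd_dualCos, fst_dualSin,
      fst_dualCos, Nat.cast_one, one_mul, smul_eq_mul, MulOpposite.smul_eq_mul_unop,
      MulOpposite.unop_op]
    push_cast
    rw [add_mul (n : ℂ) 1 (ψ : ℂ), Complex.cos_add, one_mul (ψ : ℂ)]
    ring

theorem dualCos_succ (ψ : ℝ) (n : ℕ) :
    dualCos ψ (n + 1) = dualCos ψ 1 * dualCos ψ n - dualSin ψ 1 * dualSin ψ n := by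
  ext
  · simp only [TrivSqZeroExt.fst_sub, TrivSqZeroExt.fst_mul, fst_dualSin, fst_dualCos, Nat.cast_one,
      one_mul]
    push_cast
    rw [add_mul, Complex.cos_add, one_mul]
    ring
  · simp only [TrivSqZeroExt.snd_sub, TrivSqZeroExt.snd_mul, snd_dualSin, snd_dualCos, fst_dualSin,
      fst_dualCos, Nat.cast_one, one_mul, smul_eq_mul, MulOpposite.smul_eq_mul_unop,
      MulOpposite.unop_op]
    push_cast
    rw [add_mul (n : ℂ) 1 (ψ : ℂ), Complex.sin_add, one_mul (ψ : ℂ)]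
    ring

theorem dualCos_sq_add_dualSin_sq (ψ : ℝ) : dualCos ψ 1 ^ 2 + dualSin ψ 1 ^ 2 = 1 := by
  have h := Complex.cos_sq_add_sin_sq (ψ : ℂ)
  ext
  · simp only [pow_two, TrivSqZeroExt.fst_add, TrivSqZeroExt.fst_mul, fst_dualSin, fst_dualCos,
      Nat.cast_one, one_mul, TrivSqZeroExt.fst_one]
    push_cast
    linear_combination h
  · simp only [pow_two, TrivSqZeroExt.snd_add, TrivSqZeroExt.snd_mul, snd_dualSin, snd_dualCos,
      fst_dualSin, fst_dualCos, Nat.cast_one, one_mul, smul_eq_mul, MulOpposite.smul_eq_mul_unop,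
      MulOpposite.unop_op, TrivSqZeroExt.snd_one]
    ring

theorem dualSin_add_two (ψ : ℝ) (n : ℕ) :
    dualSin ψ (n + 2) = 2 * dualCos ψ 1 * dualSin ψ (n + 1) - dualSin ψ n := by
  have h := dualCos_sq_add_dualSin_sq ψ
  rw [dualSin_succ ψ (n + 1), dualCos_succ ψ n, dualSin_succ ψ n]
  linear_combination -dualSin ψ n * h

/-- `F_n (2 i cos t) = i ^ (n - 1) sin (n t) / sin t`. -/
theorem dualSin_mul_fibPoly (ψ : ℝ) {j : ℂ[ε]} (hj : j * j = -1) (n : ℕ) :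
    j * (dualSin ψ 1 * fibPoly (j * (2 * dualCos ψ 1)) n) = j ^ n * dualSin ψ n := by
  induction n using Nat.twoStepInduction with
  | zero => simp [fibPoly, dualSin_zero]
  | one => simp [fibPoly]
  | more n ih1 ih2 =>
    rw [fibPoly, dualSin_add_two]
    linear_combination ih1 + j * (2 * dualCos ψ 1) * ih2 + j ^ n * dualSin ψ n * hj

theorem dualSin_mul_eq_zero {ψ : ℝ} (hψ : Real.sin ψ ≠ 0) {x : ℂ[ε]} (h : dualSin ψ 1 * x = 0) :
    x = 0 := by
  have hu : IsUnit (dualSin ψ 1) := by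
    rw [TrivSqZeroExt.isUnit_iff_isUnit_fst, fst_dualSin, isUnit_iff_ne_zero, Nat.cast_one, one_mul]
    exact_mod_cast hψ
  exact (hu.mul_right_eq_zero).1 h

/-- An even cycle vanishes to second order at `2 i cos (π / 2 - π / k)`, and at the opposite
point. -/
theorem cycleVal_dual_eq_zero {m : ℕ} (hm : m ≠ 0) {ψ : ℝ}
    (hψ : ψ = Real.pi / 2 - Real.pi / (2 * m))
    (hs : Real.sin ψ ≠ 0) {j : ℂ[ε]} (hj : j * j = -1) :
    cycleVal (j * (2 * dualCos ψ 1)) (2 * m) = 0 := by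
  have hangle : ((2 * m : ℕ) : ℝ) * ψ = m * Real.pi - Real.pi := by
    rw [hψ]
    push_cast
    field_simp
  have hc : dualCos ψ (2 * m) = -(-1) ^ m := by
    ext
    · rw [fst_dualCos, hangle, Real.cos_sub_pi, Real.cos_nat_mul_pi]
      simp
    · rw [snd_dualCos, hangle, Real.sin_sub_pi, Real.sin_nat_mul_pi]
      have : ((-1 : ℂ[ε]) ^ m).snd = 0 := by
        rcases neg_one_pow_eq_or ℂ[ε] m with h | h <;> simp [h]
      simp [this]
  have hs0 : dualSin ψ (2 * m + 1) - dualSin ψ (2 * m - 1) =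
      2 * (dualSin ψ 1 * dualCos ψ (2 * m)) := by
    obtain ⟨l, hl⟩ : ∃ l, 2 * m = l + 1 := ⟨2 * m - 1, by omega⟩
    have h := dualCos_sq_add_dualSin_sq ψ
    rw [hl, Nat.add_sub_cancel, dualSin_succ ψ (l + 1), dualCos_succ ψ l, dualSin_succ ψ l]
    linear_combination dualSin ψ l * h
  have hj2 : j ^ (2 * m) = (-1) ^ m := by rw [pow_mul, pow_two, hj]
  have h1 := dualSin_mul_fibPoly ψ hj (2 * m + 1)
  have h2 := dualSin_mul_fibPoly ψ hj (2 * m - 1)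
  have hj3 : j ^ (2 * m + 1) = (-1) ^ m * j := by rw [pow_succ, hj2]
  have hj4 : j ^ (2 * m - 1) = -((-1) ^ m * j) := by
    have : j ^ (2 * m - 1) * j = j ^ (2 * m) := by
      rw [← pow_succ, Nat.sub_add_cancel (by omega)]
    linear_combination (-j) * this - j * hj2 + j ^ (2 * m - 1) * hj
  rw [hj3] at h1
  rw [hj4] at h2
  have hsq : ((-1 : ℂ[ε]) ^ m) * (-1) ^ m = 1 := by rw [← mul_pow]; simp
  apply dualSin_mul_eq_zero hs
  have h3 : j * (dualSin ψ 1 * cycleVal (j * (2 * dualCos ψ 1)) (2 * m)) = 0 := by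
    rw [cycleVal]
    linear_combination h1 + h2 + (-1) ^ m * j * hs0 + 2 * (-1) ^ m * j * dualSin ψ 1 * hc -
      2 * j * dualSin ψ 1 * hsq
  linear_combination (-j) * h3 + dualSin ψ 1 * cycleVal (j * (2 * dualCos ψ 1)) (2 * m) * hj

/-- The theta value at `2 i cos t` split into its even and its odd part, in `j = ± i`. For odd
parameters the powers of `j` that occur here are signs, the same for `j` and `-j`. -/
theorem dualSin_mul_thetaVal (ψ : ℝ) {j : ℂ[ε]} (hj : j * j = -1) {a b c : ℕ} {α β γ : ℂ[ε]}
    (ha : j ^ (a + 1) = α) (hb : j ^ (b + 1) = β) (hc : j ^ (c + 1) = γ) :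
    dualSin ψ 1 ^ 3 * thetaVal (j * (2 * dualCos ψ 1)) a b c =
      2 * (α * β * γ) * (2 * dualCos ψ 1 *
          (dualSin ψ (a + 1) * dualSin ψ (b + 1) * dualSin ψ (c + 1))
        - (dualSin ψ a * dualSin ψ (b + 1) * dualSin ψ (c + 1) +
          dualSin ψ (a + 1) * dualSin ψ b * dualSin ψ (c + 1) +
          dualSin ψ (a + 1) * dualSin ψ (b + 1) * dualSin ψ c)) +
      j * (α * β * γ * ((1 - (2 * dualCos ψ 1) ^ 2) *
          (dualSin ψ (a + 1) * dualSin ψ (b + 1) * dualSin ψ (c + 1)) +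
        2 * (2 * dualCos ψ 1) * (dualSin ψ a * dualSin ψ (b + 1) * dualSin ψ (c + 1) +
          dualSin ψ (a + 1) * dualSin ψ b * dualSin ψ (c + 1) +
          dualSin ψ (a + 1) * dualSin ψ (b + 1) * dualSin ψ c) -
        2 * (dualSin ψ a * dualSin ψ b * dualSin ψ (c + 1) +
          dualSin ψ a * dualSin ψ (b + 1) * dualSin ψ c +
          dualSin ψ (a + 1) * dualSin ψ b * dualSin ψ c) -
        ((2 * dualCos ψ 1 * dualSin ψ a - dualSin ψ (a + 1)) *
            dualSin ψ (b + 1) * dualSin ψ (c + 1) +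
          dualSin ψ (a + 1) * (2 * dualCos ψ 1 * dualSin ψ b - dualSin ψ (b + 1)) *
            dualSin ψ (c + 1) +
          dualSin ψ (a + 1) * dualSin ψ (b + 1) *
            (2 * dualCos ψ 1 * dualSin ψ c - dualSin ψ (c + 1)))) -
        2 * dualSin ψ 1 ^ 2 * (α * dualSin ψ (a + 1) + β * dualSin ψ (b + 1) +
          γ * dualSin ψ (c + 1))) := by
  have key : ∀ {a : ℕ} {α : ℂ[ε]}, j ^ (a + 1) = α →
      dualSin ψ 1 * fibPoly (j * (2 * dualCos ψ 1)) (a + 1) = -(j * α * dualSin ψ (a + 1)) ∧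
      dualSin ψ 1 * fibPoly (j * (2 * dualCos ψ 1)) a = -(α * dualSin ψ a) := by
    intro a α ha
    have h1 := dualSin_mul_fibPoly ψ hj (a + 1)
    have h2 := dualSin_mul_fibPoly ψ hj a
    rw [ha] at h1
    rw [pow_succ] at ha
    refine ⟨?_, ?_⟩
    · linear_combination (-j) * h1 +
        dualSin ψ 1 * fibPoly (j * (2 * dualCos ψ 1)) (a + 1) * hj
    · linear_combination (-j) * h2 + dualSin ψ 1 * fibPoly (j * (2 * dualCos ψ 1)) a * hj -
        dualSin ψ a * ha
  obtain ⟨a1, a2⟩ := key ha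
  obtain ⟨b1, b2⟩ := key hb
  obtain ⟨c1, c2⟩ := key hc
  -- one factor `sin t` for each of the three Fibonacci polynomials
  have expand : dualSin ψ 1 ^ 3 * thetaVal (j * (2 * dualCos ψ 1)) a b c =
      (j * (2 * dualCos ψ 1) - 1) ^ 2 *
        ((dualSin ψ 1 * fibPoly (j * (2 * dualCos ψ 1)) (a + 1)) *
        (dualSin ψ 1 * fibPoly (j * (2 * dualCos ψ 1)) (b + 1)) *
        (dualSin ψ 1 * fibPoly (j * (2 * dualCos ψ 1)) (c + 1))) +
      2 * (j * (2 * dualCos ψ 1) - 1) *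
        ((dualSin ψ 1 * fibPoly (j * (2 * dualCos ψ 1)) a) *
          (dualSin ψ 1 * fibPoly (j * (2 * dualCos ψ 1)) (b + 1)) *
          (dualSin ψ 1 * fibPoly (j * (2 * dualCos ψ 1)) (c + 1)) +
        (dualSin ψ 1 * fibPoly (j * (2 * dualCos ψ 1)) (a + 1)) *
          (dualSin ψ 1 * fibPoly (j * (2 * dualCos ψ 1)) b) *
          (dualSin ψ 1 * fibPoly (j * (2 * dualCos ψ 1)) (c + 1)) +
        (dualSin ψ 1 * fibPoly (j * (2 * dualCos ψ 1)) (a + 1)) *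
          (dualSin ψ 1 * fibPoly (j * (2 * dualCos ψ 1)) (b + 1)) *
          (dualSin ψ 1 * fibPoly (j * (2 * dualCos ψ 1)) c)) +
      2 * ((dualSin ψ 1 * fibPoly (j * (2 * dualCos ψ 1)) a) *
          (dualSin ψ 1 * fibPoly (j * (2 * dualCos ψ 1)) b) *
          (dualSin ψ 1 * fibPoly (j * (2 * dualCos ψ 1)) (c + 1)) +
        (dualSin ψ 1 * fibPoly (j * (2 * dualCos ψ 1)) a) *
          (dualSin ψ 1 * fibPoly (j * (2 * dualCos ψ 1)) (b + 1)) *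
          (dualSin ψ 1 * fibPoly (j * (2 * dualCos ψ 1)) c) +
        (dualSin ψ 1 * fibPoly (j * (2 * dualCos ψ 1)) (a + 1)) *
          (dualSin ψ 1 * fibPoly (j * (2 * dualCos ψ 1)) b) *
          (dualSin ψ 1 * fibPoly (j * (2 * dualCos ψ 1)) c)) +
      ((dualSin ψ 1 * fibPoly (j * (2 * dualCos ψ 1)) (a + 1) -
          j * (2 * dualCos ψ 1) * (dualSin ψ 1 * fibPoly (j * (2 * dualCos ψ 1)) a)) *
          (dualSin ψ 1 * fibPoly (j * (2 * dualCos ψ 1)) (b + 1)) *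
          (dualSin ψ 1 * fibPoly (j * (2 * dualCos ψ 1)) (c + 1)) +
        (dualSin ψ 1 * fibPoly (j * (2 * dualCos ψ 1)) (a + 1)) *
          (dualSin ψ 1 * fibPoly (j * (2 * dualCos ψ 1)) (b + 1) -
          j * (2 * dualCos ψ 1) * (dualSin ψ 1 * fibPoly (j * (2 * dualCos ψ 1)) b)) *
          (dualSin ψ 1 * fibPoly (j * (2 * dualCos ψ 1)) (c + 1)) +
        (dualSin ψ 1 * fibPoly (j * (2 * dualCos ψ 1)) (a + 1)) *
          (dualSin ψ 1 * fibPoly (j * (2 * dualCos ψ 1)) (b + 1)) *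
          (dualSin ψ 1 * fibPoly (j * (2 * dualCos ψ 1)) (c + 1) -
          j * (2 * dualCos ψ 1) * (dualSin ψ 1 * fibPoly (j * (2 * dualCos ψ 1)) c))) +
      2 * dualSin ψ 1 ^ 2 * (dualSin ψ 1 * fibPoly (j * (2 * dualCos ψ 1)) (a + 1) +
        dualSin ψ 1 * fibPoly (j * (2 * dualCos ψ 1)) (b + 1) +
        dualSin ψ 1 * fibPoly (j * (2 * dualCos ψ 1)) (c + 1)) := by
    rw [thetaVal]
    ring
  rw [expand, a1, a2, b1, b2, c1, c2]
  generalize dualSin ψ (a + 1) = sa at *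
  generalize dualSin ψ (b + 1) = sb at *
  generalize dualSin ψ (c + 1) = sc at *
  generalize dualSin ψ a = ta at *
  generalize dualSin ψ b = tb at *
  generalize dualSin ψ c = tc at *
  generalize dualCos ψ 1 = C at *
  clear expand key a1 a2 b1 b2 c1 c2 ha hb hc
  have hj3 : j ^ 3 = -j := by linear_combination j * hj
  have hj4 : j ^ 4 = 1 := by linear_combination (j * j - 1) * hj
  have hj5 : j ^ 5 = j := by linear_combination (j * j - 1) * j * hj
  have hj2 : j ^ 2 = -1 := by linear_combination hj
  ring_nf
  simp only [hj2, hj3, hj4, hj5]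
  ring

theorem dualSin_eq_sub (ψ : ℝ) (n : ℕ) :
    dualSin ψ n = dualCos ψ 1 * dualSin ψ (n + 1) - dualSin ψ 1 * dualCos ψ (n + 1) := by
  rw [dualSin_succ ψ n, dualCos_succ ψ n]
  linear_combination (-dualSin ψ n) * dualCos_sq_add_dualSin_sq ψ

theorem abs_sin_nat_mul_le {ψ : ℝ} (hψ : 0 < Real.sin ψ) (n : ℕ) :
    |Real.sin (n * ψ)| ≤ n * Real.sin ψ := by
  induction n with
  | zero => simp
  | succ n ih =>
    push_cast
    rw [add_mul, one_mul, Real.sin_add]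
    refine (abs_add_le _ _).trans ?_
    rw [abs_mul, abs_mul, abs_of_pos hψ]
    nlinarith [Real.abs_cos_le_one ψ, Real.abs_cos_le_one (n * ψ), abs_nonneg (Real.sin (n * ψ))]

/-- If `cot (A t) + cot (B t) + cot (C t) - cot t` vanishes to second order, then
`A / sin² (A t) + B / sin² (B t) + C / sin² (C t) = 1 / sin² t`, which is too small in view of
`|sin (n t)| ≤ n sin t`. So one, and hence each, of the sines is zero. -/
theorem sin_eq_zero_of_spider {A B C s₀ c₀ s₁ c₁ s₂ c₂ s₃ c₃ : ℝ} (hA : 0 < A) (hB : 0 < B)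
    (hC : 0 < C) (h₀ : 0 < s₀) (e₁ : c₁ ^ 2 + s₁ ^ 2 = 1)
    (e₂ : c₂ ^ 2 + s₂ ^ 2 = 1) (e₃ : c₃ ^ 2 + s₃ ^ 2 = 1)
    (b₁ : s₁ * (c₁ * c₀ + s₁ * s₀) ≤ A * s₀) (b₂ : s₂ * (c₂ * c₀ + s₂ * s₀) ≤ B * s₀)
    (b₃ : s₃ * (c₃ * c₀ + s₃ * s₀) ≤ C * s₀)
    (h : s₀ * (c₁ * s₂ * s₃ + s₁ * c₂ * s₃ + s₁ * s₂ * c₃) = c₀ * (s₁ * s₂ * s₃))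
    (h' : s₀ * (s₁ * s₂ * s₃) - c₀ * (A * c₁ * s₂ * s₃ + B * s₁ * c₂ * s₃ + C * s₁ * s₂ * c₃) +
      c₀ * (c₁ * s₂ * s₃ + s₁ * c₂ * s₃ + s₁ * s₂ * c₃) +
      s₀ * (-(A + B + C) * (s₁ * s₂ * s₃) + c₁ * (B * c₂ * s₃ + C * s₂ * c₃) +
        c₂ * (A * c₁ * s₃ + C * s₁ * c₃) + c₃ * (A * c₁ * s₂ + B * s₁ * c₂)) = 0) :
    s₁ = 0 ∧ s₂ = 0 ∧ s₃ = 0 := by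
  have two : ∀ {A B s₁ c₁ s₂ c₂ s₃ : ℝ}, 0 < A → 0 < B → c₁ ^ 2 + s₁ ^ 2 = 1 →
      c₂ ^ 2 + s₂ ^ 2 = 1 → s₁ = 0 → s₂ = 0 →
      s₀ * ((A + B) * (c₁ * c₂) * s₃) = 0 → s₃ = 0 := by
    intro A B s₁ c₁ s₂ c₂ s₃ hA hB e₁ e₂ h1 h2 h
    subst h1 h2
    have hc₁ : c₁ ≠ 0 := by rintro rfl; norm_num at e₁
    have hc₂ : c₂ ≠ 0 := by rintro rfl; norm_num at e₂
    have : A + B ≠ 0 := by positivity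
    simpa [h₀.ne', hc₁, hc₂, this] using h
  have one : ∀ {c₁ s₂ s₃ : ℝ}, c₁ ^ 2 = 1 → s₀ * (c₁ * s₂ * s₃) = 0 → s₂ = 0 ∨ s₃ = 0 := by
    intro c₁ s₂ s₃ e h
    have hc₁ : c₁ ≠ 0 := by rintro rfl; norm_num at e
    simpa [h₀.ne', hc₁] using h
  by_cases z₁ : s₁ = 0
  · subst z₁
    rcases one (c₁ := c₁) (s₂ := s₂) (s₃ := s₃) (by linarith)
      (by linear_combination h) with z | z <;> subst z
    · exact ⟨rfl, rfl, two (A := A) (B := B) (s₃ := s₃) hA hB e₁ e₂ rfl rfl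
        (by linear_combination h')⟩
    · exact ⟨rfl, two (A := A) (B := C) (s₃ := s₂) hA hC e₁ e₃ rfl rfl
        (by linear_combination h'), rfl⟩
  by_cases z₂ : s₂ = 0
  · subst z₂
    rcases one (c₁ := c₂) (s₂ := s₁) (s₃ := s₃) (by linarith) (by linear_combination h) with z | z
    · exact absurd z z₁
    · subst z
      exact absurd (two (A := B) (B := C) (s₃ := s₁) hB hC e₂ e₃ rfl rfl
        (by linear_combination h')) z₁
  by_cases z₃ : s₃ = 0
  · subst z₃
    rcases one (c₁ := c₃) (s₂ := s₁) (s₃ := s₂) (by linarith) (by linear_combination h) with z | z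
    · exact absurd z z₁
    · exact absurd z z₂
  exfalso
  -- `k₀, …, k₃` are the cotangents
  obtain ⟨k₁, rfl⟩ : ∃ k, c₁ = k * s₁ := ⟨c₁ / s₁, by field_simp⟩
  obtain ⟨k₂, rfl⟩ : ∃ k, c₂ = k * s₂ := ⟨c₂ / s₂, by field_simp⟩
  obtain ⟨k₃, rfl⟩ : ∃ k, c₃ = k * s₃ := ⟨c₃ / s₃, by field_simp⟩
  obtain ⟨k₀, rfl⟩ : ∃ k, c₀ = k * s₀ := ⟨c₀ / s₀, by field_simp⟩
  have hne : s₀ * (s₁ * s₂ * s₃) ≠ 0 := by simp [h₀.ne', z₁, z₂, z₃]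
  have q : k₁ + k₂ + k₃ = k₀ := by
    apply mul_left_cancel₀ hne
    linear_combination h
  have q' : 1 + k₀ ^ 2 = A * (1 + k₁ ^ 2) + B * (1 + k₂ ^ 2) + C * (1 + k₃ ^ 2) := by
    apply mul_left_cancel₀ hne
    subst q
    linear_combination h'
  have bound : ∀ {A s k : ℝ}, s ≠ 0 → (k * s) ^ 2 + s ^ 2 = 1 →
      s * (k * s * (k₀ * s₀) + s * s₀) ≤ A * s₀ → 1 + k * k₀ ≤ A * (1 + k ^ 2) := by
    intro A s k hs e b
    have hpos : 0 < s ^ 2 * s₀ := by positivity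
    refine le_of_mul_le_mul_left ?_ hpos
    linear_combination b - A * s₀ * e
  have := bound z₁ e₁ b₁
  have := bound z₂ e₂ b₂
  have := bound z₃ e₃ b₃
  subst q
  nlinarith

theorem eq_zero_of_dual_add_self {x : ℂ[ε]} (h : x + x = 0) : x = 0 := by
  have h1 := congrArg TrivSqZeroExt.fst h
  have h2 := congrArg TrivSqZeroExt.snd h
  rw [TrivSqZeroExt.fst_add, TrivSqZeroExt.fst_zero, add_self_eq_zero] at h1
  rw [TrivSqZeroExt.snd_add, TrivSqZeroExt.snd_zero, add_self_eq_zero] at h2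
  exact TrivSqZeroExt.ext h1 h2

/-- A theta value with odd parameters does not vanish to second order at both points
`± 2 i cos ψ`. -/
theorem not_thetaVal_dual_eq_zero {ψ : ℝ} (hψ : 0 < Real.sin ψ) {a b c : ℕ} (ha : a % 2 = 1)
    (hb : b % 2 = 1) (hc : c % 2 = 1)
    (h : ∀ j : ℂ[ε], j * j = -1 → thetaVal (j * (2 * dualCos ψ 1)) a b c = 0) : False := by
  obtain ⟨j, hj⟩ : ∃ j : ℂ[ε], j * j = -1 :=
    ⟨TrivSqZeroExt.inl Complex.I, by
      rw [← TrivSqZeroExt.inl_mul, Complex.I_mul_I, TrivSqZeroExt.inl_neg, TrivSqZeroExt.inl_one]⟩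
  have sign : ∀ {a : ℕ}, a % 2 = 1 → ∃ σ : ℝ, (σ = 1 ∨ σ = -1) ∧
      j ^ (a + 1) = TrivSqZeroExt.inl (σ : ℂ) ∧ (-j) ^ (a + 1) = TrivSqZeroExt.inl (σ : ℂ) := by
    intro a ha
    obtain ⟨m, rfl⟩ : ∃ m, a = 2 * m + 1 := ⟨a / 2, by omega⟩
    have e : 2 * m + 1 + 1 = 2 * (m + 1) := by ring
    have hj' : -j * -j = -1 := by rw [neg_mul_neg, hj]
    refine ⟨(-1) ^ (m + 1), neg_one_pow_eq_or ℝ (m + 1), ?_, ?_⟩ <;>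
      rw [e, pow_mul, pow_two] <;> simp only [hj, hj'] <;>
      rcases Nat.even_or_odd (m + 1) with hm | hm <;>
      simp [hm.neg_one_pow, TrivSqZeroExt.inl_neg]
  obtain ⟨σ, hσ, σa, σa'⟩ := sign ha
  obtain ⟨τ, hτ, τb, τb'⟩ := sign hb
  obtain ⟨υ, hυ, υc, υc'⟩ := sign hc
  have h1 := dualSin_mul_thetaVal ψ hj σa τb υc
  have h2 := dualSin_mul_thetaVal ψ (by rw [neg_mul_neg, hj]) σa' τb' υc'
  rw [h j hj, mul_zero] at h1
  rw [h (-j) (by rw [neg_mul_neg, hj]), mul_zero] at h2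
  have hσ2 : (TrivSqZeroExt.inl (σ : ℂ) : ℂ[ε]) * TrivSqZeroExt.inl (σ : ℂ) = 1 := by
    rcases hσ with rfl | rfl <;> simp [TrivSqZeroExt.inl_neg]
  have hτ2 : (TrivSqZeroExt.inl (τ : ℂ) : ℂ[ε]) * TrivSqZeroExt.inl (τ : ℂ) = 1 := by
    rcases hτ with rfl | rfl <;> simp [TrivSqZeroExt.inl_neg]
  have hυ2 : (TrivSqZeroExt.inl (υ : ℂ) : ℂ[ε]) * TrivSqZeroExt.inl (υ : ℂ) = 1 := by
    rcases hυ with rfl | rfl <;> simp [TrivSqZeroExt.inl_neg]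
  rw [dualSin_eq_sub ψ a, dualSin_eq_sub ψ b, dualSin_eq_sub ψ c] at h1 h2
  set α : ℂ[ε] := TrivSqZeroExt.inl (σ : ℂ) with hα
  set β : ℂ[ε] := TrivSqZeroExt.inl (τ : ℂ) with hβ
  set γ : ℂ[ε] := TrivSqZeroExt.inl (υ : ℂ) with hγ
  have hT : (α * β * γ) * (α * β * γ) = 1 := by
    linear_combination β * β * γ * γ * hσ2 + γ * γ * hτ2 + hυ2
  -- the even part, whose vanishing says that the sum of the cotangents is the cotangent of `t`
  have hP : dualSin ψ 1 * (dualCos ψ (a + 1) * dualSin ψ (b + 1) * dualSin ψ (c + 1) +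
      dualSin ψ (a + 1) * dualCos ψ (b + 1) * dualSin ψ (c + 1) +
      dualSin ψ (a + 1) * dualSin ψ (b + 1) * dualCos ψ (c + 1)) =
      dualCos ψ 1 * (dualSin ψ (a + 1) * dualSin ψ (b + 1) * dualSin ψ (c + 1)) := by
    rw [← sub_eq_zero]
    refine eq_zero_of_dual_add_self (eq_zero_of_dual_add_self ?_)
    generalize dualSin ψ (a + 1) = s₁ at *
    generalize dualSin ψ (b + 1) = s₂ at *
    generalize dualSin ψ (c + 1) = s₃ at *
    linear_combination (-(α * β * γ)) * (h1 + h2) -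
      4 * (dualSin ψ 1 * (dualCos ψ (a + 1) * s₂ * s₃ + s₁ * dualCos ψ (b + 1) * s₃ +
        s₁ * s₂ * dualCos ψ (c + 1)) - dualCos ψ 1 * (s₁ * s₂ * s₃)) * hT
  have hP1 := congrArg TrivSqZeroExt.fst hP
  have hP2 := congrArg TrivSqZeroExt.snd hP
  simp only [TrivSqZeroExt.fst_add, TrivSqZeroExt.fst_mul, TrivSqZeroExt.snd_add,
    TrivSqZeroExt.snd_mul, fst_dualSin, fst_dualCos, snd_dualSin, snd_dualCos, Nat.cast_one,
    one_mul, smul_eq_mul, MulOpposite.smul_eq_mul_unop, MulOpposite.unop_op] at hP1 hP2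
  have bound : ∀ n : ℕ, Real.sin ((n : ℕ) * ψ) * (Real.cos ((n : ℕ) * ψ) * Real.cos ψ +
      Real.sin ((n : ℕ) * ψ) * Real.sin ψ) ≤ n * Real.sin ψ := by
    intro n
    rw [← Real.cos_sub]
    refine (le_abs_self _).trans ?_
    rw [abs_mul]
    nlinarith [abs_sin_nat_mul_le hψ n, Real.abs_cos_le_one (n * ψ - ψ),
      abs_nonneg (Real.sin (n * ψ))]
  obtain ⟨z₁, z₂, z₃⟩ := sin_eq_zero_of_spider (A := (a + 1 : ℕ)) (B := (b + 1 : ℕ))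
    (C := (c + 1 : ℕ)) (by positivity) (by positivity) (by positivity) hψ
    (Real.cos_sq_add_sin_sq _) (Real.cos_sq_add_sin_sq _) (Real.cos_sq_add_sin_sq _)
    (bound (a + 1)) (bound (b + 1)) (bound (c + 1)) (by exact_mod_cast hP1) (by
      apply Complex.ofReal_injective
      push_cast at hP2 ⊢
      linear_combination hP2)
  -- the odd part, to first order at a common zero of the three sines
  have z₁' : (dualSin ψ (a + 1)).fst = 0 := by rw [fst_dualSin, z₁, Complex.ofReal_zero]
  have z₂' : (dualSin ψ (b + 1)).fst = 0 := by rw [fst_dualSin, z₂, Complex.ofReal_zero]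
  have z₃' : (dualSin ψ (c + 1)).fst = 0 := by rw [fst_dualSin, z₃, Complex.ofReal_zero]
  have hz : ∀ {x y : ℂ[ε]}, x.fst = 0 → y.fst = 0 → x * y = 0 := by
    intro x y hx hy
    ext <;> simp [hx, hy]
  have p₁₂ := hz z₁' z₂'
  have p₁₃ := hz z₁' z₃'
  have p₂₃ := hz z₂' z₃'
  have hQ : α * β * γ * (dualSin ψ 1 ^ 2 * (dualCos ψ (a + 1) * dualCos ψ (b + 1) *
        dualSin ψ (c + 1) + dualCos ψ (a + 1) * dualSin ψ (b + 1) * dualCos ψ (c + 1) +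
        dualSin ψ (a + 1) * dualCos ψ (b + 1) * dualCos ψ (c + 1))) +
      dualSin ψ 1 ^ 2 * (α * dualSin ψ (a + 1) + β * dualSin ψ (b + 1) +
        γ * dualSin ψ (c + 1)) = 0 := by
    have split : ∀ {X Y : ℂ[ε]}, 0 = X + j * Y → 0 = X + -j * Y → Y = 0 := by
      intro X Y e1 e2
      apply eq_zero_of_dual_add_self
      linear_combination j * e1 - j * e2 + 2 * Y * hj
    have e := split h1 h2
    clear h1 h2 hP hP1 hP2 h
    refine eq_zero_of_dual_add_self ?_
    generalize dualSin ψ (a + 1) = s₁ at *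
    generalize dualSin ψ (b + 1) = s₂ at *
    generalize dualSin ψ (c + 1) = s₃ at *
    generalize dualCos ψ (a + 1) = c₁ at *
    generalize dualCos ψ (b + 1) = c₂ at *
    generalize dualCos ψ (c + 1) = c₃ at *
    generalize dualSin ψ 1 = S at *
    generalize dualCos ψ 1 = C at *
    linear_combination -e + α * β * γ * ((1 - 4 * C ^ 2) * s₁ * p₂₃ +
      (2 * C * (C * s₁ - S * c₁) + s₁) * p₂₃ + (2 * C * (C * s₂ - S * c₂) + s₂) * p₁₃ +
      (2 * C * (C * s₃ - S * c₃) + s₃) * p₁₂ - 6 * C ^ 2 * s₁ * p₂₃ +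
      4 * C * S * (c₁ * p₂₃ + c₂ * p₁₃ + c₃ * p₁₂))
  have hQ2 := congrArg TrivSqZeroExt.snd hQ
  have i : ∀ r : ℝ, (TrivSqZeroExt.inl (r : ℂ) : ℂ[ε]).snd = 0 := fun r => rfl
  have i' : ∀ r : ℝ, (TrivSqZeroExt.inl (r : ℂ) : ℂ[ε]).fst = r := fun r => rfl
  simp only [hα, hβ, hγ, TrivSqZeroExt.fst_add, TrivSqZeroExt.fst_mul, TrivSqZeroExt.snd_add,
    TrivSqZeroExt.snd_mul, pow_two, i, i', fst_dualSin, fst_dualCos, snd_dualSin, snd_dualCos,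
    Nat.cast_one, one_mul, smul_eq_mul, MulOpposite.smul_eq_mul_unop, MulOpposite.unop_op, z₁, z₂,
    z₃, Complex.ofReal_zero, TrivSqZeroExt.snd_zero] at hQ2
  have cosz : ∀ {n : ℕ}, Real.sin (n * ψ) = 0 → Real.cos (n * ψ) = 1 ∨ Real.cos (n * ψ) = -1 := by
    intro n hn
    rwa [Real.sin_eq_zero_iff_cos_eq] at hn
  have hQ3 : Real.sin ψ ^ 2 * (σ * τ * υ * Real.cos ((a + 1 : ℕ) * ψ) *
      Real.cos ((b + 1 : ℕ) * ψ) * Real.cos ((c + 1 : ℕ) * ψ) *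
      ((a + 1 : ℕ) + (b + 1 : ℕ) + (c + 1 : ℕ)) + (σ * (a + 1 : ℕ) * Real.cos ((a + 1 : ℕ) * ψ) +
      τ * (b + 1 : ℕ) * Real.cos ((b + 1 : ℕ) * ψ) +
      υ * (c + 1 : ℕ) * Real.cos ((c + 1 : ℕ) * ψ))) = 0 := by
    apply Complex.ofReal_injective
    push_cast at hQ2 ⊢
    linear_combination hQ2
  have hQ4 := (mul_eq_zero.1 hQ3).resolve_left (by positivity)
  have pa : (0 : ℝ) < (a + 1 : ℕ) := by positivity
  have pb : (0 : ℝ) < (b + 1 : ℕ) := by positivity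
  have pc : (0 : ℝ) < (c + 1 : ℕ) := by positivity
  have hprod : ∀ {s t : ℝ}, (s = 1 ∨ s = -1) → (t = 1 ∨ t = -1) → s * t = 1 ∨ s * t = -1 := by
    rintro s t (rfl | rfl) (rfl | rfl) <;> norm_num
  have x₁ := hprod hσ (cosz z₁)
  have x₂ := hprod hτ (cosz z₂)
  have x₃ := hprod hυ (cosz z₃)
  have hQ5 : (σ * Real.cos ((a + 1 : ℕ) * ψ)) * (τ * Real.cos ((b + 1 : ℕ) * ψ)) *
      (υ * Real.cos ((c + 1 : ℕ) * ψ)) * ((a + 1 : ℕ) + (b + 1 : ℕ) + (c + 1 : ℕ)) +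
      ((a + 1 : ℕ) * (σ * Real.cos ((a + 1 : ℕ) * ψ)) +
      (b + 1 : ℕ) * (τ * Real.cos ((b + 1 : ℕ) * ψ)) +
      (c + 1 : ℕ) * (υ * Real.cos ((c + 1 : ℕ) * ψ))) = 0 := by
    linear_combination hQ4
  -- three signs cannot have pairwise negative products
  rcases x₁ with x₁ | x₁ <;> rcases x₂ with x₂ | x₂ <;> rcases x₃ with x₃ | x₃ <;>
    rw [x₁, x₂, x₃] at hQ5 <;> linarith

/-- A theta value with odd parameters is not a multiple of a cycle value. -/
theorem cycles_eq_zero_of_odd {a b c : ℕ} (ha : a % 2 = 1) (hb : b % 2 = 1) (hc : c % 2 = 1)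
    {ks : Multiset ℕ} (hks : ∀ k ∈ ks, 3 ≤ k)
    (h : ∀ (R : Type) [CommRing R] (y : R), (ks.map fun k => cycleVal y k).prod ∣
      thetaVal y a b c) : ks = 0 := by
  rw [Multiset.eq_zero_iff_forall_notMem]
  intro k hk
  have hk3 := hks k hk
  have zero : ∀ (R : Type) [CommRing R] (y : R), cycleVal y k = 0 → thetaVal y a b c = 0 := by
    intro R _ y hy
    have h0 : (ks.map fun k => cycleVal y k).prod = 0 := by
      obtain ⟨t, ht⟩ := Multiset.dvd_prod (Multiset.mem_map_of_mem (fun k => cycleVal y k) hk)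
      rw [ht, hy, zero_mul]
    have := h R y
    rwa [h0, zero_dvd_iff] at this
  obtain ⟨m, rfl | rfl⟩ := k.even_or_odd'
  -- `4 ≤ k`, so that the angle `π / 2 - π / k` is positive
  · have hm : (2 : ℝ) ≤ m := by
      have : 2 ≤ m := by omega
      exact_mod_cast this
    have hpos : 0 < Real.sin (Real.pi / 2 - Real.pi / (2 * m)) := by
      rw [Real.sin_pi_div_two_sub]
      apply Real.cos_pos_of_mem_Ioo
      have h1 : 0 < Real.pi / (2 * m) := by positivity
      have h2 : Real.pi / (2 * m) < Real.pi / 2 :=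
        div_lt_div_of_pos_left Real.pi_pos (by norm_num) (by linarith)
      constructor <;> linarith
    exact not_thetaVal_dual_eq_zero hpos ha hb hc fun j hj =>
      zero _ _ (cycleVal_dual_eq_zero (by omega) rfl hpos.ne' hj)
  · obtain ⟨η, hη, h0⟩ := exists_cycleVal_neg_eq_zero (k := 2 * m + 1) (by omega)
    exact thetaVal_neg_ne_zero hη ha hb hc (zero _ _ h0)

end EvenCycle

/-! ### Theta values determine the lengths -/

section Lengths

/-- The numerator of `thetaVal y a b c` at `y = X⁻¹ - X`, in terms of the lengths `A = a + 1`,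
`B = b + 1` and `C = c + 1`. -/
noncomputable def thetaNum (A B C : ℕ) : ℤ[X] :=
  (1 - X + 2 * X ^ 2) ^ 2 +
  (X ^ (A + B) + X ^ (A + C) + X ^ (B + C)) * (2 * (1 + X ^ 2) ^ 2) -
  (X ^ (2 * A + 2) * ((1 - X) ^ 2 * (-1) ^ A) + X ^ (2 * B + 2) * ((1 - X) ^ 2 * (-1) ^ B) +
    X ^ (2 * C + 2) * ((1 - X) ^ 2 * (-1) ^ C)) +
  (X ^ (2 * A + 2 * B) * ((1 + X) ^ 2 * (-1) ^ (A + B)) +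
    X ^ (2 * A + 2 * C) * ((1 + X) ^ 2 * (-1) ^ (A + C)) +
    X ^ (2 * B + 2 * C) * ((1 + X) ^ 2 * (-1) ^ (B + C))) -
  X ^ (2 * A + 2 * B + 2 * C) * ((2 + X + X ^ 2) ^ 2 * (-1) ^ (A + B + C)) -
  (X ^ (2 * A + B + C) * (2 * (1 + X ^ 2) ^ 2 * (-1) ^ A) +
    X ^ (A + 2 * B + C) * (2 * (1 + X ^ 2) ^ 2 * (-1) ^ B) +
    X ^ (A + B + 2 * C) * (2 * (1 + X ^ 2) ^ 2 * (-1) ^ C))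

theorem mul_fibPoly_inv_sub {K : Type*} [Field K] {e : K} (he : e ≠ 0) (k : ℕ) :
    (1 + e ^ 2) * e ^ k * fibPoly (e⁻¹ - e) (k + 1) = 1 - (-1) ^ (k + 1) * e ^ (2 * (k + 1)) ∧
    (1 + e ^ 2) * e ^ (k + 1) * fibPoly (e⁻¹ - e) k =
      e ^ 2 + (-1) ^ (k + 1) * e ^ (2 * (k + 1)) := by
  induction k with
  | zero => simp [fibPoly]
  | succ k ih =>
    obtain ⟨h1, h2⟩ := ih
    have hy : e * (e⁻¹ - e) = 1 - e ^ 2 := by field_simp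
    refine ⟨?_, ?_⟩
    · rw [fibPoly]
      linear_combination e * (e⁻¹ - e) * h1 + h2 +
        (1 - (-1) ^ (k + 1) * e ^ (2 * (k + 1))) * hy
    · linear_combination e ^ 2 * h1

/-- At `y = e⁻¹ - e` the theta value is a polynomial in `e`, up to a factor that depends only on the
number of vertices. -/
theorem mul_thetaVal_inv_sub {K : Type*} [Field K] {e : K} (he : e ≠ 0) (a b c : ℕ) :
    (1 + e ^ 2) ^ 3 * e ^ (a + b + c + 2) * thetaVal (e⁻¹ - e) a b c =
      aeval e (thetaNum (a + 1) (b + 1) (c + 1)) := by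
  obtain ⟨a1, a2⟩ := mul_fibPoly_inv_sub he a
  obtain ⟨b1, b2⟩ := mul_fibPoly_inv_sub he b
  obtain ⟨c1, c2⟩ := mul_fibPoly_inv_sub he c
  have hy : e * (e⁻¹ - e) = 1 - e ^ 2 := by field_simp
  -- one factor `1 + e ^ 2` and a power of `e` for each of the three Fibonacci polynomials
  have expand : (1 + e ^ 2) ^ 3 * e ^ (a + b + c + 2) * thetaVal (e⁻¹ - e) a b c =
      (e * (e⁻¹ - e) - e) ^ 2 * (((1 + e ^ 2) * e ^ a * fibPoly (e⁻¹ - e) (a + 1)) *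
        ((1 + e ^ 2) * e ^ b * fibPoly (e⁻¹ - e) (b + 1)) *
        ((1 + e ^ 2) * e ^ c * fibPoly (e⁻¹ - e) (c + 1))) +
      2 * (e * (e⁻¹ - e) - e) *
        (((1 + e ^ 2) * e ^ (a + 1) * fibPoly (e⁻¹ - e) a) *
          ((1 + e ^ 2) * e ^ b * fibPoly (e⁻¹ - e) (b + 1)) *
          ((1 + e ^ 2) * e ^ c * fibPoly (e⁻¹ - e) (c + 1)) +
        ((1 + e ^ 2) * e ^ a * fibPoly (e⁻¹ - e) (a + 1)) *
          ((1 + e ^ 2) * e ^ (b + 1) * fibPoly (e⁻¹ - e) b) *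
          ((1 + e ^ 2) * e ^ c * fibPoly (e⁻¹ - e) (c + 1)) +
        ((1 + e ^ 2) * e ^ a * fibPoly (e⁻¹ - e) (a + 1)) *
          ((1 + e ^ 2) * e ^ b * fibPoly (e⁻¹ - e) (b + 1)) *
          ((1 + e ^ 2) * e ^ (c + 1) * fibPoly (e⁻¹ - e) c)) +
      2 * (((1 + e ^ 2) * e ^ (a + 1) * fibPoly (e⁻¹ - e) a) *
          ((1 + e ^ 2) * e ^ (b + 1) * fibPoly (e⁻¹ - e) b) *
          ((1 + e ^ 2) * e ^ c * fibPoly (e⁻¹ - e) (c + 1)) +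
        ((1 + e ^ 2) * e ^ (a + 1) * fibPoly (e⁻¹ - e) a) *
          ((1 + e ^ 2) * e ^ b * fibPoly (e⁻¹ - e) (b + 1)) *
          ((1 + e ^ 2) * e ^ (c + 1) * fibPoly (e⁻¹ - e) c) +
        ((1 + e ^ 2) * e ^ a * fibPoly (e⁻¹ - e) (a + 1)) *
          ((1 + e ^ 2) * e ^ (b + 1) * fibPoly (e⁻¹ - e) b) *
          ((1 + e ^ 2) * e ^ (c + 1) * fibPoly (e⁻¹ - e) c)) +
      ((e ^ 2 * ((1 + e ^ 2) * e ^ a * fibPoly (e⁻¹ - e) (a + 1)) -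
          e * (e⁻¹ - e) * ((1 + e ^ 2) * e ^ (a + 1) * fibPoly (e⁻¹ - e) a)) *
          ((1 + e ^ 2) * e ^ b * fibPoly (e⁻¹ - e) (b + 1)) *
          ((1 + e ^ 2) * e ^ c * fibPoly (e⁻¹ - e) (c + 1)) +
        ((1 + e ^ 2) * e ^ a * fibPoly (e⁻¹ - e) (a + 1)) *
          (e ^ 2 * ((1 + e ^ 2) * e ^ b * fibPoly (e⁻¹ - e) (b + 1)) -
          e * (e⁻¹ - e) * ((1 + e ^ 2) * e ^ (b + 1) * fibPoly (e⁻¹ - e) b)) *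
          ((1 + e ^ 2) * e ^ c * fibPoly (e⁻¹ - e) (c + 1)) +
        ((1 + e ^ 2) * e ^ a * fibPoly (e⁻¹ - e) (a + 1)) *
          ((1 + e ^ 2) * e ^ b * fibPoly (e⁻¹ - e) (b + 1)) *
          (e ^ 2 * ((1 + e ^ 2) * e ^ c * fibPoly (e⁻¹ - e) (c + 1)) -
          e * (e⁻¹ - e) * ((1 + e ^ 2) * e ^ (c + 1) * fibPoly (e⁻¹ - e) c))) +
      2 * (1 + e ^ 2) ^ 2 *
        (e ^ (b + 1) * e ^ (c + 1) * ((1 + e ^ 2) * e ^ a * fibPoly (e⁻¹ - e) (a + 1)) +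
        e ^ (a + 1) * e ^ (c + 1) * ((1 + e ^ 2) * e ^ b * fibPoly (e⁻¹ - e) (b + 1)) +
        e ^ (a + 1) * e ^ (b + 1) * ((1 + e ^ 2) * e ^ c * fibPoly (e⁻¹ - e) (c + 1))) := by
    rw [thetaVal]
    generalize e⁻¹ - e = y
    ring
  rw [expand, a1, a2, b1, b2, c1, c2, hy]
  simp only [thetaNum, map_add, map_sub, map_mul, map_pow, map_one, map_neg, aeval_X, map_ofNat]
  simp only [pow_add, pow_mul']
  generalize e ^ a = x
  generalize e ^ b = y
  generalize e ^ c = z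
  generalize (-1 : K) ^ a = s
  generalize (-1 : K) ^ b = t
  generalize (-1 : K) ^ c = u
  ring

/-- The substitution `y = X⁻¹ - X` is made in the fraction field of `ℤ[X]`. -/
theorem thetaNum_eq_of_thetaVal_eq {a b c a' b' c' : ℕ} (hs : a + b + c = a' + b' + c')
    (h : ∀ (R : Type) [CommRing R] (y : R), thetaVal y a b c = thetaVal y a' b' c') :
    thetaNum (a + 1) (b + 1) (c + 1) = thetaNum (a' + 1) (b' + 1) (c' + 1) := by
  have he : algebraMap ℤ[X] (FractionRing ℤ[X]) X ≠ 0 := by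
    simp [Polynomial.X_ne_zero]
  have h1 := mul_thetaVal_inv_sub he a b c
  rw [h, hs, mul_thetaVal_inv_sub he a' b' c', aeval_algebraMap_apply, aeval_algebraMap_apply] at h1
  have := IsFractionRing.injective ℤ[X] (FractionRing ℤ[X]) h1
  simpa using this.symm

theorem coeff_X_pow_mul_of_lt {R : Type*} [Semiring R] {m k : ℕ} (p : R[X]) (h : m < k) :
    (X ^ k * p).coeff m = 0 := by
  rw [coeff_X_pow_mul', if_neg (by omega)]

theorem coeff_X_pow_mul_self {R : Type*} [Semiring R] (k : ℕ) (p : R[X]) :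
    (X ^ k * p).coeff k = p.coeff 0 := by
  rw [coeff_X_pow_mul', if_pos le_rfl, Nat.sub_self]

theorem coeff_two_mul_sq_zero : (2 * (1 + X ^ 2) ^ 2 : ℤ[X]).coeff 0 = 2 := by
  simp [coeff_zero_eq_eval_zero]

theorem coeff_X_pow_mul_two_sq (k m : ℕ) :
    0 ≤ (X ^ k * (2 * (1 + X ^ 2) ^ 2) : ℤ[X]).coeff m ∧
      (X ^ k * (2 * (1 + X ^ 2) ^ 2) : ℤ[X]).coeff m % 2 = 0 := by
  have h : (2 * (1 + X ^ 2) ^ 2 : ℤ[X]) = C 2 + C 4 * X ^ 2 + C 2 * X ^ 4 := by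
    simp only [map_ofNat]
    ring
  rw [coeff_X_pow_mul']
  split_ifs
  · rw [h]
    simp only [coeff_add, coeff_C, coeff_C_mul, coeff_X_pow]
    split_ifs <;> simp
  · simp

theorem coeff_zero_emod_two (A : ℕ) : ((1 - X) ^ 2 * (-1) ^ A : ℤ[X]).coeff 0 % 2 = 1 := by
  rcases neg_one_pow_eq_or ℤ[X] A with h | h <;> rw [h] <;> simp [coeff_zero_eq_eval_zero]

/-- The smallest length is read off from the lowest terms of the numerator. -/
theorem not_lt_of_thetaNum_eq {A B C A' B' C' : ℕ} (hA : 1 ≤ A) (hB : 2 ≤ B) (hAB : A ≤ B)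
    (hBC : B ≤ C) (hAB' : A' ≤ B') (hBC' : B' ≤ C')
    (h : thetaNum A B C = thetaNum A' B' C') : ¬ A < A' := by
  intro hlt
  by_cases hcase : B ≤ A + 1
  -- the lowest term is `2 X ^ (A + B)`; on the right hand side all terms are higher
  · have hm := congrArg (fun p => coeff p (A + B)) h
    simp (disch := omega) only [thetaNum, add_mul, coeff_add, coeff_sub, coeff_X_pow_mul_of_lt,
      coeff_X_pow_mul_self, coeff_two_mul_sq_zero] at hm
    have h1 := coeff_X_pow_mul_two_sq (A + C) (A + B)
    have h2 := coeff_X_pow_mul_two_sq (B + C) (A + B)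
    omega
  -- at `X ^ (2 A + 2)` the coefficient is odd on the left and even on the right hand side
  · have hm := congrArg (fun p => coeff p (2 * A + 2)) h
    simp (disch := omega) only [thetaNum, add_mul, coeff_add, coeff_sub, coeff_X_pow_mul_of_lt,
      coeff_X_pow_mul_self] at hm
    have h1 := coeff_X_pow_mul_two_sq (A + B) (2 * A + 2)
    have h2 := coeff_X_pow_mul_two_sq (A + C) (2 * A + 2)
    have h3 := coeff_X_pow_mul_two_sq (B + C) (2 * A + 2)
    have h4 := coeff_X_pow_mul_two_sq (A' + B') (2 * A + 2)
    have h5 := coeff_X_pow_mul_two_sq (A' + C') (2 * A + 2)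
    have h6 := coeff_X_pow_mul_two_sq (B' + C') (2 * A + 2)
    have h7 := coeff_zero_emod_two A
    omega

/-- For a given smallest length the second one is read off from the lowest terms that differ. -/
theorem not_lt_of_thetaNum_eq_of_left {A B C B' C' : ℕ} (hA : 1 ≤ A) (hAB : A ≤ B) (hBC' : B' ≤ C')
    (hs : B + C = B' + C') (h : thetaNum A B C = thetaNum A B' C') : ¬ B < B' := by
  intro hlt
  have hm := congrArg (fun p => coeff p (A + B)) h
  simp (disch := omega) only [thetaNum, add_mul, coeff_add, coeff_sub, coeff_X_pow_mul_of_lt,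
    coeff_X_pow_mul_self, coeff_two_mul_sq_zero] at hm
  omega

/-- Theta graphs of the same order with the same theta value have the same lengths. -/
theorem eq_of_thetaVal_eq {a b c a' b' c' : ℕ} (hs : a + b + c = a' + b' + c') (hab : a ≤ b)
    (hbc : b ≤ c) (hb : b ≠ 0) (hab' : a' ≤ b') (hbc' : b' ≤ c') (hb' : b' ≠ 0)
    (h : ∀ (R : Type) [CommRing R] (y : R), thetaVal y a b c = thetaVal y a' b' c') :
    a = a' ∧ b = b' ∧ c = c' := by
  have hN := thetaNum_eq_of_thetaVal_eq hs h
  have h1 := not_lt_of_thetaNum_eq (by omega) (by omega) (by omega) (by omega) (by omega) (by omega)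
    hN
  have h2 := not_lt_of_thetaNum_eq (by omega) (by omega) (by omega) (by omega) (by omega) (by omega)
    hN.symm
  obtain rfl : a = a' := by omega
  have h3 := not_lt_of_thetaNum_eq_of_left (by omega) (by omega) (by omega) (by omega) hN
  have h4 := not_lt_of_thetaNum_eq_of_left (by omega) (by omega) (by omega) (by omega) hN.symm
  omega

end Lengths

/-! ### Theta graphs are determined -/

/-- The paths of a theta graph can be listed by length; all but possibly the first then have inner
vertices. -/
theorem IsTheta.exists_sorted {W : Type*} [Fintype W] [DecidableEq W] {G : SimpleGraph W}
    [DecidableRel G.Adj] {u v : W} {L : Fin 3 → ℕ} {w : Fin 3 → ℕ → W} (h : IsTheta G u v L w)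
    (hu : G.degree u = 3) :
    ∃ e : Equiv.Perm (Fin 3), L (e 0) ≤ L (e 1) ∧ L (e 1) ≤ L (e 2) ∧ L (e 1) ≠ 0 := by
  have hm := Tuple.monotone_sort L
  have h01 : L (Tuple.sort L 0) ≤ L (Tuple.sort L 1) := hm (by decide)
  refine ⟨Tuple.sort L, h01, hm (by decide), fun h1 => ?_⟩
  have := (Tuple.sort L).injective
    (h.eq_of_length_zero hu (show L (Tuple.sort L 0) = 0 by omega) h1)
  exact absurd this (by decide)

theorem sum_comp_perm (L : Fin 3 → ℕ) (e : Equiv.Perm (Fin 3)) :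
    L (e 0) + L (e 1) + L (e 2) = L 0 + L 1 + L 2 := by
  rw [← Fin.sum_univ_three L, ← Equiv.sum_comp e, Fin.sum_univ_three]

theorem theorem1p2 (p q r : ℕ)
    (hpq : p ≠ 0 ∨ q ≠ 0) (hpr : p ≠ 0 ∨ r ≠ 0) (hqr : q ≠ 0 ∨ r ≠ 0)
    {W : Type*} [Fintype W] [DecidableEq W] (H : SimpleGraph W) [DecidableRel H.Adj]
    (h : LaplacianCopermanental H (thetaGraph p q r)) :
    Nonempty (H ≃g thetaGraph p q r) := by
  obtain ⟨hcard, u, v, huv, hu, hv, hdeg⟩ := exists_degrees_of_copermanental hpq hpr hqr H h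
  have hperm : ∀ (R : Type) [CommRing R] (y : R), permOn (shiftMat H y) Finset.univ =
      permOn (shiftMat (thetaGraph p q r) y) Finset.univ := by
    intro R _ y
    rw [← eval₂_lapPermPoly, ← eval₂_lapPermPoly, show lapPermPoly H = _ from h]
  obtain ⟨d0, d1⟩ := thetaGraph_degree_ends hpq hpr hqr
  have hθ := isTheta_thetaGraph (p := p) (q := q) (r := r)
  obtain ⟨e, e01, e12, e1⟩ := hθ.exists_sorted d0
  obtain ⟨ks', hk3', hks', hval'⟩ := (hθ.comp e).exists_cycles d0 d1
    (fun s => thetaGraph_degree_inner) e1 (by simp only [Function.comp_apply]; omega)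
  simp only [Function.comp_apply] at hks' hval'
  have hsum : ![p, q, r] (e 0) + ![p, q, r] (e 1) + ![p, q, r] (e 2) = p + q + r :=
    sum_comp_perm _ e
  rw [card_thetaVertex, hsum] at hks'
  obtain rfl : ks' = 0 := by
    by_contra hne
    obtain ⟨k, hk⟩ := Multiset.exists_mem_of_ne_zero hne
    have := Multiset.le_sum_of_mem hk
    have := hk3' k hk
    omega
  simp only [Multiset.map_zero, Multiset.prod_zero, mul_one] at hval'
  generalize hα : ![p, q, r] (e 0) = α at *
  generalize hβ : ![p, q, r] (e 1) = β at *
  generalize hγ : ![p, q, r] (e 2) = γ at *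
  rcases exists_theta_or_dumbbell huv hu hv hdeg with ⟨L, w, hL⟩ | ⟨a, b, c, wa, wb, wc, hD⟩
  · obtain ⟨f, f01, f12, f1⟩ := hL.exists_sorted hu
    obtain ⟨ks, hk3, hks, hval⟩ := (hL.comp f).exists_cycles hu hv hdeg f1
      (by simp only [Function.comp_apply]; omega)
    simp only [Function.comp_apply] at hks hval
    have key : ∀ (R : Type) [CommRing R] (y : R), thetaVal y α β γ =
        thetaVal y (L (f 0)) (L (f 1)) (L (f 2)) * (ks.map fun k => cycleVal y k).prod :=
      fun R _ y => by rw [← hval', ← hperm, hval]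
    obtain rfl := cycles_eq_zero_of_thetaVal_eq hk3 (by omega) (key _ _) fun ha hb hc =>
      cycles_eq_zero_of_odd ha hb hc hk3 fun R _ y => ⟨_, by rw [key, mul_comm]⟩
    simp only [Multiset.map_zero, Multiset.prod_zero, mul_one] at key
    rw [Multiset.sum_zero] at hks
    obtain ⟨h0, h1, h2⟩ := eq_of_thetaVal_eq (by omega) e01 e12 e1 f01 f12 f1 key
    have hLe : L ∘ (f * e⁻¹ : Equiv.Perm (Fin 3)) = ![p, q, r] := by
      have hfe : ∀ i, L (f i) = ![p, q, r] (e i) := by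
        intro i
        fin_cases i
        · exact (hα.trans h0).symm
        · exact (hβ.trans h1).symm
        · exact (hγ.trans h2).symm
      funext i
      rw [Function.comp_apply, Equiv.Perm.mul_apply, hfe, Equiv.Perm.inv_def,
        Equiv.apply_symm_apply]
    have hfin := hL.comp (f * e⁻¹)
    rw [hLe] at hfin
    exact hfin.nonempty_iso hcard
  · obtain ⟨ks, hk3, hks, hval⟩ := hD.exists_cycles hu hv hdeg
    have key : ∀ (R : Type) [CommRing R] (y : R), thetaVal y α β γ =
        dumbbellVal y a b c * (ks.map fun k => cycleVal y k).prod :=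
      fun R _ y => by rw [← hval', ← hperm, hval]
    exact absurd (key _ _) (thetaVal_ne_dumbbellVal hk3 (hD.loop_left.two_le rfl)
      (hD.loop_right.two_le rfl) (by omega) fun ha hb hc =>
      cycles_eq_zero_of_odd ha hb hc hk3 fun R _ y => ⟨_, by rw [key, mul_comm]⟩)
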